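/- Given a closed geodesic $\gamma$ of length $\ell$ on a hyperbolic surface $X$ and $w>0$, write $C_w(\gamma)=\{x\in X:\operatorname{dist}(x,\gamma)\le w\}$ for the collar of width $w$ around $\gamma$, and call it standard if it is isometric to the cylinder $[-w,w]\times\mathbb{R}/\mathbb{Z}$ with the Riemannian metric $d\rho^2+\ell^2\cosh^2(\rho)\,dt^2$. Let $\Delta$ be the positive Laplacian of $X$ and $\langle u,v\rangle=\int_X uv$ the $L^2$ inner product for the hyperbolic area. For every $w>0$ there exist constants $\varepsilon>0$ and $B>0$, depending only on $w$, such that the following holds. Let $X$ be a closed (connected) hyperbolic surface and let $\gamma_1,\dots,\gamma_k\subset X$ be closed geodesics of length $\ell$ such that the collars $C_w(\gamma_1),\dots,C_w(\gamma_k)$ are standard and pairwise disjoint. Let $f:X\to\mathbb{R}$ be a Laplacian eigenfunction of eigenvalue $\lambda>0$ with $\|f\|_{L^2}=1$, and suppose that $\|f\|_\infty^2\cdot\ell<\varepsilon$. Then there exists a smooth function $f':X\to\mathbb{R}$, not identically zero, such that $$f'|_{C_{w/2}(\gamma_i)}\equiv 0\ \text{ for } i=1,\dots,k,\qquad f'=f\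 \text{ on } X\setminus\bigcup_{i=1}^k C_w(\gamma_i),$$ and $$\frac{\langle\Delta f',f'\rangle}{\langle f',f'\rangle}-\lambda\le B\cdot\|f\|_\infty^2\cdot\ell\cdot k .$$ -/

import Mathlib

open UpperHalfPlane
open scoped ContDiff

noncomputable section

namespace HypSurface

/-- The group `PGL(2, ℝ)` of all isometries of the hyperbolic plane, as transformations of `ℍ`:
the maps `z ↦ (a z + b) / (c z + d)` with `a d - b c > 0` and
`z ↦ (a z̄ + b) / (c z̄ + d)` with `a d - b c < 0`. -/
def isometryGroup : Subgroup (Equiv.Perm ℍ) :=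
  (MulAction.toPermHom (GL (Fin 2) ℝ) ℍ).range

/-- The orbit space `Γ \ ℍ`. -/
abbrev Surface (Γ : Subgroup (Equiv.Perm ℍ)) : Type :=
  MulAction.orbitRel.Quotient Γ ℍ

/-- The projection `ℍ → Γ \ ℍ`. -/
def proj (Γ : Subgroup (Equiv.Perm ℍ)) (z : ℍ) : Surface Γ :=
  Quotient.mk _ z

/-- `Γ` is the deck group of a closed hyperbolic surface `Γ \ ℍ` (orientable or not): a group of
isometries of `ℍ` that acts freely, properly discontinuously and cocompactly. -/
structure IsClosedSurfaceGroup (Γ : Subgroup (Equiv.Perm ℍ)) : Prop where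
  le_isometryGroup : Γ ≤ isometryGroup
  free : ∀ γ ∈ Γ, ∀ z : ℍ, γ z = z → γ = 1
  properlyDiscontinuous : ∀ K : Set ℍ, IsCompact K →
    {γ : Equiv.Perm ℍ | γ ∈ Γ ∧ (γ '' K ∩ K).Nonempty}.Finite
  cocompact : ∃ K : Set ℍ, IsCompact K ∧ proj Γ '' K = Set.univ

variable (Γ : Subgroup (Equiv.Perm ℍ))

/-- The Dirichlet fundamental domain of `Γ` centred at `i`. -/
def dirichletDomain : Set ℍ :=
  {z | ∀ γ ∈ Γ, dist z UpperHalfPlane.I ≤ dist z (γ UpperHalfPlane.I)}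

/-- The integral of a function over `Γ \ ℍ` against the hyperbolic area `dx dy / y²`
(which is `volume` on `ℍ`). -/
def integral (u : Surface Γ → ℝ) : ℝ :=
  ∫ z in dirichletDomain Γ, u (proj Γ z)

/-- The `L²` inner product of real functions on `Γ \ ℍ`. -/
def inner (u v : Surface Γ → ℝ) : ℝ :=
  integral Γ fun x => u x * v x

/-- A function on `Γ \ ℍ` is smooth if its lift to `ℍ` is smooth. -/
def IsSmooth (u : Surface Γ → ℝ) : Prop :=
  ContDiffOn ℝ ∞ (fun w : ℂ => u (proj Γ (ofComplex w))) {w : ℂ | 0 < w.im}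

/-- The positive hyperbolic Laplacian `- y² (∂²/∂x² + ∂²/∂y²)` on `ℍ`. -/
def planeLaplacian (u : ℍ → ℝ) (z : ℍ) : ℝ :=
  -(z.im ^ 2 * Laplacian.laplacian (fun w : ℂ => u (ofComplex w)) (z : ℂ))

/-- The positive Laplacian of `Γ \ ℍ`, computed at any point above `x`: for smooth `u` the
result does not depend on that point, since `Γ` acts by isometries. -/
def laplacian (u : Surface Γ → ℝ) (x : Surface Γ) : ℝ :=
  planeLaplacian (fun z => u (proj Γ z)) (Quotient.out x)

/-- `f` is a Laplacian eigenfunction of eigenvalue `μ` with `‖f‖_{L²} = 1`. -/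
structure IsNormalizedEigenfunction (μ : ℝ) (f : Surface Γ → ℝ) : Prop where
  smooth : IsSmooth Γ f
  eigen : ∀ x, laplacian Γ f x = μ * f x
  normalized : inner Γ f f = 1

/-- The Rayleigh quotient `⟨Δ u, u⟩ / ⟨u, u⟩`. -/
def rayleigh (u : Surface Γ → ℝ) : ℝ :=
  inner Γ (laplacian Γ u) u / inner Γ u u

/-- The supremum norm. -/
def supNorm (u : Surface Γ → ℝ) : ℝ :=
  ⨆ x : Surface Γ, |u x|

/-- The hyperbolic distance on `Γ \ ℍ`: the infimum of the distances of lifts. -/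
def surfaceDist (x y : Surface Γ) : ℝ :=
  sInf {d : ℝ | ∃ z w : ℍ, proj Γ z = x ∧ proj Γ w = y ∧ d = dist z w}

/-- `c` is a closed geodesic of length `ℓ` on `Γ \ ℍ`, parametrized by arc length: it lifts to a
complete unit speed geodesic of `ℍ` and closes up after time `ℓ`. -/
structure IsClosedGeodesic (ℓ : ℝ) (c : ℝ → Surface Γ) : Prop where
  length_pos : 0 < ℓ
  geodesic : ∃ g : ℝ → ℍ, Isometry g ∧ ∀ t, c t = proj Γ (g t)
  closed : ∀ t, c (t + ℓ) = c t

/-- The collar `{x | dist(x, c) ≤ w}` of width `w` around the curve `c`. -/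
def collar (w : ℝ) (c : ℝ → Surface Γ) : Set (Surface Γ) :=
  {x | (⨅ t : ℝ, surfaceDist Γ x (c t)) ≤ w}

/-- The parameter domain `[-w, w] × ℝ` of the universal cover of the cylinder `[-w, w] × ℝ/ℤ`. -/
def strip (w : ℝ) : Set (ℝ × ℝ) :=
  Set.Icc (-w) w ×ˢ Set.univ

/-- The collar of width `w` around a closed geodesic `c` of length `ℓ` is standard: there is a
Riemannian isometry `Φ` onto it from the cylinder `[-w, w] × ℝ/ℤ` with the metric
`dρ² + ℓ² cosh²(ρ) dt²`.

`Φ` is a bijection onto the collar; that it is smooth and isometric is expressed by its lift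
`F : [-w, w] × ℝ → ℍ` to universal covers, which is smooth and pulls the hyperbolic metric
`|dz|² / (Im z)²` back to `dρ² + ℓ² cosh²(ρ) dt²`. -/
def IsStandardCollar (w ℓ : ℝ) (c : ℝ → Surface Γ) : Prop :=
  ∃ Φ : ℝ × UnitAddCircle → Surface Γ,
    Set.BijOn Φ (Set.Icc (-w) w ×ˢ Set.univ) (collar Γ w c) ∧
    ∃ F : ℝ × ℝ → ℍ,
      (∀ p ∈ strip w, Φ (p.1, (p.2 : UnitAddCircle)) = proj Γ (F p)) ∧
      ContDiffOn ℝ ∞ (fun p => (F p : ℂ)) (strip w) ∧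
      ∀ p ∈ strip w, ∀ v : ℝ × ℝ,
        ‖fderivWithin ℝ (fun q => (F q : ℂ)) (strip w) p v‖ ^ 2 / (F p).im ^ 2 =
          v.1 ^ 2 + ℓ ^ 2 * Real.cosh p.1 ^ 2 * v.2 ^ 2

end HypSurface

end

noncomputable section

namespace HypSurface

open MeasureTheory Set Filter Topology
open scoped ENNReal Pointwise

/-! ### Isometries of the hyperbolic plane and the Laplacian -/

/-! The function `f'` is `f` times a radial profile `φ` that vanishes on slightly more than the half
collars and is `1` near the boundary of the full collars. Integration by parts turns `⟨Δf', f'⟩ -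
μ⟨f', f'⟩` into the integral of `|∇φ|² f²`. This lives in `k` collars of area `2 ℓ sinh w` each, so
it is at most a constant times `‖f‖∞² ℓ k`, and if `⟨f', f'⟩ ≥ 1/2` the theorem follows.

Since `k` is arbitrary, the collars may carry most of the mass of `f`. If `⟨f', f'⟩ < 1/2`, they
carry more than half of it, which bounds `‖f‖∞² ℓ k` from below. It then suffices to bound the
excess of the Rayleigh quotient by a constant, that is, to show that the integral of `|∇φ|² f²` over
a collar is at most `K` times the mass of `f'` there, with `K` independent of `μ`. `quotient_le`
combines the two cases.

The uniform bound is the analytic core (`exists_mass_weight`, `exists_cutoff`). In the conformal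
coordinates `z = i exp (s + i τ)` the equation reads `v_ττ + v_ss = -μ v / cos² τ`. The factor `1 /
cos² τ` increases away from the core `τ = 0`, so a virial identity with the vector field `sin τ ∂_τ`
has positive terms near the core. Cutting the field off makes a gradient term of the wrong sign,
which a multiple of the energy identity absorbs. What remains is `∫ W v² ≤ 0`, where `W` is at least
`c (1 + μ)` on the support of `φ'` and at least `-N (1 + μ)` everywhere. The factors `1 + μ` cancel,
so the mass where `φ'` lives is controlled by the mass near the boundary of the collar, where `φ =
1`. Near the core only a bound that loses a factor `1 + μ` is available; it is used just to show
that `f'` does not vanish identically.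

On the geometric side, the isometry that makes a collar standard is never identified with Fermi
coordinates: only the area that it yields is used. Two periods of the Fermi strip cover the collar
at least twice and have twice its area, hence cover it exactly twice almost everywhere
(`Frame.ae_multiplicity_eq_two`). This gives both the integration formula `Frame.setIntegral_collar`
and, through `Frame.defect_apply_eq`, a well-defined distance to the core from which the cutoff is
built. -/

theorem laplacian_eq_fderiv_fderiv (u : ℂ → ℝ) (z : ℂ) :
    Laplacian.laplacian u z =
      fderiv ℝ (fderiv ℝ u) z 1 1 + fderiv ℝ (fderiv ℝ u) z Complex.I Complex.I := by
  rw [InnerProductSpace.laplacian_eq_iteratedFDeriv_complexPlane]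
  simp [iteratedFDeriv_two_apply]

theorem fderiv_fderiv_comp_holomorphic {u : ℂ → ℝ} {E : ℂ → ℂ} {z : ℂ}
    (hE : AnalyticAt ℂ E z) (hu : ContDiffAt ℝ 2 u (E z)) (v : ℂ) :
    fderiv ℝ (fderiv ℝ (u ∘ E)) z v v =
      fderiv ℝ (fderiv ℝ u) (E z) (deriv E z * v) (deriv E z * v) +
        fderiv ℝ u (E z) (deriv (deriv E) z * v * v) := by
  have hcE : ContinuousAt E z := hE.continuousAt
  have hev : ∀ᶠ y in nhds z, AnalyticAt ℂ E y ∧ ContDiffAt ℝ 2 u (E y) :=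
    hE.eventually_analyticAt.and (hcE.eventually (hu.eventually (by simp)))
  have hD : ∀ y, AnalyticAt ℂ E y → HasFDerivAt E
      ((ContinuousLinearMap.toSpanSingleton ℂ (deriv E y)).restrictScalars ℝ) y := fun y hy =>
    hy.differentiableAt.hasDerivAt.hasFDerivAt.restrictScalars ℝ
  have h1 : ∀ᶠ y in nhds z, fderiv ℝ (u ∘ E) y =
      (fderiv ℝ u (E y)).comp
        ((ContinuousLinearMap.toSpanSingleton ℂ (deriv E y)).restrictScalars ℝ) := by
    filter_upwards [hev] with y hy
    exact ((hy.2.differentiableAt (by norm_num)).hasFDerivAt.comp y (hD y hy.1)).fderiv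
  have hcomp : DifferentiableAt ℝ (fderiv ℝ (u ∘ E)) z := by
    have : ContDiffAt ℝ 2 (u ∘ E) z :=
      hu.comp z ((hE.restrictScalars (𝕜 := ℝ)).contDiffAt)
    exact (this.fderiv_right (m := 1) (by norm_num)).differentiableAt (by norm_num)
  have h2 : fderiv ℝ (fderiv ℝ (u ∘ E)) z v v =
      fderiv ℝ (fun y => fderiv ℝ (u ∘ E) y v) z v := by
    rw [fderiv_clm_apply hcomp (differentiableAt_const v)]
    simp
  have h3 : (fun y => fderiv ℝ (u ∘ E) y v) =ᶠ[nhds z]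
      fun y => fderiv ℝ u (E y) (deriv E y * v) := by
    filter_upwards [h1] with y hy
    rw [hy]
    simp [mul_comm]
  rw [h2, h3.fderiv_eq]
  have hdu : DifferentiableAt ℝ (fderiv ℝ u) (E z) :=
    (hu.fderiv_right (m := 1) (by norm_num)).differentiableAt (by norm_num)
  have ha : HasFDerivAt (fun y => fderiv ℝ u (E y)) _ z :=
    hdu.hasFDerivAt.comp z (hD z hE)
  have hb : HasFDerivAt (fun y => deriv E y * v) _ z :=
    ((hE.deriv.differentiableAt.hasDerivAt.hasFDerivAt.restrictScalars ℝ).mul_const v)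
  have hab := (ha.clm_apply hb).fderiv
  rw [hab]
  simp only [add_apply, ContinuousLinearMap.coe_comp, Function.comp_apply,
    ContinuousLinearMap.flip_apply, ContinuousLinearMap.coe_restrictScalars',
    ContinuousLinearMap.toSpanSingleton_apply, smul_apply, smul_eq_mul]
  rw [add_comm]
  congr 2
  · ring_nf
  · ring_nf

/-- The terms with `E''` cancel between the directions `1` and `i` because `i² = -1`. What is left
is the trace of the Hessian in the basis `E'`, `i E'`, which is orthogonal with both lengths `|E'|`.
-/
theorem laplacian_comp_holomorphic {u : ℂ → ℝ} {E : ℂ → ℂ} {z : ℂ}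
    (hE : AnalyticAt ℂ E z) (hu : ContDiffAt ℝ 2 u (E z)) :
    Laplacian.laplacian (u ∘ E) z = ‖deriv E z‖ ^ 2 * Laplacian.laplacian u (E z) := by
  rw [laplacian_eq_fderiv_fderiv, laplacian_eq_fderiv_fderiv,
    fderiv_fderiv_comp_holomorphic hE hu, fderiv_fderiv_comp_holomorphic hE hu]
  have h0 : deriv (deriv E) z * Complex.I * Complex.I = -(deriv (deriv E) z * 1 * 1) := by
    rw [mul_assoc, Complex.I_mul_I]; ring
  rw [h0, map_neg]
  set c := deriv E z
  set B := fderiv ℝ (fderiv ℝ u) (E z)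
  have hc1 : c * 1 = c.re • (1 : ℂ) + c.im • Complex.I := by
    apply Complex.ext <;> simp
  have hcI : c * Complex.I = (-c.im) • (1 : ℂ) + c.re • Complex.I := by
    apply Complex.ext <;> simp
  rw [hc1, hcI]
  simp only [map_add, map_smul, add_apply, smul_apply,
    smul_eq_mul]
  rw [← Complex.normSq_eq_norm_sq, Complex.normSq_apply]
  ring

theorem laplacian_comp_neg_conj (u : ℂ → ℝ) (z : ℂ) :
    Laplacian.laplacian (fun w => u (-(starRingEnd ℂ) w)) z =
      Laplacian.laplacian u (-(starRingEnd ℂ) z) := by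
  have h := (Complex.conjCLE.trans (ContinuousLinearEquiv.neg ℝ)).iteratedFDerivWithin_comp_right
    u uniqueDiffOn_univ (x := z) (Set.mem_univ _) 2
  rw [Set.preimage_univ, iteratedFDerivWithin_univ, iteratedFDerivWithin_univ] at h
  have e : (u ∘ (Complex.conjCLE.trans (ContinuousLinearEquiv.neg ℝ)) : ℂ → ℝ) =
      (fun w => u (-(starRingEnd ℂ) w)) := by ext; simp
  rw [e] at h
  rw [InnerProductSpace.laplacian_eq_iteratedFDeriv_complexPlane,
    InnerProductSpace.laplacian_eq_iteratedFDeriv_complexPlane]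
  simp only [h, ContinuousMultilinearMap.compContinuousLinearMap_apply, iteratedFDeriv_two_apply]
  simp

/-- The lift of a function on `ℍ` to a function on `ℂ` is smooth on the upper half-plane. -/
def IsSmoothLift (u : ℍ → ℝ) : Prop :=
  ContDiffOn ℝ ∞ (fun w : ℂ => u (ofComplex w)) {w : ℂ | 0 < w.im}

theorem isOpen_im_pos : IsOpen {w : ℂ | 0 < w.im} :=
  isOpen_lt continuous_const Complex.continuous_im

theorem IsSmoothLift.contDiffAt {u : ℍ → ℝ} (hu : IsSmoothLift u) {w : ℂ} (hw : 0 < w.im) :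
    ContDiffAt ℝ ∞ (fun w : ℂ => u (ofComplex w)) w :=
  ContDiffOn.contDiffAt hu (isOpen_im_pos.mem_nhds hw)

theorem IsSmoothLift.continuous {u : ℍ → ℝ} (hu : IsSmoothLift u) : Continuous u := by
  have h := hu.continuousOn.comp_continuous UpperHalfPlane.continuous_coe fun z => z.im_pos
  have e : (fun w : ℂ => u (ofComplex w)) ∘ UpperHalfPlane.coe = u := by ext; simp
  rwa [e] at h

/-- Together with `det_J_mul_pos`, this reduces statements about orientation-reversing isometries to
Möbius transformations and the reflection `J : z ↦ -z̄`. -/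
theorem eq_J_mul (g : GL (Fin 2) ℝ) : g = J * (J * g) := by
  rw [← mul_assoc, ← sq, J_sq, one_mul]

theorem det_J_mul_pos {g : GL (Fin 2) ℝ} (hg : ¬ 0 < g.det.val) : 0 < (J * g).det.val := by
  have : g.det.val ≠ 0 := g.det.ne_zero
  rw [map_mul, det_J]
  simp only [Units.val_neg, neg_mul, one_mul]
  rcases lt_or_gt_of_ne this with h | h
  · linarith
  · exact absurd h hg

theorem contDiffAt_smul (g : GL (Fin 2) ℝ) {w : ℂ} (hw : 0 < w.im) :
    ContDiffAt ℝ ∞ (fun w : ℂ => ((g • ofComplex w : ℍ) : ℂ)) w := by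
  wlog hg : 0 < g.det.val generalizing g
  · have h := this (J * g) (det_J_mul_pos hg)
    rw [eq_J_mul g]
    have e : (fun w : ℂ => (((J * (J * g)) • ofComplex w : ℍ) : ℂ)) =
        fun w => -(starRingEnd ℂ) (((J * g) • ofComplex w : ℍ) : ℂ) := by
      ext w
      rw [mul_smul J (J * g), coe_J_smul]
    rw [e]
    exact (Complex.conjCLE.contDiff.contDiffAt.comp w h).neg
  · have h := analyticAt_smul hg (⟨w, hw⟩ : ℍ)
    exact (h.restrictScalars (𝕜 := ℝ)).contDiffAt

theorem IsSmoothLift.comp_smul {u : ℍ → ℝ} (hu : IsSmoothLift u) (g : GL (Fin 2) ℝ) :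
    IsSmoothLift fun z => u (g • z) := by
  intro w hw
  have h := (hu.contDiffAt (g • ofComplex w : ℍ).im_pos).comp w (contDiffAt_smul g hw)
  refine ContDiffAt.contDiffWithinAt (h.congr_of_eventuallyEq ?_)
  filter_upwards with y
  simp

theorem planeLaplacian_comp_J_smul (u : ℍ → ℝ) (z : ℍ) :
    planeLaplacian (fun z => u (J • z)) z = planeLaplacian u (J • z) := by
  unfold planeLaplacian
  have e : (fun w : ℂ => u (J • ofComplex w)) =ᶠ[nhds (z : ℂ)]
      fun w => u (ofComplex (-(starRingEnd ℂ) w)) := by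
    filter_upwards [isOpen_im_pos.mem_nhds z.im_pos] with w hw
    have : (J • ofComplex w : ℍ) = ofComplex (-(starRingEnd ℂ) w) := by
      rw [J_smul, ofComplex_apply_of_im_pos hw]
    simp [this]
  rw [(InnerProductSpace.laplacian_congr_nhds e).self_of_nhds,
    laplacian_comp_neg_conj (fun w => u (ofComplex w)), coe_J_smul]
  have him : (J • z : ℍ).im = z.im := by
    rw [← coe_im, coe_J_smul]; simp
  rw [him]

theorem planeLaplacian_comp_smul_of_det_pos {u : ℍ → ℝ} (hu : IsSmoothLift u)
    {g : GL (Fin 2) ℝ} (hg : 0 < g.det.val) (z : ℍ) :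
    planeLaplacian (fun z => u (g • z)) z = planeLaplacian u (g • z) := by
  unfold planeLaplacian
  have e : (fun w : ℂ => u (g • ofComplex w)) =
      (fun w : ℂ => u (ofComplex w)) ∘ (fun w : ℂ => ((g • ofComplex w : ℍ) : ℂ)) := by
    ext w; simp
  rw [e, laplacian_comp_holomorphic (analyticAt_smul hg z)
    ((hu.contDiffAt (UpperHalfPlane.im_pos _)).of_le
      (WithTop.coe_le_coe.mpr (le_top : (2 : ℕ∞) ≤ ⊤))), deriv_smul hg,
    ofComplex_apply, UpperHalfPlane.im_smul_eq_div_normSq, norm_div, norm_pow,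
    Complex.normSq_eq_norm_sq, Complex.norm_real, Real.norm_eq_abs]
  have h1 := denom_ne_zero g z
  have h2 : ‖denom g z‖ ≠ 0 := by simp [h1]
  simp only [Matrix.GeneralLinearGroup.val_det_apply]
  field_simp

theorem planeLaplacian_comp_smul {u : ℍ → ℝ} (hu : IsSmoothLift u) (g : GL (Fin 2) ℝ) (z : ℍ) :
    planeLaplacian (fun z => u (g • z)) z = planeLaplacian u (g • z) := by
  by_cases hg : 0 < g.det.val
  · exact planeLaplacian_comp_smul_of_det_pos hu hg z
  · have h := planeLaplacian_comp_smul_of_det_pos (hu.comp_smul J) (det_J_mul_pos hg) z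
    rw [planeLaplacian_comp_J_smul] at h
    simp only [← mul_smul, ← eq_J_mul] at h
    exact h

theorem dist_smul_smul (g : GL (Fin 2) ℝ) (z w : ℍ) : dist (g • z) (g • w) = dist z w := by
  wlog hg : 0 < g.det.val generalizing g
  · have h := this (J * g) (det_J_mul_pos hg)
    have hJ : ∀ z w : ℍ, dist (J • z) (J • w) = dist z w := by
      intro z w
      have him : ∀ z : ℍ, (J • z : ℍ).im = z.im := fun z => by
        rw [← coe_im, coe_J_smul]; simp
      rw [dist_eq, dist_eq, him, him, coe_J_smul, coe_J_smul, dist_neg_neg, Complex.dist_conj_conj]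
    rw [← h, mul_smul, mul_smul, hJ]
  · have h1 := denom_ne_zero g z
    have h2 := denom_ne_zero g w
    have h1' : ‖denom g z‖ ≠ 0 := by simp [h1]
    have h2' : ‖denom g w‖ ≠ 0 := by simp [h2]
    have hd : |g.det.val| ≠ 0 := abs_ne_zero.mpr g.det.ne_zero
    have key : Real.cosh (dist (g • z) (g • w)) = Real.cosh (dist z w) := by
      rw [cosh_dist, cosh_dist, UpperHalfPlane.im_smul_eq_div_normSq,
        UpperHalfPlane.im_smul_eq_div_normSq, coe_smul_of_det_pos hg, coe_smul_of_det_pos hg,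
        Complex.dist_eq, Complex.dist_eq, div_sub_div _ _ h1 h2]
      have e : num g z * denom g w - denom g z * num g w = (g.det.val : ℂ) * (z - w) := by
        simp only [num, denom, Matrix.GeneralLinearGroup.val_det_apply, Matrix.det_fin_two]
        push_cast
        ring
      have hz := z.im_pos.ne'
      have hw := w.im_pos.ne'
      rw [e, norm_div, norm_mul, norm_mul, Complex.norm_real, Real.norm_eq_abs,
        Complex.normSq_eq_norm_sq, Complex.normSq_eq_norm_sq]
      field_simp
    exact Real.cosh_strictMonoOn.injOn (Set.mem_Ici.mpr dist_nonneg) (Set.mem_Ici.mpr dist_nonneg)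
      key

section

/-! ### Groups of deck transformations -/


theorem volume_eq_zero_of_coe_image {s : Set ℍ} (h : volume (UpperHalfPlane.coe '' s) = 0) :
    volume s = 0 := by
  rw [volume_eq_lintegral]
  exact setLIntegral_measure_zero _ _ h

theorem finite_quadratic_roots {a b c : ℝ} (h : a ≠ 0 ∨ b ≠ 0) :
    {x : ℝ | a * x ^ 2 + b * x + c = 0}.Finite := by
  have hp : (Polynomial.C a * Polynomial.X ^ 2 + Polynomial.C b * Polynomial.X +
      Polynomial.C c : Polynomial ℝ) ≠ 0 := by
    intro h0
    have h1 := congrArg (fun p => Polynomial.coeff p 1) h0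
    have h2 := congrArg (fun p => Polynomial.coeff p 2) h0
    simp [Polynomial.coeff_C] at h1 h2
    tauto
  refine (Polynomial.finite_setOfPred_isRoot hp).subset fun x hx => ?_
  simpa [Polynomial.IsRoot] using hx

/-- On each horizontal line the condition is a polynomial equation of degree at most two in the real
part. Its two leading coefficients vanish together only if `p = q`, so each slice is finite and
Fubini applies. -/
theorem volume_bisector {p q : ℍ} (hpq : p ≠ q) : volume {z : ℍ | dist z p = dist z q} = 0 := by
  apply volume_eq_zero_of_coe_image
  let S : Set (ℝ × ℝ) := {x | (q.im - p.im) * x.2 ^ 2 + (2 * q.re * p.im - 2 * p.re * q.im) * x.2 +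
    ((p.re ^ 2 + (x.1 - p.im) ^ 2) * q.im - (q.re ^ 2 + (x.1 - q.im) ^ 2) * p.im) = 0}
  have hS : IsClosed S := isClosed_eq (by fun_prop) continuous_const
  have hS0 : (volume : Measure (ℝ × ℝ)) S = 0 := by
    rw [Measure.volume_eq_prod, Measure.measure_prod_null hS.measurableSet]
    refine Eventually.of_forall fun y => ?_
    suffices hfin : (Prod.mk y ⁻¹' S).Finite from hfin.measure_zero volume
    refine finite_quadratic_roots (a := q.im - p.im) (b := 2 * q.re * p.im - 2 * p.re * q.im)
      (c := (p.re ^ 2 + (y - p.im) ^ 2) * q.im - (q.re ^ 2 + (y - q.im) ^ 2) * p.im) ?_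
    by_contra! hc
    obtain ⟨h1, h2⟩ := hc
    have h3 : p.im = q.im := by linarith
    rw [h3] at h2
    have : (q.re - p.re) * q.im = 0 := by linarith
    have h4 : q.re - p.re = 0 := (mul_eq_zero.mp this).resolve_right q.im_ne_zero
    exact hpq (UpperHalfPlane.ext_re_im (by linarith) h3)
  have hmp : MeasurePreserving (fun z : ℂ => (z.im, z.re)) volume volume :=
    Measure.measurePreserving_swap.comp Complex.volume_preserving_equiv_real_prod
  refine measure_mono_null ?_ ((hmp.measure_preimage hS.measurableSet.nullMeasurableSet).trans hS0)
  rintro _ ⟨z, hz, rfl⟩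
  have h := congrArg Real.cosh (show dist z p = dist z q from hz)
  rw [cosh_dist, cosh_dist, Complex.dist_eq, Complex.dist_eq, ← Complex.normSq_eq_norm_sq,
    ← Complex.normSq_eq_norm_sq, Complex.normSq_apply, Complex.normSq_apply] at h
  have hz := z.im_ne_zero
  have hp := p.im_ne_zero
  have hq := q.im_ne_zero
  field_simp at h
  simp only [Complex.sub_re, Complex.sub_im, coe_re, coe_im] at h
  simp only [S, mem_preimage, mem_ofPred_eq, coe_re, coe_im]
  linarith

variable {Γ : Subgroup (Equiv.Perm ℍ)}

theorem proj_eq_iff {z w : ℍ} : proj Γ z = proj Γ w ↔ ∃ γ ∈ Γ, γ w = z := by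
  unfold proj
  rw [Quotient.eq, MulAction.orbitRel_apply]
  constructor
  · rintro ⟨γ, h⟩; exact ⟨γ, γ.2, h⟩
  · rintro ⟨γ, hγ, h⟩; exact ⟨⟨γ, hγ⟩, h⟩

theorem proj_apply {γ : Equiv.Perm ℍ} (hγ : γ ∈ Γ) (z : ℍ) : proj Γ (γ z) = proj Γ z :=
  proj_eq_iff.mpr ⟨γ, hγ, rfl⟩

theorem proj_surjective : Function.Surjective (proj Γ) := Quotient.mk_surjective

theorem exists_gl (hΓ : IsClosedSurfaceGroup Γ) {γ : Equiv.Perm ℍ} (hγ : γ ∈ Γ) :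
    ∃ g : GL (Fin 2) ℝ, ∀ z, γ z = g • z := by
  obtain ⟨g, rfl⟩ := hΓ.le_isometryGroup hγ
  exact ⟨g, fun z => rfl⟩

theorem dist_apply (hΓ : IsClosedSurfaceGroup Γ) {γ : Equiv.Perm ℍ} (hγ : γ ∈ Γ) (z w : ℍ) :
    dist (γ z) (γ w) = dist z w := by
  obtain ⟨g, hg⟩ := exists_gl hΓ hγ
  rw [hg, hg, dist_smul_smul]

theorem continuous_apply (hΓ : IsClosedSurfaceGroup Γ) {γ : Equiv.Perm ℍ} (hγ : γ ∈ Γ) :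
    Continuous γ :=
  (Isometry.of_dist_eq (dist_apply hΓ hγ)).continuous

theorem smulInvariantMeasure (hΓ : IsClosedSurfaceGroup Γ) :
    SMulInvariantMeasure Γ ℍ (volume : Measure ℍ) where
  measure_preimage_smul γ s hs := by
    obtain ⟨g, hg⟩ := exists_gl hΓ γ.2
    have : (fun x : ℍ => γ • x) ⁻¹' s = (fun x => g • x) ⁻¹' s := by
      ext z
      simp only [mem_preimage, ← hg]
      rfl
    rw [this, measure_preimage_smul]

theorem measurableConstSMul (hΓ : IsClosedSurfaceGroup Γ) : MeasurableConstSMul Γ ℍ where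
  measurable_const_smul γ := (continuous_apply hΓ γ.2).measurable

theorem finite_inter_closedBall (hΓ : IsClosedSurfaceGroup Γ) (z p : ℍ) (R : ℝ) :
    {γ : Equiv.Perm ℍ | γ ∈ Γ ∧ dist (γ z) p ≤ R}.Finite := by
  have hK : IsCompact (insert z (Metric.closedBall p R)) := (isCompact_closedBall p R).insert z
  refine (hΓ.properlyDiscontinuous _ hK).subset fun γ hγ => ⟨hγ.1, γ z, ?_, ?_⟩
  · exact ⟨z, mem_insert _ _, rfl⟩
  · exact mem_insert_of_mem _ hγ.2

theorem countable (hΓ : IsClosedSurfaceGroup Γ) : Countable Γ := by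
  have h : (Γ : Set (Equiv.Perm ℍ)) ⊆
      ⋃ n : ℕ, {γ : Equiv.Perm ℍ | γ ∈ Γ ∧ dist (γ I) I ≤ n} := by
    intro γ hγ
    obtain ⟨n, hn⟩ := exists_nat_ge (dist (γ I) I)
    exact mem_iUnion.mpr ⟨n, hγ, hn⟩
  exact ((countable_iUnion fun n : ℕ =>
    (finite_inter_closedBall hΓ I I n).countable).mono h).to_subtype

theorem isClosed_dirichletDomain : IsClosed (dirichletDomain Γ) := by
  have : dirichletDomain Γ = ⋂ γ ∈ Γ, {z | dist z I ≤ dist z (γ I)} := by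
    ext z; simp [dirichletDomain]
  rw [this]
  exact isClosed_biInter fun γ _ => isClosed_le (by fun_prop) (by fun_prop)

theorem dist_apply_comm (hΓ : IsClosedSurfaceGroup Γ) {γ : Equiv.Perm ℍ} (hγ : γ ∈ Γ) (z w : ℍ) :
    dist (γ z) w = dist z (γ⁻¹ w) := by
  have := dist_apply hΓ hγ z (γ⁻¹ w)
  rwa [show γ (γ⁻¹ w) = w from γ.apply_symm_apply w] at this

theorem exists_apply_mem_dirichletDomain (hΓ : IsClosedSurfaceGroup Γ) (z : ℍ) :
    ∃ γ ∈ Γ, γ z ∈ dirichletDomain Γ := by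
  have hfin := finite_inter_closedBall hΓ z I (dist z I)
  obtain ⟨γ, hγ, hmin⟩ := hfin.exists_minimalFor (fun γ => dist (γ z) I) _
    ⟨1, Γ.one_mem, le_rfl⟩
  refine ⟨γ, hγ.1, fun γ' hγ' => ?_⟩
  have hmem : γ'⁻¹ * γ ∈ Γ := Γ.mul_mem (Γ.inv_mem hγ') hγ.1
  have e : dist (γ z) (γ' I) = dist ((γ'⁻¹ * γ) z) I := by
    have := dist_apply_comm hΓ (Γ.inv_mem hγ') (γ z) I
    rw [inv_inv] at this
    rw [← this]; rfl
  rw [e]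
  by_contra! hlt
  have := hmin ⟨hmem, hlt.le.trans hγ.2⟩ hlt.le
  exact absurd hlt (not_lt.mpr this)

/-- The domain and its translate by `γ` overlap only inside the bisector of `i` and `γ i`, which is
null because freeness makes these points distinct. -/
theorem isFundamentalDomain_dirichletDomain (hΓ : IsClosedSurfaceGroup Γ) :
    IsFundamentalDomain Γ (dirichletDomain Γ) (volume : Measure ℍ) := by
  have := smulInvariantMeasure hΓ
  have := measurableConstSMul hΓ
  refine IsFundamentalDomain.mk'' isClosed_dirichletDomain.measurableSet.nullMeasurableSet
    (Eventually.of_forall fun z => ?_) (fun γ hγ => ?_)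
    (fun γ => (measurePreserving_smul γ _).quasiMeasurePreserving)
  · obtain ⟨γ, hγ, h⟩ := exists_apply_mem_dirichletDomain hΓ z
    exact ⟨⟨γ, hγ⟩, h⟩
  · have hne : (γ : Equiv.Perm ℍ) I ≠ I := fun h => hγ (Subtype.ext (hΓ.free γ γ.2 I h))
    refine measure_mono_null ?_ (volume_bisector hne)
    rintro z ⟨hz1, hz2⟩
    rw [mem_smul_set_iff_inv_smul_mem] at hz1
    apply le_antisymm
    · have h := hz1 (γ : Equiv.Perm ℍ)⁻¹ (Γ.inv_mem γ.2)
      have e1 : dist (γ⁻¹ • z) I = dist z ((γ : Equiv.Perm ℍ) I) := by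
        have := dist_apply_comm hΓ (Γ.inv_mem γ.2) z I
        rwa [inv_inv] at this
      have e2 : dist (γ⁻¹ • z) ((γ : Equiv.Perm ℍ)⁻¹ I) = dist z I :=
        dist_apply hΓ (Γ.inv_mem γ.2) z I
      rwa [e1, e2] at h
    · exact hz2 γ γ.2

theorem exists_dirichletDomain_subset (hΓ : IsClosedSurfaceGroup Γ) :
    ∃ R, dirichletDomain Γ ⊆ Metric.closedBall I R := by
  obtain ⟨K, hK, hKs⟩ := hΓ.cocompact
  obtain ⟨R, hR⟩ := hK.isBounded.subset_closedBall I
  refine ⟨R, fun z hz => ?_⟩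
  have : proj Γ z ∈ proj Γ '' K := hKs ▸ mem_univ _
  obtain ⟨k, hk, hkz⟩ := this
  obtain ⟨γ, hγ, rfl⟩ := proj_eq_iff.mp hkz
  have h1 := hz γ⁻¹ (Γ.inv_mem hγ)
  rw [← dist_apply_comm hΓ hγ] at h1
  exact h1.trans (hR hk)

theorem isCompact_dirichletDomain (hΓ : IsClosedSurfaceGroup Γ) :
    IsCompact (dirichletDomain Γ) := by
  obtain ⟨R, hR⟩ := exists_dirichletDomain_subset hΓ
  exact (isCompact_closedBall I R).of_isClosed_subset isClosed_dirichletDomain hR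

/-- The number of elements of `Γ` that send `z` into `S`. -/
def multiplicity (Γ : Subgroup (Equiv.Perm ℍ)) (S : Set ℍ) (z : ℍ) : ℝ≥0∞ :=
  ∑' γ : Γ, S.indicator 1 (γ • z)

theorem measurable_multiplicity (hΓ : IsClosedSurfaceGroup Γ) {S : Set ℍ} (hS : MeasurableSet S) :
    Measurable (multiplicity Γ S) := by
  have := countable hΓ
  have := measurableConstSMul hΓ
  exact Measurable.tsum fun γ =>
    (measurable_one.indicator hS).comp (measurable_const_smul γ)

theorem multiplicity_apply (S : Set ℍ) {γ : Equiv.Perm ℍ} (hγ : γ ∈ Γ) (z : ℍ) :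
    multiplicity Γ S (γ z) = multiplicity Γ S z := by
  unfold multiplicity
  let γ₀ : Γ := ⟨γ, hγ⟩
  exact (Equiv.mulRight γ₀).tsum_eq (fun γ' : Γ => S.indicator (1 : ℍ → ℝ≥0∞) (γ' • z))

theorem multiplicity_inter_preimage (S : Set ℍ) (B : Set (Surface Γ)) (z : ℍ) :
    multiplicity Γ (S ∩ proj Γ ⁻¹' B) z = (proj Γ ⁻¹' B).indicator (multiplicity Γ S) z := by
  unfold multiplicity
  have h : ∀ γ : Γ, γ • z ∈ proj Γ ⁻¹' B ↔ z ∈ proj Γ ⁻¹' B := fun γ => by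
    have := proj_apply γ.2 z
    simp only [mem_preimage]
    rw [show γ • z = (γ : Equiv.Perm ℍ) z from rfl, this]
  by_cases hz : z ∈ proj Γ ⁻¹' B
  · rw [indicator_of_mem hz]
    congr 1; ext γ
    by_cases hS : γ • z ∈ S
    · rw [indicator_of_mem hS, indicator_of_mem
        (show γ • z ∈ S ∩ proj Γ ⁻¹' B from ⟨hS, (h γ).mpr hz⟩)]
    · rw [indicator_of_notMem hS, indicator_of_notMem fun hh => hS hh.1]
  · rw [indicator_of_notMem hz]
    simp only [ENNReal.tsum_eq_zero]
    intro γ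
    exact indicator_of_notMem (fun hh => hz ((h γ).mp hh.2)) _

/-- Unfolding of the indicator of `S` over the translates of a fundamental domain. -/
theorem volume_eq_lintegral_multiplicity (hΓ : IsClosedSurfaceGroup Γ) {S : Set ℍ}
    (hS : MeasurableSet S) :
    volume S = ∫⁻ z in dirichletDomain Γ, multiplicity Γ S z := by
  have := countable hΓ
  have := measurableConstSMul hΓ
  have := smulInvariantMeasure hΓ
  rw [← lintegral_indicator_one hS,
    (isFundamentalDomain_dirichletDomain hΓ).lintegral_eq_tsum'' (S.indicator 1)]
  exact (lintegral_tsum fun γ =>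
    ((measurable_one.indicator hS).comp (measurable_const_smul γ)).aemeasurable).symm

theorem card_le_multiplicity (S : Set ℍ) (z : ℍ) (A : Finset Γ) (hA : ∀ γ ∈ A, γ • z ∈ S) :
    (A.card : ℝ≥0∞) ≤ multiplicity Γ S z := by
  refine le_trans ?_ (ENNReal.sum_le_tsum A)
  rw [Finset.sum_congr rfl fun γ hγ => indicator_of_mem (hA γ hγ) _]
  simp

theorem multiplicity_eq_zero {S : Set ℍ} {z : ℍ} (h : ∀ γ ∈ Γ, γ z ∉ S) :
    multiplicity Γ S z = 0 := by
  simp only [multiplicity, ENNReal.tsum_eq_zero]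
  exact fun γ => indicator_of_notMem (h γ γ.2) _

theorem volume_dirichletDomain_lt_top (hΓ : IsClosedSurfaceGroup Γ) :
    volume (dirichletDomain Γ) < ⊤ :=
  (isCompact_dirichletDomain hΓ).measure_lt_top

/-- If `S` covers each point of the part `B` of the surface at least `n` times, and has the area
of `n` copies of `B`, then it covers almost every point of `B` exactly `n` times. -/
theorem ae_multiplicity_eq (hΓ : IsClosedSurfaceGroup Γ) {S : Set ℍ} (hS : MeasurableSet S)
    {B : Set (Surface Γ)} (hB : MeasurableSet (proj Γ ⁻¹' B)) (n : ℕ)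
    (hn : ∀ z, proj Γ z ∈ B → (n : ℝ≥0∞) ≤ multiplicity Γ S z)
    (hvol : volume S ≤ n * volume (dirichletDomain Γ ∩ proj Γ ⁻¹' B)) :
    ∀ᵐ z : ℍ, multiplicity Γ S z = (proj Γ ⁻¹' B).indicator (fun _ => (n : ℝ≥0∞)) z := by
  have := countable hΓ
  have := measurableConstSMul hΓ
  have := smulInvariantMeasure hΓ
  have hle : ∀ z, (proj Γ ⁻¹' B).indicator (fun _ => (n : ℝ≥0∞)) z ≤ multiplicity Γ S z := by
    intro z
    by_cases hz : z ∈ proj Γ ⁻¹' B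
    · rw [indicator_of_mem hz]; exact hn z hz
    · rw [indicator_of_notMem hz]; exact zero_le
  have hI : ∫⁻ z in dirichletDomain Γ, (proj Γ ⁻¹' B).indicator (fun _ => (n : ℝ≥0∞)) z =
      n * volume (dirichletDomain Γ ∩ proj Γ ⁻¹' B) := by
    rw [lintegral_indicator hB, setLIntegral_const, Measure.restrict_apply hB, inter_comm]
  -- A pointwise inequality whose larger side has no larger, finite integral is an equality almost
  -- everywhere.
  have hae : (proj Γ ⁻¹' B).indicator (fun _ => (n : ℝ≥0∞))
      =ᵐ[volume.restrict (dirichletDomain Γ)] multiplicity Γ S := by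
    refine ae_eq_of_ae_le_of_lintegral_le (Eventually.of_forall hle) ?_
      (measurable_multiplicity hΓ hS).aemeasurable ?_
    · rw [hI]
      exact (ENNReal.mul_lt_top (by simp) ((measure_mono inter_subset_left).trans_lt
        (volume_dirichletDomain_lt_top hΓ))).ne
    · rw [hI, ← volume_eq_lintegral_multiplicity hΓ hS]; exact hvol
  set bad : Set ℍ :=
    {z | ¬ multiplicity Γ S z = (proj Γ ⁻¹' B).indicator (fun _ => (n : ℝ≥0∞)) z} with hbad
  have hinv : ∀ (γ : Γ) z, γ • z ∈ bad ↔ z ∈ bad := by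
    intro γ z
    have e1 := multiplicity_apply S γ.2 z
    have e2 : (proj Γ ⁻¹' B).indicator (fun _ => (n : ℝ≥0∞)) ((γ : Equiv.Perm ℍ) z) =
        (proj Γ ⁻¹' B).indicator (fun _ => (n : ℝ≥0∞)) z := by
      have : (γ : Equiv.Perm ℍ) z ∈ proj Γ ⁻¹' B ↔ z ∈ proj Γ ⁻¹' B := by
        rw [mem_preimage, mem_preimage, proj_apply γ.2 z]
      by_cases hz : z ∈ proj Γ ⁻¹' B
      · rw [indicator_of_mem hz, indicator_of_mem (this.mpr hz)]
      · rw [indicator_of_notMem hz, indicator_of_notMem (fun h => hz (this.mp h))]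
    simp only [hbad, mem_ofPred_eq]
    rw [show γ • z = (γ : Equiv.Perm ℍ) z from rfl, e1, e2]
  -- Both sides are `Γ`-invariant, so the exceptional set is null as soon as it is null in the
  -- fundamental domain.
  refine (isFundamentalDomain_dirichletDomain hΓ).measure_zero_of_invariant bad (fun γ => ?_) ?_
  · ext z
    rw [mem_smul_set_iff_inv_smul_mem, hinv]
  · rw [Filter.EventuallyEq, ae_iff, Measure.restrict_apply₀'
      isClosed_dirichletDomain.measurableSet.nullMeasurableSet] at hae
    convert! hae using 3
    ext z
    exact not_congr eq_comm

theorem measurable_proj : Measurable (proj Γ) := measurable_quotient_mk''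

/-- This moves an integral over a part of the surface to any set that covers it `n` times; it is
applied with `n = 2`. -/
theorem map_proj_restrict (hΓ : IsClosedSurfaceGroup Γ) {S : Set ℍ} (hS : MeasurableSet S)
    {B : Set (Surface Γ)} (hB : MeasurableSet (proj Γ ⁻¹' B)) (n : ℕ)
    (h : ∀ᵐ z : ℍ, multiplicity Γ S z = (proj Γ ⁻¹' B).indicator (fun _ => (n : ℝ≥0∞)) z) :
    Measure.map (proj Γ) (volume.restrict S) =
      (n : ℝ≥0∞) • Measure.map (proj Γ) (volume.restrict (dirichletDomain Γ ∩ proj Γ ⁻¹' B)) := by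
  ext C hC
  have hC' : MeasurableSet (proj Γ ⁻¹' C) := measurable_proj hC
  rw [Measure.smul_apply, Measure.map_apply measurable_proj hC, Measure.map_apply measurable_proj hC,
    Measure.restrict_apply hC', Measure.restrict_apply hC', inter_comm,
    volume_eq_lintegral_multiplicity hΓ (hS.inter hC')]
  simp_rw [multiplicity_inter_preimage]
  have : ∫⁻ z in dirichletDomain Γ, (proj Γ ⁻¹' C).indicator (multiplicity Γ S) z =
      ∫⁻ z in dirichletDomain Γ, (proj Γ ⁻¹' C ∩ proj Γ ⁻¹' B).indicator
        (fun _ => (n : ℝ≥0∞)) z := by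
    refine lintegral_congr_ae ?_
    filter_upwards [ae_restrict_of_ae h] with z hz
    rw [← indicator_indicator]
    by_cases hzC : z ∈ proj Γ ⁻¹' C
    · rw [indicator_of_mem hzC, indicator_of_mem hzC, hz]
    · rw [indicator_of_notMem hzC, indicator_of_notMem hzC]
  rw [this, lintegral_indicator (hC'.inter hB), setLIntegral_const,
    Measure.restrict_apply (hC'.inter hB), smul_eq_mul]
  congr 2
  ext z
  simp only [mem_inter_iff]
  tauto

end

/-! ### Geodesics and Fermi coordinates of the hyperbolic plane -/

/-- The unit speed parametrization of the imaginary axis. -/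
def axis (s : ℝ) : ℍ := ⟨⟨0, Real.exp s⟩, Real.exp_pos s⟩

@[simp] theorem axis_re (s : ℝ) : (axis s).re = 0 := rfl
@[simp] theorem axis_im (s : ℝ) : (axis s).im = Real.exp s := rfl

theorem isometry_axis : Isometry axis := isometry_vertical_line 0

theorem axis_log_im {z : ℍ} (hz : z.re = 0) : axis (Real.log z.im) = z :=
  UpperHalfPlane.ext_re_im (by simp [hz]) (by simp [Real.exp_log z.im_pos])

theorem cosh_dist_axis (z : ℍ) (s : ℝ) : Real.cosh (dist z (axis s)) =
    (z.re ^ 2 + z.im ^ 2 + Real.exp s ^ 2) / (2 * z.im * Real.exp s) := by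
  rw [cosh_dist, Complex.dist_eq, ← Complex.normSq_eq_norm_sq, Complex.normSq_apply]
  simp only [Complex.sub_re, Complex.sub_im, coe_re, coe_im, axis_re, axis_im]
  have h1 := z.im_ne_zero
  have h2 := (Real.exp_pos s).ne'
  field_simp
  ring

/-- Each distance gives an equation in `re z` and `im z` through `cosh`. Their difference is free of
`re z` and yields `im z = e^s`; either equation then forces `re z = 0`. -/
theorem eq_axis_of_dist {z : ℍ} {a b s : ℝ} (hab : a ≠ b) (ha : dist z (axis a) = |s - a|)
    (hb : dist z (axis b) = |s - b|) : z = axis s := by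
  have h1 := cosh_dist_axis z a
  have h2 := cosh_dist_axis z b
  rw [ha, Real.cosh_abs, Real.cosh_eq, eq_div_iff (by have := z.im_pos; positivity), neg_sub,
    Real.exp_sub, Real.exp_sub] at h1
  rw [hb, Real.cosh_abs, Real.cosh_eq, eq_div_iff (by have := z.im_pos; positivity), neg_sub,
    Real.exp_sub, Real.exp_sub] at h2
  have hA := Real.exp_pos a
  have hB := Real.exp_pos b
  have hS := Real.exp_pos s
  have hne : Real.exp a ≠ Real.exp b := fun h => hab (Real.exp_injective h)
  set A := Real.exp a
  set B := Real.exp b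
  set S := Real.exp s
  field_simp at h1 h2
  have h3 : (A - B) * ((A + B) * (z.im - S)) = 0 := by linear_combination h1 - h2
  have h4 : z.im = S := by
    have := (mul_eq_zero.mp h3).resolve_left (sub_ne_zero.mpr hne)
    have := (mul_eq_zero.mp this).resolve_left (by positivity)
    linarith
  rw [h4] at h1
  have h5 : S * z.re ^ 2 = 0 := by linear_combination -h1
  have h6 : z.re = 0 := by
    have := (mul_eq_zero.mp h5).resolve_left hS.ne'
    exact pow_eq_zero_iff (two_ne_zero) |>.mp this
  exact UpperHalfPlane.ext_re_im (by simp [h6]) (by simp [h4, S])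

/-- The Möbius transformation `z ↦ (a z + b) / (c z + d)` for `a d - b c > 0`. -/
theorem exists_moebius {a b c d : ℝ} (h : 0 < a * d - b * c) :
    ∃ A : GL (Fin 2) ℝ, ∀ z : ℍ, ((A • z : ℍ) : ℂ) = (a * z + b) / (c * z + d) := by
  have hdet : Matrix.det !![a, b; c, d] ≠ 0 := by
    rw [Matrix.det_fin_two_of]; exact h.ne'
  refine ⟨.mkOfDetNeZero _ hdet, fun z => ?_⟩
  rw [coe_smul_of_det_pos]
  · simp [num, denom, Matrix.GeneralLinearGroup.mkOfDetNeZero]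
  · simpa [Matrix.GeneralLinearGroup.mkOfDetNeZero, Matrix.det_fin_two_of] using h

theorem exists_smul_re_eq_zero (p q : ℍ) :
    ∃ A : GL (Fin 2) ℝ, (A • p).re = 0 ∧ (A • q).re = 0 := by
  by_cases hpq : p.re = q.re
  · obtain ⟨A, hA⟩ := exists_moebius (a := 1) (b := -p.re) (c := 0) (d := 1) (by norm_num)
    have key : ∀ z : ℍ, (A • z).re = z.re - p.re := by
      intro z
      rw [← coe_re, hA]
      simp [sub_eq_add_neg]
    exact ⟨A, by rw [key]; ring, by rw [key, hpq]; ring⟩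
  -- `c` and `R` are the centre and radius of the half circle through `p` and `q` orthogonal to the
  -- real line. The Möbius map below sends its endpoints `c - R` and `c + R` to `0` and `∞`.
  · set c := (q.re ^ 2 + q.im ^ 2 - p.re ^ 2 - p.im ^ 2) / (2 * (q.re - p.re)) with hc
    set R := √((p.re - c) ^ 2 + p.im ^ 2) with hR
    have hRpos : 0 < R := Real.sqrt_pos.mpr (by have := p.im_pos; positivity)
    have hR2 : R ^ 2 = (p.re - c) ^ 2 + p.im ^ 2 := Real.sq_sqrt (by positivity)
    have hR2' : R ^ 2 = (q.re - c) ^ 2 + q.im ^ 2 := by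
      have hne : q.re - p.re ≠ 0 := sub_ne_zero.mpr (Ne.symm hpq)
      have : c * (2 * (q.re - p.re)) = q.re ^ 2 + q.im ^ 2 - p.re ^ 2 - p.im ^ 2 := by
        rw [hc]; field_simp
      rw [hR2]
      linear_combination this
    obtain ⟨A, hA⟩ := exists_moebius (a := 1) (b := -(c - R)) (c := -1) (d := c + R)
      (by linarith)
    have key : ∀ z : ℍ, R ^ 2 = (z.re - c) ^ 2 + z.im ^ 2 → (A • z).re = 0 := by
      intro z hz
      rw [← coe_re, hA]
      simp only [Complex.div_re]
      simp
      rw [← add_div, div_eq_zero_iff]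
      left
      linear_combination hz
    exact ⟨A, key p hR2, key q hR2'⟩

theorem exists_smul_axis {a b : ℝ} (hab : |a - b| = 1) :
    ∃ D : GL (Fin 2) ℝ, D • axis a = axis 0 ∧ D • axis b = axis 1 := by
  have hI : ∀ s, ((axis s : ℍ) : ℂ) = Complex.I * Real.exp s := fun s => by
    apply Complex.ext <;> simp [axis, Complex.exp_ofReal_re]
  have hE := fun s : ℝ => Complex.exp_ne_zero (s : ℂ)
  rcases (abs_eq zero_le_one).mp hab with h | h
  · obtain ⟨D, hD⟩ := exists_moebius (a := 0) (b := -Real.exp a) (c := 1) (d := 0)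
      (by have := Real.exp_pos a; linarith)
    have key : ∀ s, D • axis s = axis (a - s) := by
      intro s
      apply UpperHalfPlane.ext
      rw [hD, hI, hI, Real.exp_sub]
      push_cast
      have h1 := hE s
      field_simp
      simp
      linear_combination (-(Complex.exp a * Complex.exp s)) * Complex.I_mul_I
    exact ⟨D, by rw [key, sub_self], by rw [key, h]⟩
  · obtain ⟨D, hD⟩ := exists_moebius (a := 1) (b := 0) (c := 0) (d := Real.exp a)
      (by have := Real.exp_pos a; linarith)
    have key : ∀ s, D • axis s = axis (s - a) := by
      intro s
      apply UpperHalfPlane.ext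
      rw [hD, hI, hI, Real.exp_sub]
      push_cast
      have h1 := hE a
      field_simp
      simp
    exact ⟨D, by rw [key, sub_self], by rw [key, show b - a = 1 by linarith]⟩

/-- Two points at distance `1` can be moved to `axis 0` and `axis 1`, and the distances to these two
points then determine every other point of the geodesic. -/
theorem exists_eq_smul_axis {g : ℝ → ℍ} (hg : Isometry g) :
    ∃ A : GL (Fin 2) ℝ, ∀ s, g s = A • axis s := by
  obtain ⟨A, h0, h1⟩ := exists_smul_re_eq_zero (g 0) (g 1)
  have hd : |Real.log (A • g 0).im - Real.log (A • g 1).im| = 1 := by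
    rw [← Real.dist_eq, ← isometry_axis.dist_eq, axis_log_im h0, axis_log_im h1, dist_smul_smul,
      hg.dist_eq, Real.dist_eq]
    norm_num
  obtain ⟨D, hD0, hD1⟩ := exists_smul_axis hd
  rw [axis_log_im h0] at hD0
  rw [axis_log_im h1] at hD1
  refine ⟨(D * A)⁻¹, fun s => ?_⟩
  rw [eq_inv_smul_iff]
  refine eq_axis_of_dist zero_ne_one ?_ ?_
  · rw [← hD0, mul_smul, dist_smul_smul, dist_smul_smul, hg.dist_eq, Real.dist_eq]
  · rw [← hD1, mul_smul, dist_smul_smul, dist_smul_smul, hg.dist_eq, Real.dist_eq]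

/-- Two geodesics that agree at two times agree. -/
theorem geodesic_ext {g₁ g₂ : ℝ → ℍ} (h₁ : Isometry g₁) (h₂ : Isometry g₂) {a b : ℝ} (hab : a ≠ b)
    (ha : g₁ a = g₂ a) (hb : g₁ b = g₂ b) : g₁ = g₂ := by
  obtain ⟨A, hA⟩ := exists_eq_smul_axis h₂
  ext1 s
  rw [hA s, ← inv_smul_eq_iff]
  have key : ∀ t, g₁ t = g₂ t → dist (A⁻¹ • g₁ s) (axis t) = |s - t| := fun t ht => by
    rw [← h₁.dist_eq s t |>.trans (Real.dist_eq s t), ht, hA t, ← dist_smul_smul A⁻¹ _ (A • axis t),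
      inv_smul_smul]
  exact eq_axis_of_dist hab (key a ha) (key b hb)

/-- The square of `sinh` of the distance to the imaginary axis. -/
def axisDefect (z : ℍ) : ℝ := (z.re / z.im) ^ 2

/-- The difference of the two sides is a perfect square that vanishes exactly at `e^s = |z|`, the
foot of the perpendicular from `z`; `exists_cosh_dist_axis` uses this value. -/
theorem one_add_axisDefect_le (z : ℍ) (s : ℝ) :
    1 + axisDefect z ≤ Real.cosh (dist z (axis s)) ^ 2 := by
  rw [cosh_dist_axis, axisDefect]
  have h1 := z.im_pos
  have h2 := Real.exp_pos s
  rw [div_pow, div_pow, ← sub_nonneg]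
  have : (z.re ^ 2 + z.im ^ 2 + Real.exp s ^ 2) ^ 2 / (2 * z.im * Real.exp s) ^ 2 -
      (1 + z.re ^ 2 / z.im ^ 2) =
      ((z.re ^ 2 + z.im ^ 2 - Real.exp s ^ 2) / (2 * z.im * Real.exp s)) ^ 2 := by
    field_simp
    ring
  rw [this]
  positivity

theorem exists_cosh_dist_axis (z : ℍ) :
    ∃ s, Real.cosh (dist z (axis s)) ^ 2 = 1 + axisDefect z := by
  have h1 := z.im_pos
  have h3 : 0 < z.re ^ 2 + z.im ^ 2 := by positivity
  refine ⟨Real.log √(z.re ^ 2 + z.im ^ 2), ?_⟩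
  rw [cosh_dist_axis, axisDefect, Real.exp_log (Real.sqrt_pos.mpr h3), div_pow, mul_pow,
    Real.sq_sqrt h3.le]
  field_simp
  ring

theorem axisDefect_le_of_dist_le {z : ℍ} {s r : ℝ} (h : dist z (axis s) ≤ r) :
    axisDefect z ≤ Real.sinh r ^ 2 := by
  have h1 := one_add_axisDefect_le z s
  have h2 : Real.cosh (dist z (axis s)) ≤ Real.cosh r :=
    Real.cosh_le_cosh.mpr (by rw [abs_of_nonneg dist_nonneg]; exact h.trans (le_abs_self r))
  have h3 : Real.cosh (dist z (axis s)) ^ 2 ≤ Real.cosh r ^ 2 :=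
    pow_le_pow_left₀ (Real.cosh_pos _).le h2 2
  rw [Real.cosh_sq r] at h3
  linarith

theorem exists_dist_le_of_axisDefect_le {z : ℍ} {r : ℝ} (hr : 0 ≤ r)
    (h : axisDefect z ≤ Real.sinh r ^ 2) : ∃ s, dist z (axis s) ≤ r := by
  obtain ⟨s, hs⟩ := exists_cosh_dist_axis z
  refine ⟨s, ?_⟩
  have h3 : Real.cosh (dist z (axis s)) ^ 2 ≤ Real.cosh r ^ 2 := by
    rw [Real.cosh_sq r]; linarith
  have h4 := Real.cosh_le_cosh.mp (le_of_abs_le (abs_le_of_sq_le_sq h3 (Real.cosh_pos r).le))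
  rwa [abs_of_nonneg dist_nonneg, abs_of_nonneg hr] at h4

theorem continuous_axisDefect : Continuous axisDefect := by
  unfold axisDefect
  exact (continuous_re.div continuous_im fun z => z.im_ne_zero).pow 2

theorem isSmoothLift_axisDefect : IsSmoothLift axisDefect := by
  have h : ContDiffOn ℝ ∞ (fun w : ℂ => (w.re / w.im) ^ 2) {w : ℂ | 0 < w.im} := by
    refine ContDiffOn.pow (ContDiffOn.div ?_ ?_ fun w hw => ne_of_gt hw) 2
    · exact Complex.reCLM.contDiff.contDiffOn
    · exact Complex.imCLM.contDiff.contDiffOn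
  refine h.congr fun w hw => ?_
  simp only [axisDefect]
  rw [ofComplex_apply_of_im_pos hw]
  rfl

/-- An isometry that translates the imaginary axis is `z ↦ e^ℓ z` or `z ↦ - e^ℓ z̄`. -/
theorem smul_of_translates_axis {B : GL (Fin 2) ℝ} {ℓ : ℝ} (hB : ∀ s, B • axis s = axis (s + ℓ)) :
    ∃ e : ℝ, e ^ 2 = 1 ∧ ∀ z : ℍ, (B • z).re = e * Real.exp ℓ * z.re ∧
      (B • z).im = Real.exp ℓ * z.im := by
  wlog hd : 0 < B.det.val generalizing B
  · have hJ : ∀ z : ℍ, (J • z).re = -z.re ∧ (J • z).im = z.im := fun z => by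
      rw [← coe_im, ← coe_re, coe_J_smul]; simp
    obtain ⟨e, he, h⟩ := this (B := J * B) (fun s => by
      rw [mul_smul, hB]
      exact UpperHalfPlane.ext_re_im (by rw [(hJ _).1]; simp) (hJ _).2) (det_J_mul_pos hd)
    refine ⟨-e, by rw [neg_sq, he], fun z => ?_⟩
    have h1 := h z
    rw [mul_smul, (hJ _).1, (hJ _).2] at h1
    exact ⟨by linarith [h1.1], h1.2⟩
  · have key : ∀ s : ℝ, B 0 1 = -(B 1 0 * Real.exp s * Real.exp (s + ℓ)) ∧
        B 0 0 * Real.exp s = B 1 1 * Real.exp (s + ℓ) := by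
      intro s
      have h := congrArg UpperHalfPlane.coe (hB s)
      rw [coe_smul_of_det_pos hd, div_eq_iff (denom_ne_zero B _)] at h
      have hre := congrArg Complex.re h
      have him := congrArg Complex.im h
      simp [num, denom] at hre him
      constructor
      · linarith
      · linarith
    obtain ⟨h1, h2⟩ := key 0
    obtain ⟨h3, -⟩ := key 1
    rw [zero_add] at h1 h2
    rw [Real.exp_zero, mul_one] at h1 h2
    -- The times `0` and `1` give two expressions for the entry `B 0 1`, and they are compatible
    -- only if `B 1 0` vanishes.
    have hc : B 1 0 = 0 := by
      have h4 : B 1 0 * (Real.exp 1 * Real.exp (1 + ℓ) - Real.exp ℓ) = 0 := by linarith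
      refine (mul_eq_zero.mp h4).resolve_right ?_
      have e1 : (1 : ℝ) < Real.exp 1 := Real.one_lt_exp_iff.mpr one_pos
      have e2 : Real.exp ℓ < Real.exp (1 + ℓ) := Real.exp_lt_exp.mpr (by linarith)
      have e3 := Real.exp_pos ℓ
      nlinarith
    have hb : B 0 1 = 0 := by rw [h1, hc]; ring
    have hd0 : B 1 1 ≠ 0 := by
      intro h0
      have := B.det.ne_zero
      rw [Matrix.GeneralLinearGroup.val_det_apply, Matrix.det_fin_two, hc, h0] at this
      simp at this
    refine ⟨1, by norm_num, fun z => ?_⟩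
    have hz : ((B • z : ℍ) : ℂ) = Real.exp ℓ * z := by
      rw [coe_smul_of_det_pos hd, num, denom, hc, hb, h2]
      have : (B 1 1 : ℂ) ≠ 0 := by exact_mod_cast hd0
      push_cast
      rw [div_eq_iff (by simpa using this)]
      ring
    rw [← coe_re, ← coe_im, hz, Complex.re_ofReal_mul, Complex.im_ofReal_mul]
    exact ⟨by rw [one_mul]; rfl, rfl⟩


/-- The holomorphic coordinates `s + i τ ↦ i exp (s + i τ)` on `ℍ`. -/
def fermi (ζ : ℂ) : ℂ := Complex.I * Complex.exp ζ

theorem fermi_re (ζ : ℂ) : (fermi ζ).re = -(Real.exp ζ.re * Real.sin ζ.im) := by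
  simp [fermi, Complex.exp_im]

theorem fermi_im (ζ : ℂ) : (fermi ζ).im = Real.exp ζ.re * Real.cos ζ.im := by
  simp [fermi, Complex.exp_re]

theorem fermi_im_pos {ζ : ℂ} (h : |ζ.im| < Real.pi / 2) : 0 < (fermi ζ).im := by
  rw [fermi_im]
  exact mul_pos (Real.exp_pos _) (Real.cos_pos_of_mem_Ioo (abs_lt.mp h))

theorem ofComplex_fermi_re {ζ : ℂ} (h : |ζ.im| < Real.pi / 2) :
    (ofComplex (fermi ζ)).re = -(Real.exp ζ.re * Real.sin ζ.im) := by
  rw [ofComplex_apply_of_im_pos (fermi_im_pos h), mk_re, fermi_re]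

theorem ofComplex_fermi_im {ζ : ℂ} (h : |ζ.im| < Real.pi / 2) :
    (ofComplex (fermi ζ)).im = Real.exp ζ.re * Real.cos ζ.im := by
  rw [ofComplex_apply_of_im_pos (fermi_im_pos h), mk_im, fermi_im]

theorem coe_ofComplex_fermi {ζ : ℂ} (h : |ζ.im| < Real.pi / 2) :
    (ofComplex (fermi ζ) : ℂ) = fermi ζ := by
  rw [ofComplex_apply_of_im_pos (fermi_im_pos h)]

theorem axisDefect_fermi {ζ : ℂ} (h : |ζ.im| < Real.pi / 2) :
    axisDefect (ofComplex (fermi ζ)) = Real.tan ζ.im ^ 2 := by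
  rw [axisDefect, ofComplex_fermi_re h, ofComplex_fermi_im h, Real.tan_eq_sin_div_cos]
  have := (Real.exp_pos ζ.re).ne'
  have := (Real.cos_pos_of_mem_Ioo (abs_lt.mp h)).ne'
  field_simp

theorem exists_fermi_eq (z : ℍ) : ∃ ζ : ℂ, |ζ.im| < Real.pi / 2 ∧ ofComplex (fermi ζ) = z := by
  have hne : (-Complex.I * z : ℂ) ≠ 0 := mul_ne_zero (by simp) z.ne_zero
  have hre : 0 < (-Complex.I * z : ℂ).re := by simp [z.im_pos]
  refine ⟨Complex.log (-Complex.I * z), ?_, ?_⟩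
  · rw [Complex.log_im]
    exact Complex.abs_arg_lt_pi_div_two_iff.mpr (Or.inl hre)
  · rw [fermi, Complex.exp_log hne]
    have : Complex.I * (-Complex.I * z) = z := by
      linear_combination (-(z : ℂ)) * Complex.I_mul_I
    rw [this, ofComplex_apply]

theorem fermi_injOn : InjOn fermi {ζ : ℂ | |ζ.im| < Real.pi / 2} := by
  intro ζ hζ ζ' hζ' h
  have h1 : Complex.exp ζ = Complex.exp ζ' := mul_left_cancel₀ Complex.I_ne_zero h
  have hpi := Real.pi_pos
  have a1 := abs_lt.mp (show |ζ.im| < Real.pi / 2 from hζ)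
  have a2 := abs_lt.mp (show |ζ'.im| < Real.pi / 2 from hζ')
  exact Complex.exp_inj_of_neg_pi_lt_of_le_pi (by linarith) (by linarith) (by linarith)
    (by linarith) h1

theorem ofComplex_fermi_add (ζ : ℂ) (h : |ζ.im| < Real.pi / 2) (a : ℝ) :
    (ofComplex (fermi (ζ + a))).re = Real.exp a * (ofComplex (fermi ζ)).re ∧
      (ofComplex (fermi (ζ + a))).im = Real.exp a * (ofComplex (fermi ζ)).im := by
  have h' : |(ζ + a).im| < Real.pi / 2 := by simpa using h
  rw [ofComplex_fermi_re h', ofComplex_fermi_im h', ofComplex_fermi_re h, ofComplex_fermi_im h]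
  simp only [Complex.add_re, Complex.ofReal_re, Complex.add_im, Complex.ofReal_im, add_zero,
    Real.exp_add]
  constructor <;> ring

theorem hasDerivAt_fermi (ζ : ℂ) : HasDerivAt fermi (fermi ζ) ζ :=
  (Complex.hasDerivAt_exp ζ).const_mul Complex.I

theorem analyticAt_fermi (ζ : ℂ) : AnalyticAt ℂ fermi ζ :=
  analyticAt_const.mul (analyticAt_cexp)

theorem norm_fermi (ζ : ℂ) : ‖fermi ζ‖ = Real.exp ζ.re := by
  simp [fermi, Complex.norm_exp]

/-- In the coordinates `fermi` the hyperbolic Laplacian is `cos² τ` times the flat one. -/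
theorem laplacian_comp_fermi {u : ℍ → ℝ} (hu : IsSmoothLift u) {ζ : ℂ}
    (h : |ζ.im| < Real.pi / 2) :
    Laplacian.laplacian (fun ζ => u (ofComplex (fermi ζ))) ζ =
      -(planeLaplacian u (ofComplex (fermi ζ)) / Real.cos ζ.im ^ 2) := by
  have hc := hu.contDiffAt (fermi_im_pos h)
  have := laplacian_comp_holomorphic (analyticAt_fermi ζ)
    (hc.of_le (WithTop.coe_le_coe.mpr (le_top : (2 : ℕ∞) ≤ ⊤)))
  rw [show (fun ζ => u (ofComplex (fermi ζ))) = (fun w : ℂ => u (ofComplex w)) ∘ fermi from rfl,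
    this, (hasDerivAt_fermi ζ).deriv, norm_fermi, planeLaplacian, ofComplex_fermi_im h,
    coe_ofComplex_fermi h]
  have := (Real.cos_pos_of_mem_Ioo (abs_lt.mp h)).ne'
  field_simp

theorem contDiffOn_comp_fermi {u : ℍ → ℝ} (hu : IsSmoothLift u) :
    ContDiffOn ℝ ∞ (fun ζ => u (ofComplex (fermi ζ))) {ζ : ℂ | |ζ.im| < Real.pi / 2} := by
  refine ContDiffOn.comp (g := fun w : ℂ => u (ofComplex w)) hu (f := fermi) ?_
    fun ζ hζ => fermi_im_pos hζ
  exact fun ζ _ => ((analyticAt_fermi ζ).restrictScalars (𝕜 := ℝ)).contDiffAt.contDiffWithinAt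

/-! ### Areas in coordinates -/

theorem det_prod (M : ℝ × ℝ →L[ℝ] ℝ × ℝ) :
    M.det = (M (1, 0)).1 * (M (0, 1)).2 - (M (0, 1)).1 * (M (1, 0)).2 := by
  rw [ContinuousLinearMap.det, ← LinearMap.det_toMatrix (Module.Basis.finTwoProd ℝ),
    Matrix.det_fin_two]
  simp [LinearMap.toMatrix_apply]

/-- The vector `(1, 1)` shows that the images of the basis vectors are orthogonal. Lagrange's
identity then makes the squared determinant the product of their squared lengths. -/
theorem abs_det_of_norm_sq {L : ℝ × ℝ →L[ℝ] ℂ} {y α β : ℝ} (hy : 0 < y) (hα : 0 ≤ α) (hβ : 0 ≤ β)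
    (h : ∀ v, ‖L v‖ ^ 2 / y ^ 2 = α ^ 2 * v.1 ^ 2 + β ^ 2 * v.2 ^ 2) :
    |((Complex.equivRealProdCLM : ℂ →L[ℝ] ℝ × ℝ) ∘L L).det| = α * β * y ^ 2 := by
  have h' : ∀ v, (L v).re ^ 2 + (L v).im ^ 2 = (α ^ 2 * v.1 ^ 2 + β ^ 2 * v.2 ^ 2) * y ^ 2 := by
    intro v
    rw [← h v, div_mul_cancel₀ _ (by positivity), ← Complex.normSq_eq_norm_sq,
      Complex.normSq_apply]
    ring
  have h1 := h' (1, 0)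
  have h2 := h' (0, 1)
  have h3 := h' (1, 1)
  have e : L (1, 1) = L (1, 0) + L (0, 1) := by rw [← map_add]; simp
  rw [e] at h3
  simp only [Complex.add_re, Complex.add_im] at h1 h2 h3
  rw [det_prod, ← abs_of_nonneg (show 0 ≤ α * β * y ^ 2 by positivity), ← sq_eq_sq_iff_abs_eq_abs]
  simp only [ContinuousLinearMap.coe_comp, Function.comp_apply]
  change ((L (1, 0)).re * (L (0, 1)).im - (L (0, 1)).re * (L (1, 0)).im) ^ 2 = _
  have h4 : (L (1, 0)).re * (L (0, 1)).re + (L (1, 0)).im * (L (0, 1)).im = 0 := by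
    linear_combination (h3 - h1 - h2) / 2
  have h5 : ((L (1, 0)).re ^ 2 + (L (1, 0)).im ^ 2) * ((L (0, 1)).re ^ 2 + (L (0, 1)).im ^ 2) =
      α ^ 2 * β ^ 2 * y ^ 4 := by
    rw [h1, h2]; ring
  linear_combination h5 -
    ((L (1, 0)).re * (L (0, 1)).re + (L (1, 0)).im * (L (0, 1)).im) * h4

/-- The area of the image of a parametrization that pulls the hyperbolic metric back to
`α² dx² + β² dy²`. -/
theorem volume_image_eq {F : ℝ × ℝ → ℍ} {s : Set (ℝ × ℝ)} (hs : MeasurableSet s)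
    {L : ℝ × ℝ → ℝ × ℝ →L[ℝ] ℂ} (hL : ∀ p ∈ s, HasFDerivWithinAt (fun p => (F p : ℂ)) (L p) s p)
    (hF : InjOn F s) {α β : ℝ × ℝ → ℝ} (hα : ∀ p ∈ s, 0 ≤ α p) (hβ : ∀ p ∈ s, 0 ≤ β p)
    (h : ∀ p ∈ s, ∀ v, ‖L p v‖ ^ 2 / (F p).im ^ 2 = α p ^ 2 * v.1 ^ 2 + β p ^ 2 * v.2 ^ 2) :
    volume (F '' s) = ∫⁻ p in s, ENNReal.ofReal (α p * β p) := by
  let G : ℝ × ℝ → ℝ × ℝ := fun p => ((F p).re, (F p).im)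
  have hG : ∀ p ∈ s, HasFDerivWithinAt G ((Complex.equivRealProdCLM : ℂ →L[ℝ] ℝ × ℝ) ∘L L p) s p :=
    fun p hp => Complex.equivRealProdCLM.hasFDerivAt.comp_hasFDerivWithinAt p (hL p hp)
  have hGinj : InjOn G s := fun p hp q hq hpq => hF hp hq
    (UpperHalfPlane.ext_re_im (congrArg Prod.fst hpq) (congrArg Prod.snd hpq))
  have hmeas : MeasurableSet (G '' s) := measurable_image_of_fderivWithin hs hG hGinj
  have himg : UpperHalfPlane.coe '' (F '' s) = Complex.measurableEquivRealProd ⁻¹' (G '' s) := by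
    ext w
    simp only [mem_image, mem_preimage, G, exists_exists_and_eq_and]
    constructor
    · rintro ⟨p, hp, rfl⟩
      exact ⟨p, hp, rfl⟩
    · rintro ⟨p, hp, hw⟩
      exact ⟨p, hp, Complex.ext (congrArg Prod.fst hw) (congrArg Prod.snd hw)⟩
  rw [volume_eq_lintegral, himg]
  have hmp := Complex.volume_preserving_equiv_real_prod.setLIntegral_comp_preimage hmeas
    (f := fun p : ℝ × ℝ => (((1 / ‖p.2‖₊) ^ 2 : NNReal) : ℝ≥0∞))
    (by fun_prop)
  have e : ∫⁻ z : ℂ in Complex.measurableEquivRealProd ⁻¹' (G '' s),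
      (((1 / ‖z.im‖₊) ^ 2 : NNReal) : ℝ≥0∞) = ∫⁻ p in G '' s,
      (((1 / ‖p.2‖₊) ^ 2 : NNReal) : ℝ≥0∞) := by
    rw [← hmp]; rfl
  rw [e, lintegral_image_eq_lintegral_abs_det_fderiv_mul volume hs hG hGinj]
  refine setLIntegral_congr_fun hs fun p hp => ?_
  have hy := (F p).im_pos
  rw [abs_det_of_norm_sq hy (hα p hp) (hβ p hp) (h p hp)]
  have : (((1 / ‖(G p).2‖₊) ^ 2 : NNReal) : ℝ≥0∞) = ENNReal.ofReal (1 / (F p).im ^ 2) := by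
    rw [ENNReal.ofReal, ENNReal.coe_inj]
    ext
    rw [Real.coe_toNNReal _ (by positivity)]
    push_cast
    rw [show (G p).2 = (F p).im from rfl, Real.norm_of_nonneg hy.le, one_div_pow]
  rw [this, ← ENNReal.ofReal_mul (by have := hα p hp; have := hβ p hp; positivity)]
  congr 1
  field_simp

/-- Change of variables for the hyperbolic area. -/
theorem setIntegral_image_eq {F : ℝ × ℝ → ℍ} {s : Set (ℝ × ℝ)} (hs : MeasurableSet s)
    {L : ℝ × ℝ → ℝ × ℝ →L[ℝ] ℂ} (hL : ∀ p ∈ s, HasFDerivWithinAt (fun p => (F p : ℂ)) (L p) s p)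
    (hF : InjOn F s) {α β : ℝ × ℝ → ℝ} (hα : ∀ p ∈ s, 0 ≤ α p) (hβ : ∀ p ∈ s, 0 ≤ β p)
    (hαβ : AEMeasurable (fun p => α p * β p) (volume.restrict s))
    (h : ∀ p ∈ s, ∀ v, ‖L p v‖ ^ 2 / (F p).im ^ 2 = α p ^ 2 * v.1 ^ 2 + β p ^ 2 * v.2 ^ 2)
    {u : ℍ → ℝ} (hu : Measurable u) :
    ∫ z in F '' s, u z = ∫ p in s, α p * β p * u (F p) := by
  have hcont : ContinuousOn F s := by
    rw [UpperHalfPlane.isEmbedding_coe.continuousOn_iff]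
    exact fun p hp => (hL p hp).continuousWithinAt
  have hFm : AEMeasurable F (volume.restrict s) := hcont.aemeasurable hs
  set ν := (volume.restrict s).withDensity fun p => ENNReal.ofReal (α p * β p) with hν
  have hFν : AEMeasurable F ν := hFm.mono_ac (withDensity_absolutelyContinuous _ _)
  -- The area formula on all sets `s ∩ F ⁻¹' C` identifies the measures, so integrals of arbitrary
  -- measurable functions follow at once.
  have hmap : volume.restrict (F '' s) = Measure.map F ν := by
    ext C hC
    have hsC : MeasurableSet (s ∩ F ⁻¹' C) := by
      have := hs.subtype_image (hcont.domRestrict.measurable hC)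
      convert! this using 1
      ext p
      simp [and_comm]
    rw [Measure.restrict_apply hC, Measure.map_apply_of_aemeasurable hFν hC, inter_comm,
      ← image_inter_preimage, volume_image_eq hsC
        (fun p hp => (hL p hp.1).mono inter_subset_left) (hF.mono inter_subset_left)
        (fun p hp => hα p hp.1) (fun p hp => hβ p hp.1) (fun p hp => h p hp.1), hν]
    rw [← restrict_withDensity hs, Measure.restrict_apply' hs, inter_comm _ s,
      withDensity_apply _ hsC]
  rw [hmap, integral_map hFν hu.aestronglyMeasurable, hν,
    integral_withDensity_eq_integral_toReal_smul₀ (by fun_prop) (by simp)]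
  refine setIntegral_congr_fun hs fun p hp => ?_
  rw [ENNReal.toReal_ofReal (mul_nonneg (hα p hp) (hβ p hp)), smul_eq_mul]

section

/-! ### Collars -/

variable {Γ : Subgroup (Equiv.Perm ℍ)}

/-- The closed geodesic `c` lifts to the image under `A` of the imaginary axis, along which `h`
is a translation by `ℓ`. -/
structure Frame (Γ : Subgroup (Equiv.Perm ℍ)) (ℓ : ℝ) (c : ℝ → Surface Γ) (A : GL (Fin 2) ℝ)
    (h : Equiv.Perm ℍ) : Prop where
  length_pos : 0 < ℓ
  mem : h ∈ Γ
  lift : ∀ t, c t = proj Γ (A • axis t)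
  translates : ∀ t, h (A • axis t) = A • axis (t + ℓ)

/-- Closedness alone provides an element of `Γ` for each time `t`, possibly depending on `t`. For
`t` in `[0, 1]` only finitely many elements can occur by proper discontinuity, so one of them serves
two times, and geodesics that agree at two times agree. -/
theorem exists_frame (hΓ : IsClosedSurfaceGroup Γ) {ℓ : ℝ} {c : ℝ → Surface Γ}
    (hc : IsClosedGeodesic Γ ℓ c) : ∃ A h, Frame Γ ℓ c A h := by
  obtain ⟨g, hg, hcg⟩ := hc.geodesic
  have hℓ := hc.length_pos
  have h1 : ∀ t, ∃ γ ∈ Γ, γ (g t) = g (t + ℓ) := by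
    intro t
    have := hc.closed t
    rw [hcg, hcg] at this
    exact proj_eq_iff.mp this
  choose γ hγ hγt using h1
  have hmaps : MapsTo γ (Icc (0 : ℝ) 1) {γ | γ ∈ Γ ∧ dist (γ (g 0)) (g 0) ≤ 2 + ℓ} := by
    intro t ht
    refine ⟨hγ t, ?_⟩
    have e1 : dist (γ t (g 0)) (γ t (g t)) ≤ 1 := by
      rw [dist_apply hΓ (hγ t), hg.dist_eq, Real.dist_eq, zero_sub, abs_neg, abs_of_nonneg ht.1]
      exact ht.2
    have e2 : dist (γ t (g t)) (g 0) ≤ 1 + ℓ := by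
      rw [hγt, hg.dist_eq, Real.dist_eq, sub_zero, abs_of_nonneg (by linarith [ht.1])]
      linarith [ht.2]
    linarith [dist_triangle (γ t (g 0)) (γ t (g t)) (g 0)]
  obtain ⟨a, -, b, -, hab, hγab⟩ := (Set.Icc_infinite zero_lt_one).exists_ne_map_eq_of_mapsTo hmaps
    (finite_inter_closedBall hΓ _ _ _)
  obtain ⟨A, hA⟩ := exists_eq_smul_axis hg
  have hiso1 : Isometry fun t => γ a (g t) :=
    (Isometry.of_dist_eq (dist_apply hΓ (hγ a))).comp hg
  have hiso2 : Isometry fun t => g (t + ℓ) :=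
    hg.comp (Isometry.of_dist_eq fun x y => by simp)
  have heq := geodesic_ext hiso1 hiso2 hab (hγt a) (by rw [hγab]; exact hγt b)
  refine ⟨A, γ a, hℓ, hγ a, fun t => by rw [hcg, hA], fun t => ?_⟩
  rw [← hA, ← hA]
  exact congrFun heq t

/-- The square of `sinh` of the distance to the image under `A` of the imaginary axis. -/
def defect (A : GL (Fin 2) ℝ) (z : ℍ) : ℝ := axisDefect (A⁻¹ • z)

theorem continuous_defect (A : GL (Fin 2) ℝ) : Continuous (defect A) :=
  continuous_axisDefect.comp (continuous_const_smul _)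

theorem isSmoothLift_defect (A : GL (Fin 2) ℝ) : IsSmoothLift (defect A) :=
  isSmoothLift_axisDefect.comp_smul A⁻¹

/-- Fermi coordinates along the image under `A` of the imaginary axis. -/
def fermiAt (A : GL (Fin 2) ℝ) (ζ : ℂ) : ℍ := A • ofComplex (fermi ζ)

theorem defect_fermiAt (A : GL (Fin 2) ℝ) {ζ : ℂ} (h : |ζ.im| < Real.pi / 2) :
    defect A (fermiAt A ζ) = Real.tan ζ.im ^ 2 := by
  rw [defect, fermiAt, inv_smul_smul, axisDefect_fermi h]

theorem exists_fermiAt_eq (A : GL (Fin 2) ℝ) (z : ℍ) :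
    ∃ ζ : ℂ, |ζ.im| < Real.pi / 2 ∧ fermiAt A ζ = z := by
  obtain ⟨ζ, h1, h2⟩ := exists_fermi_eq (A⁻¹ • z)
  exact ⟨ζ, h1, by rw [fermiAt, h2, smul_inv_smul]⟩

theorem axis_eq_fermi (t : ℝ) : axis t = ofComplex (fermi t) := by
  have h : |(t : ℂ).im| < Real.pi / 2 := by simp [Real.pi_pos]
  refine UpperHalfPlane.ext_re_im ?_ ?_
  · rw [ofComplex_fermi_re h]; simp
  · rw [ofComplex_fermi_im h]; simp

variable {ℓ : ℝ} {c : ℝ → Surface Γ} {A : GL (Fin 2) ℝ} {h : Equiv.Perm ℍ}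

theorem Frame.exists_sign (hf : Frame Γ ℓ c A h) (hΓ : IsClosedSurfaceGroup Γ) :
    ∃ e : ℝ, e ^ 2 = 1 ∧ ∀ z : ℍ, (A⁻¹ • h (A • z)).re = e * Real.exp ℓ * z.re ∧
      (A⁻¹ • h (A • z)).im = Real.exp ℓ * z.im := by
  obtain ⟨g, hg⟩ := exists_gl hΓ hf.mem
  have key : ∀ z : ℍ, (A⁻¹ * g * A) • z = A⁻¹ • h (A • z) := fun z => by
    rw [hg, mul_smul, mul_smul]
  obtain ⟨e, he, hz⟩ := smul_of_translates_axis (B := A⁻¹ * g * A) (ℓ := ℓ) fun s => by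
    rw [key, hf.translates, inv_smul_smul]
  exact ⟨e, he, fun z => by rw [← key]; exact hz z⟩

theorem Frame.defect_apply (hf : Frame Γ ℓ c A h) (hΓ : IsClosedSurfaceGroup Γ) (z : ℍ) :
    defect A (h z) = defect A z := by
  obtain ⟨e, he, hz⟩ := hf.exists_sign hΓ
  obtain ⟨h1, h2⟩ := hz (A⁻¹ • z)
  rw [smul_inv_smul] at h1 h2
  rw [defect, axisDefect, h1, h2, defect, axisDefect, div_pow, div_pow, mul_pow, mul_pow, he,
    mul_pow, one_mul]
  have := (Real.exp_pos ℓ).ne'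
  have := (A⁻¹ • z).im_ne_zero
  field_simp

/-- `h` itself may be a glide reflection that exchanges the two sides of the axis. Its square is
always a pure translation, so the argument works with the period `2 ℓ` throughout. -/
theorem Frame.sq_fermiAt (hf : Frame Γ ℓ c A h) (hΓ : IsClosedSurfaceGroup Γ) {ζ : ℂ}
    (hζ : |ζ.im| < Real.pi / 2) : (h * h) (fermiAt A ζ) = fermiAt A (ζ + (2 * ℓ : ℝ)) := by
  obtain ⟨e, he, hz⟩ := hf.exists_sign hΓ
  rw [Equiv.Perm.mul_apply, fermiAt, fermiAt, ← inv_smul_eq_iff]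
  obtain ⟨h1, h2⟩ := hz (ofComplex (fermi ζ))
  obtain ⟨h3, h4⟩ := hz (A⁻¹ • h (A • ofComplex (fermi ζ)))
  rw [smul_inv_smul] at h3 h4
  obtain ⟨h5, h6⟩ := ofComplex_fermi_add ζ hζ (2 * ℓ)
  have e2 : Real.exp (2 * ℓ) = Real.exp ℓ * Real.exp ℓ := by rw [two_mul, Real.exp_add]
  refine UpperHalfPlane.ext_re_im ?_ ?_
  · rw [h3, h1, h5, e2]
    linear_combination (Real.exp ℓ * Real.exp ℓ * (ofComplex (fermi ζ)).re) * he
  · rw [h4, h2, h6, e2]; ring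

theorem Frame.zpow_fermiAt (hf : Frame Γ ℓ c A h) (hΓ : IsClosedSurfaceGroup Γ) (n : ℤ) {ζ : ℂ}
    (hζ : |ζ.im| < Real.pi / 2) :
    ((h * h) ^ n) (fermiAt A ζ) = fermiAt A (ζ + (n * (2 * ℓ) : ℝ)) := by
  have him : ∀ a : ℝ, |(ζ + (a : ℂ)).im| < Real.pi / 2 := fun a => by simpa using hζ
  induction n with
  | zero => simp
  | succ n ih =>
    rw [zpow_add_one, ← (Commute.self_zpow (h * h) n).eq, Equiv.Perm.mul_apply, ih,
      hf.sq_fermiAt hΓ (him _)]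
    congr 1
    push_cast
    ring
  | pred n ih =>
    rw [zpow_sub_one, ← ((Commute.refl (h * h)).inv_left.zpow_right _).eq, Equiv.Perm.mul_apply, ih,
      Equiv.Perm.inv_eq_iff_eq, hf.sq_fermiAt hΓ (him _)]
    congr 1
    push_cast
    ring

theorem Frame.zpow_mem (hf : Frame Γ ℓ c A h) (n : ℤ) : (h * h) ^ n ∈ Γ :=
  Γ.zpow_mem (Γ.mul_mem hf.mem hf.mem) n

theorem Frame.defect_zpow (hf : Frame Γ ℓ c A h) (hΓ : IsClosedSurfaceGroup Γ) (n : ℤ) (z : ℍ) :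
    defect A ((h ^ n) z) = defect A z := by
  induction n generalizing z with
  | zero => simp
  | succ n ih => rw [zpow_add_one, Equiv.Perm.mul_apply, ih, hf.defect_apply hΓ]
  | pred n ih =>
    rw [zpow_sub_one, Equiv.Perm.mul_apply, ih, ← hf.defect_apply hΓ (h⁻¹ z)]
    congr 1
    exact h.apply_symm_apply z

theorem exists_dist_le_of_defect_le {z : ℍ} {r : ℝ} (hr : 0 ≤ r)
    (hz : defect A z ≤ Real.sinh r ^ 2) : ∃ s, dist z (A • axis s) ≤ r := by
  obtain ⟨s, hs⟩ := exists_dist_le_of_axisDefect_le hr hz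
  refine ⟨s, ?_⟩
  rwa [← dist_smul_smul A⁻¹, inv_smul_smul]

theorem defect_le_of_dist_le {z : ℍ} {s r : ℝ} (hz : dist z (A • axis s) ≤ r) :
    defect A z ≤ Real.sinh r ^ 2 := by
  refine axisDefect_le_of_dist_le (s := s) ?_
  rwa [← dist_smul_smul A⁻¹, inv_smul_smul] at hz

theorem surfaceDist_nonneg (x y : Surface Γ) : 0 ≤ surfaceDist Γ x y := by
  refine Real.sInf_nonneg ?_
  rintro d ⟨z, w, -, -, rfl⟩
  exact dist_nonneg

theorem Frame.mem_collar_of_defect_le (hf : Frame Γ ℓ c A h) {w : ℝ} (hw : 0 ≤ w) {z : ℍ}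
    (hz : defect A z ≤ Real.sinh w ^ 2) : proj Γ z ∈ collar Γ w c := by
  obtain ⟨s, hs⟩ := exists_dist_le_of_defect_le hw hz
  have h1 : surfaceDist Γ (proj Γ z) (c s) ≤ w := by
    refine le_trans (csInf_le ?_ ?_) hs
    · refine ⟨0, ?_⟩
      rintro d ⟨z, w, -, -, rfl⟩
      exact dist_nonneg
    · exact ⟨z, A • axis s, rfl, (hf.lift s).symm, rfl⟩
  have h2 : BddBelow (range fun t => surfaceDist Γ (proj Γ z) (c t)) := by
    refine ⟨0, ?_⟩
    rintro _ ⟨t, rfl⟩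
    exact surfaceDist_nonneg _ _
  exact (ciInf_le h2 s).trans h1

theorem Frame.exists_dist_lt (hf : Frame Γ ℓ c A h) (hΓ : IsClosedSurfaceGroup Γ)
    {w : ℝ} {z : ℍ} (hz : proj Γ z ∈ collar Γ w c) {ε : ℝ} (hε : 0 < ε) :
    ∃ γ ∈ Γ, ∃ t, dist (γ z) (A • axis t) < w + ε ∧ |t| ≤ 2 * ℓ := by
  obtain ⟨t, ht⟩ := exists_lt_of_ciInf_lt (lt_of_le_of_lt hz (lt_add_of_pos_right w hε))
  obtain ⟨d, ⟨z', w', hz', hw', rfl⟩, hd⟩ := exists_lt_of_csInf_lt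
    (by obtain ⟨w', hw'⟩ := proj_surjective (c t); exact ⟨_, z, w', rfl, hw', rfl⟩) ht
  rw [hf.lift] at hw'
  obtain ⟨γ₁, hγ₁, rfl⟩ := proj_eq_iff.mp hz'
  obtain ⟨γ₂, hγ₂, rfl⟩ := proj_eq_iff.mp hw'
  have hℓ := hf.length_pos
  -- Moving `t` into one period by a power of `h²` keeps the nearby axis point in a bounded set,
  -- which proper discontinuity needs later.
  obtain ⟨n, hn, -⟩ := existsUnique_add_zsmul_mem_Ico (show (0 : ℝ) < 2 * ℓ by linarith) t 0
  simp only [zsmul_eq_mul, zero_add] at hn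
  refine ⟨(h * h) ^ n * (γ₂⁻¹ * γ₁),
    Γ.mul_mem (hf.zpow_mem n) (Γ.mul_mem (Γ.inv_mem hγ₂) hγ₁), t + n * (2 * ℓ), ?_, ?_⟩
  · have e : A • axis (t + n * (2 * ℓ)) = ((h * h) ^ n) (A • axis t) := by
      rw [axis_eq_fermi, axis_eq_fermi]
      have := hf.zpow_fermiAt hΓ n (ζ := t) (by simp [Real.pi_pos])
      rw [fermiAt, fermiAt] at this
      rw [this]
      push_cast
      rfl
    rw [e, Equiv.Perm.mul_apply, dist_apply hΓ (hf.zpow_mem n), Equiv.Perm.mul_apply,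
      dist_apply_comm hΓ (Γ.inv_mem hγ₂), inv_inv]
    exact hd
  · rw [abs_of_nonneg hn.1]; exact hn.2.le

/-- The infima in the definition of a collar are attained up to the closed bound: only finitely many
lifts of the point come near the relevant period of the axis. If all of them had a larger defect, a
common slack `ε` would contradict `Frame.exists_dist_lt`. -/
theorem Frame.exists_defect_le (hf : Frame Γ ℓ c A h) (hΓ : IsClosedSurfaceGroup Γ)
    {w : ℝ} {z : ℍ} (hz : proj Γ z ∈ collar Γ w c) :
    ∃ γ ∈ Γ, defect A (γ z) ≤ Real.sinh w ^ 2 := by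
  by_contra! hcon
  set Fin := {γ : Equiv.Perm ℍ | γ ∈ Γ ∧ dist (γ z) (A • axis 0) ≤ w + 1 + 2 * ℓ}
  have hfin : Fin.Finite := finite_inter_closedBall hΓ _ _ _
  have hev : ∀ᶠ ε in 𝓝[>] (0 : ℝ), ∀ γ ∈ Fin, Real.sinh (w + ε) ^ 2 < defect A (γ z) := by
    rw [Set.Finite.eventually_all hfin]
    intro γ hγ
    have hcont : Continuous fun ε => Real.sinh (w + ε) ^ 2 := by fun_prop
    have : Tendsto (fun ε => Real.sinh (w + ε) ^ 2) (𝓝[>] 0) (𝓝 (Real.sinh w ^ 2)) := by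
      have := hcont.tendsto 0
      rw [add_zero] at this
      exact this.mono_left nhdsWithin_le_nhds
    exact this.eventually_lt_const (hcon γ hγ.1)
  obtain ⟨ε, ⟨hε, hε0⟩, hε1⟩ := ((hev.and self_mem_nhdsWithin).and
    (nhdsWithin_le_nhds (Iio_mem_nhds zero_lt_one))).exists
  obtain ⟨γ, hγ, t, ht, ht'⟩ := hf.exists_dist_lt hΓ hz hε0
  refine absurd (hε γ ⟨hγ, ?_⟩) (not_lt.mpr (defect_le_of_dist_le ht.le))
  have e : dist (A • axis t) (A • axis 0) = |t| := by
    rw [dist_smul_smul, isometry_axis.dist_eq, Real.dist_eq, sub_zero]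
  have := dist_triangle (γ z) (A • axis t) (A • axis 0)
  rw [e] at this
  have : ε < 1 := hε1
  linarith

theorem Frame.mem_collar_iff (hf : Frame Γ ℓ c A h) (hΓ : IsClosedSurfaceGroup Γ)
    {w : ℝ} (hw : 0 ≤ w) {z : ℍ} :
    proj Γ z ∈ collar Γ w c ↔ ∃ γ ∈ Γ, defect A (γ z) ≤ Real.sinh w ^ 2 := by
  refine ⟨hf.exists_defect_le hΓ, ?_⟩
  rintro ⟨γ, hγ, hz⟩
  rw [← proj_apply hγ]
  exact hf.mem_collar_of_defect_le hw hz

theorem Frame.measurableSet_preimage_collar (hf : Frame Γ ℓ c A h) (hΓ : IsClosedSurfaceGroup Γ)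
    {w : ℝ} (hw : 0 ≤ w) : MeasurableSet (proj Γ ⁻¹' collar Γ w c) := by
  have := countable hΓ
  have e : proj Γ ⁻¹' collar Γ w c =
      ⋃ γ : Γ, {z | defect A ((γ : Equiv.Perm ℍ) z) ≤ Real.sinh w ^ 2} := by
    ext z
    rw [mem_preimage, hf.mem_collar_iff hΓ hw]
    simp
  rw [e]
  exact MeasurableSet.iUnion fun γ => (isClosed_le
    ((continuous_defect A).comp (continuous_apply hΓ γ.2)) continuous_const).measurableSet

end

/-! ### Areas of standard collars and of Fermi rectangles -/

section

variable {Γ : Subgroup (Equiv.Perm ℍ)}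

theorem lintegral_box {a b C : ℝ} (hab : a ≤ b) {f : ℝ → ℝ}
    (hf : ContinuousOn f (Icc a b)) (hf0 : ∀ x ∈ Icc a b, 0 ≤ f x) :
    ∫⁻ p in Icc a b ×ˢ Ico 0 C, ENNReal.ofReal (f p.1) = ENNReal.ofReal ((∫ x in a..b, f x) * C) := by
  have hfm : AEMeasurable (fun x => ENNReal.ofReal (f x)) (volume.restrict (Icc a b)) :=
    (hf.aemeasurable measurableSet_Icc).ennreal_ofReal
  have h1 := lintegral_prod_mul (μ := volume.restrict (Icc a b)) (ν := volume.restrict (Ico 0 C))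
    hfm (g := fun _ => 1) aemeasurable_const
  simp only [mul_one, lintegral_const, Measure.restrict_apply_univ, one_mul] at h1
  rw [Measure.volume_eq_prod, ← Measure.prod_restrict, h1, Real.volume_Ico, sub_zero,
    ENNReal.ofReal_mul (intervalIntegral.integral_nonneg hab hf0),
    intervalIntegral.integral_of_le hab, ← integral_Icc_eq_integral_Ioc,
    ofReal_integral_eq_lintegral_ofReal (hf.integrableOn_compact isCompact_Icc)]
  exact (ae_restrict_iff' measurableSet_Icc).mpr (Eventually.of_forall hf0)

theorem multiplicity_eq_one (hΓ : IsClosedSurfaceGroup Γ) {S : Set ℍ} {z : ℍ}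
    {γ : Equiv.Perm ℍ} (hγ : γ ∈ Γ) (hz : γ z ∈ S) (huniq : ∀ γ' ∈ Γ, γ' z ∈ S → γ' z = γ z) :
    multiplicity Γ S z = 1 := by
  rw [multiplicity, tsum_eq_single (⟨γ, hγ⟩ : Γ)]
  · exact indicator_of_mem hz _
  · intro γ' hne
    refine indicator_of_notMem (fun hmem => hne (Subtype.ext ?_)) _
    have h1 := huniq γ' γ'.2 hmem
    have h2 := hΓ.free (γ⁻¹ * γ') (Γ.mul_mem (Γ.inv_mem hγ) γ'.2) z (by
      rw [Equiv.Perm.mul_apply, h1]; exact γ.symm_apply_apply z)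
    exact (inv_mul_eq_one.mp h2).symm

theorem integral_cosh (w : ℝ) : ∫ x in -w..w, Real.cosh x = 2 * Real.sinh w := by
  rw [intervalIntegral.integral_eq_sub_of_hasDerivAt (fun x _ => Real.hasDerivAt_sinh x)
    (Real.continuous_cosh.intervalIntegrable _ _), Real.sinh_neg]
  ring

/-- The area of a standard collar. -/
theorem IsStandardCollar.volume_eq (hΓ : IsClosedSurfaceGroup Γ) {w ℓ : ℝ} {c : ℝ → Surface Γ}
    (hw : 0 < w) (hℓ : 0 < ℓ) (hstd : IsStandardCollar Γ w ℓ c)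
    (hmeas : MeasurableSet (proj Γ ⁻¹' collar Γ w c)) :
    volume (dirichletDomain Γ ∩ proj Γ ⁻¹' collar Γ w c) =
      ENNReal.ofReal (2 * ℓ * Real.sinh w) := by
  obtain ⟨Φ, hΦ, F, hΦF, hF, hmetric⟩ := hstd
  -- The half-open period represents each point of the circle once, so by bijectivity of `Φ` the
  -- image of `s` meets each orbit above the collar exactly once.
  set s : Set (ℝ × ℝ) := Icc (-w) w ×ˢ Ico 0 1 with hs
  have hsub : s ⊆ strip w := prod_mono subset_rfl (subset_univ _)
  have hsm : MeasurableSet s := measurableSet_Icc.prod measurableSet_Ico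
  have hder : ∀ p ∈ s, HasFDerivWithinAt (fun p => (F p : ℂ))
      (fderivWithin ℝ (fun q => (F q : ℂ)) (strip w) p) s p := fun p hp =>
    ((hF.differentiableOn (by simp)) p (hsub hp)).hasFDerivWithinAt.mono hsub
  have hΦmem : ∀ p ∈ s, ((p.1, (p.2 : UnitAddCircle)) : ℝ × UnitAddCircle) ∈
      Icc (-w) w ×ˢ (univ : Set UnitAddCircle) := fun p hp => ⟨hp.1, mem_univ _⟩
  have hproj : ∀ p ∈ s, ∀ q ∈ s, proj Γ (F p) = proj Γ (F q) → p = q := by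
    intro p hp q hq hpq
    rw [← hΦF p (hsub hp), ← hΦF q (hsub hq)] at hpq
    have h1 := hΦ.injOn (hΦmem p hp) (hΦmem q hq) hpq
    have h2 : (p.2 : UnitAddCircle) = q.2 := congrArg Prod.snd h1
    have h3 : p.2 = q.2 := by
      refine (AddCircle.coe_eq_coe_iff_of_mem_Ico (p := (1 : ℝ)) (a := 0) ?_ ?_).mp h2
      · simpa using hp.2
      · simpa using hq.2
    exact Prod.ext (Prod.ext_iff.mp h1).1 h3
  have hinj : InjOn F s := fun p hp q hq hpq => hproj p hp q hq (by rw [hpq])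
  have hcont : ContinuousOn F s := by
    rw [UpperHalfPlane.isEmbedding_coe.continuousOn_iff]
    exact fun p hp => (hder p hp).continuousWithinAt
  have hSm : MeasurableSet (F '' s) := hsm.image_of_continuousOn_injOn hcont hinj
  have hvol : volume (F '' s) = ENNReal.ofReal (2 * ℓ * Real.sinh w) := by
    rw [volume_image_eq hsm hder hinj (α := fun _ => 1) (β := fun p => ℓ * Real.cosh p.1)
      (fun _ _ => zero_le_one) (fun p _ => mul_nonneg hℓ.le (Real.cosh_pos _).le)
      (fun p hp v => by rw [hmetric p (hsub hp) v]; ring)]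
    simp only [one_mul]
    rw [lintegral_box (f := fun x => ℓ * Real.cosh x) (by linarith)
      (by fun_prop) (fun x _ => mul_nonneg hℓ.le (Real.cosh_pos _).le),
      intervalIntegral.integral_const_mul, integral_cosh]
    ring_nf
  have hmult : ∀ z, multiplicity Γ (F '' s) z =
      (proj Γ ⁻¹' collar Γ w c).indicator (fun _ => 1) z := by
    intro z
    by_cases hz : z ∈ proj Γ ⁻¹' collar Γ w c
    · rw [indicator_of_mem hz]
      obtain ⟨⟨ρ, θ⟩, hmem, hΦz⟩ := hΦ.surjOn hz
      obtain ⟨t, ht, rfl⟩ : ∃ t ∈ Ico (0 : ℝ) 1, (t : UnitAddCircle) = θ := by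
        have := AddCircle.coe_image_Ico_eq (1 : ℝ) 0
        have hθ : θ ∈ (univ : Set (AddCircle (1 : ℝ))) := mem_univ _
        rw [← this, zero_add] at hθ
        exact hθ
      have hps : ((ρ, t) : ℝ × ℝ) ∈ s := ⟨hmem.1, ht⟩
      have h1 : proj Γ (F (ρ, t)) = proj Γ z := by rw [← hΦF _ (hsub hps)]; exact hΦz
      obtain ⟨γ, hγ, hγz⟩ := proj_eq_iff.mp h1
      refine multiplicity_eq_one hΓ hγ (by rw [hγz]; exact mem_image_of_mem F hps) ?_
      rintro γ' hγ' ⟨q, hq, hqz⟩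
      have h2 : proj Γ (F q) = proj Γ (F (ρ, t)) := by rw [h1, hqz, proj_apply hγ']
      rw [← hqz, hγz, hproj q hq _ hps h2]
    · rw [indicator_of_notMem hz]
      refine multiplicity_eq_zero ?_
      rintro γ hγ ⟨p, hp, hpz⟩
      apply hz
      rw [mem_preimage, ← proj_apply hγ, ← hpz, ← hΦF p (hsub hp)]
      exact hΦ.mapsTo (hΦmem p hp)
  rw [← hvol, volume_eq_lintegral_multiplicity hΓ hSm]
  simp_rw [hmult]
  rw [lintegral_indicator hmeas, setLIntegral_const, Measure.restrict_apply hmeas, one_mul,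
    inter_comm]

/-- A rectangle in Fermi coordinates. -/
def fermiBox (T P : ℝ) : Set (ℝ × ℝ) := Icc (-T) T ×ˢ Ico 0 P

/-- The complex Fermi coordinate with real part `p.2` and imaginary part `p.1`. -/
def toStrip (p : ℝ × ℝ) : ℂ := ⟨p.2, p.1⟩

theorem toStrip_injective : Function.Injective toStrip := fun _ _ hpq =>
  Prod.ext (congrArg Complex.im hpq) (congrArg Complex.re hpq)

theorem measurableSet_fermiBox (T P : ℝ) : MeasurableSet (fermiBox T P) :=
  measurableSet_Icc.prod measurableSet_Ico

theorem abs_im_toStrip_lt {T P : ℝ} (hT : T < Real.pi / 2) {p : ℝ × ℝ} (hp : p ∈ fermiBox T P) :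
    |(toStrip p).im| < Real.pi / 2 :=
  lt_of_le_of_lt (abs_le.mpr hp.1) hT

/-- The linear map underlying `toStrip`. -/
def toStripCLM : ℝ × ℝ →L[ℝ] ℂ :=
  (ContinuousLinearMap.snd ℝ ℝ ℝ).smulRight (1 : ℂ) +
    (ContinuousLinearMap.fst ℝ ℝ ℝ).smulRight Complex.I

theorem toStripCLM_apply (p : ℝ × ℝ) : toStripCLM p = toStrip p := by
  apply Complex.ext <;> simp [toStripCLM, toStrip]

theorem hasFDerivAt_fermi_toStrip (p : ℝ × ℝ) :
    HasFDerivAt (fun p => fermi (toStrip p))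
      ((ContinuousLinearMap.toSpanSingleton ℂ (fermi (toStrip p))).restrictScalars ℝ ∘L
        toStripCLM) p := by
  have h1 : HasFDerivAt toStrip toStripCLM p := by
    have : toStrip = toStripCLM := by ext1 p; rw [toStripCLM_apply]
    rw [this]
    exact toStripCLM.hasFDerivAt
  exact ((hasDerivAt_fermi (toStrip p)).hasFDerivAt.restrictScalars ℝ).comp p h1

/-- The part of the hyperbolic plane that is parametrized by a box. -/
def boxPoint (p : ℝ × ℝ) : ℍ := ofComplex (fermi (toStrip p))

theorem hasFDerivWithinAt_boxPoint {T P : ℝ} (hT : T < Real.pi / 2) {p : ℝ × ℝ}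
    (hp : p ∈ fermiBox T P) :
    HasFDerivWithinAt (fun p => (boxPoint p : ℂ))
      ((ContinuousLinearMap.toSpanSingleton ℂ (fermi (toStrip p))).restrictScalars ℝ ∘L
        toStripCLM) (fermiBox T P) p :=
  (hasFDerivAt_fermi_toStrip p).hasFDerivWithinAt.congr
    (fun _ hq => coe_ofComplex_fermi (abs_im_toStrip_lt hT hq))
    (coe_ofComplex_fermi (abs_im_toStrip_lt hT hp))

theorem boxPoint_injOn {T P : ℝ} (hT : T < Real.pi / 2) : InjOn boxPoint (fermiBox T P) := by
  intro p hp q hq hpq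
  have h1 := abs_im_toStrip_lt hT hp
  have h2 := abs_im_toStrip_lt hT hq
  have h3 := congrArg UpperHalfPlane.coe hpq
  rw [boxPoint, boxPoint, coe_ofComplex_fermi h1, coe_ofComplex_fermi h2] at h3
  exact toStrip_injective (fermi_injOn h1 h2 h3)

theorem boxPoint_metric {T P : ℝ} (hT : T < Real.pi / 2) {p : ℝ × ℝ}
    (hp : p ∈ fermiBox T P) (v : ℝ × ℝ) :
    ‖((ContinuousLinearMap.toSpanSingleton ℂ (fermi (toStrip p))).restrictScalars ℝ ∘L
        toStripCLM) v‖ ^ 2 / (boxPoint p).im ^ 2 =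
      (1 / Real.cos p.1) ^ 2 * v.1 ^ 2 + (1 / Real.cos p.1) ^ 2 * v.2 ^ 2 := by
  have h1 := abs_im_toStrip_lt hT hp
  have hc : 0 < Real.cos p.1 := Real.cos_pos_of_mem_Ioo (abs_lt.mp h1)
  rw [boxPoint, ofComplex_fermi_im h1]
  simp only [ContinuousLinearMap.coe_comp, Function.comp_apply,
    ContinuousLinearMap.coe_restrictScalars', ContinuousLinearMap.toSpanSingleton_apply,
    toStripCLM_apply, smul_eq_mul]
  rw [norm_mul, norm_fermi, mul_pow, ← Complex.normSq_eq_norm_sq, Complex.normSq_apply]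
  simp only [toStrip]
  have := (Real.exp_pos p.2).ne'
  field_simp
  ring

theorem continuousOn_boxPoint {T P : ℝ} (hT : T < Real.pi / 2) :
    ContinuousOn boxPoint (fermiBox T P) := by
  rw [UpperHalfPlane.isEmbedding_coe.continuousOn_iff]
  exact fun p hp => (hasFDerivWithinAt_boxPoint hT hp).continuousWithinAt

variable {A : GL (Fin 2) ℝ}

theorem fermiAt_image_eq (A : GL (Fin 2) ℝ) (s : Set (ℝ × ℝ)) :
    (fun p => fermiAt A (toStrip p)) '' s = (fun z => A • z) '' (boxPoint '' s) := by
  rw [image_image]; rfl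

theorem one_div_cos_nonneg {T P : ℝ} (hT : T < Real.pi / 2) {p : ℝ × ℝ} (hp : p ∈ fermiBox T P) :
    0 ≤ 1 / Real.cos p.1 :=
  one_div_nonneg.mpr (Real.cos_pos_of_mem_Ioo (abs_lt.mp (abs_im_toStrip_lt hT hp))).le

theorem cos_pos_of_mem_Icc {T x : ℝ} (hT : T < Real.pi / 2) (hx : x ∈ Icc (-T) T) :
    0 < Real.cos x :=
  Real.cos_pos_of_mem_Ioo ⟨by linarith [hx.1], by linarith [hx.2]⟩

theorem integral_one_div_cos_sq {T : ℝ} (hT0 : 0 ≤ T) (hT : T < Real.pi / 2) :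
    ∫ x in -T..T, 1 / Real.cos x ^ 2 = 2 * Real.tan T := by
  have hc : ∀ x ∈ uIcc (-T) T, Real.cos x ≠ 0 := fun x hx => by
    rw [uIcc_of_le (by linarith)] at hx
    exact (cos_pos_of_mem_Icc hT hx).ne'
  rw [intervalIntegral.integral_eq_sub_of_hasDerivAt (fun x hx => Real.hasDerivAt_tan (hc x hx)),
    Real.tan_neg]
  · ring
  · exact (ContinuousOn.div continuousOn_const (by fun_prop)
      fun x hx => pow_ne_zero 2 (hc x hx)).intervalIntegrable

theorem volume_fermiAt_image {T P : ℝ} (hT0 : 0 ≤ T) (hT : T < Real.pi / 2) :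
    volume ((fun p => fermiAt A (toStrip p)) '' fermiBox T P) =
      ENNReal.ofReal (2 * P * Real.tan T) := by
  rw [fermiAt_image_eq, image_smul, measure_smul, volume_image_eq (measurableSet_fermiBox T P)
    (fun p hp => hasFDerivWithinAt_boxPoint hT hp) (boxPoint_injOn hT)
    (fun p hp => one_div_cos_nonneg hT hp) (fun p hp => one_div_cos_nonneg hT hp)
    (fun p hp v => boxPoint_metric hT hp v)]
  have e : ∀ p : ℝ × ℝ, 1 / Real.cos p.1 * (1 / Real.cos p.1) = 1 / Real.cos p.1 ^ 2 :=
    fun p => by rw [← one_div_pow, sq]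
  simp_rw [e]
  rw [fermiBox, lintegral_box (f := fun x => 1 / Real.cos x ^ 2) (by linarith)
    (ContinuousOn.div continuousOn_const (by fun_prop)
      fun x hx => pow_ne_zero 2 (cos_pos_of_mem_Icc hT hx).ne')
    (fun x _ => by positivity), integral_one_div_cos_sq hT0 hT]
  ring_nf

theorem setIntegral_fermiAt_image {T P : ℝ} (hT : T < Real.pi / 2) {u : ℍ → ℝ} (hu : Measurable u) :
    ∫ z in (fun p => fermiAt A (toStrip p)) '' fermiBox T P, u z =
      ∫ p in fermiBox T P, (1 / Real.cos p.1 ^ 2) * u (fermiAt A (toStrip p)) := by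
  have hmeas : Measurable fun z : ℍ => A • z := measurable_const_smul A
  rw [fermiAt_image_eq, (measurePreserving_smul A (volume : Measure ℍ)).setIntegral_image_emb
      (measurableEmbedding_const_smul A), setIntegral_image_eq (measurableSet_fermiBox T P)
    (fun p hp => hasFDerivWithinAt_boxPoint hT hp) (boxPoint_injOn hT)
    (fun p hp => one_div_cos_nonneg hT hp) (fun p hp => one_div_cos_nonneg hT hp)
    (Measurable.aemeasurable (by fun_prop))
    (fun p hp v => boxPoint_metric hT hp v) (u := fun z => u (A • z)) (hu.comp hmeas)]
  refine setIntegral_congr_fun (measurableSet_fermiBox T P) fun p hp => ?_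
  rw [← one_div_pow, sq]
  rfl

theorem measurableSet_fermiAt_image {T P : ℝ} (hT : T < Real.pi / 2) :
    MeasurableSet ((fun p => fermiAt A (toStrip p)) '' fermiBox T P) := by
  rw [fermiAt_image_eq, (measurableEmbedding_const_smul A).measurableSet_image]
  exact (measurableSet_fermiBox T P).image_of_continuousOn_injOn (continuousOn_boxPoint hT)
    (boxPoint_injOn hT)

theorem volume_pos_of_isOpen {O : Set ℍ} (hO : IsOpen O) (hne : O.Nonempty) : volume O ≠ 0 := by
  intro h0
  have hO' : IsOpen (UpperHalfPlane.coe '' O) := isOpenEmbedding_coe.isOpenMap O hO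
  rw [volume_eq_lintegral, lintegral_eq_zero_iff (by fun_prop)] at h0
  refine (hO'.measure_pos volume (hne.image _)).ne' ?_
  have h1 := (ae_restrict_iff' hO'.measurableSet).mp h0
  rw [ae_iff] at h1
  refine measure_mono_null ?_ h1
  rintro _ ⟨z, hz, rfl⟩ hcon
  have := hcon ⟨z, hz, rfl⟩
  simp at this
  exact z.im_ne_zero this

end

/-! ### The double covering of a standard collar by two periods -/

section

variable {Γ : Subgroup (Equiv.Perm ℍ)} {ℓ : ℝ} {c : ℝ → Surface Γ} {A : GL (Fin 2) ℝ}
  {h : Equiv.Perm ℍ}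

/-- The Gudermannian function. -/
def gd (w : ℝ) : ℝ := Real.arctan (Real.sinh w)

theorem gd_lt (w : ℝ) : gd w < Real.pi / 2 := Real.arctan_lt_pi_div_two _

theorem tan_gd (w : ℝ) : Real.tan (gd w) = Real.sinh w := Real.tan_arctan _

theorem gd_strictMono : StrictMono gd := Real.arctan_strictMono.comp Real.sinh_strictMono

theorem gd_zero : gd 0 = 0 := by simp [gd]

theorem gd_pos {w : ℝ} (hw : 0 < w) : 0 < gd w := gd_zero ▸ gd_strictMono hw

theorem tan_sq_le_tan_sq {τ t : ℝ} (ht : 0 ≤ t) (ht' : t < Real.pi / 2) (hτ : |τ| < Real.pi / 2) :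
    Real.tan τ ^ 2 ≤ Real.tan t ^ 2 ↔ |τ| ≤ t := by
  have h1 : |Real.tan τ| = Real.tan |τ| := by
    rcases abs_cases τ with ⟨h1, h2⟩ | ⟨h1, h2⟩
    · rw [h1, abs_of_nonneg (Real.tan_nonneg_of_nonneg_of_le_pi_div_two h2 (h1 ▸ hτ.le))]
    · rw [h1, Real.tan_neg, abs_of_nonpos (Real.tan_nonpos_of_nonpos_of_neg_pi_div_two_le h2.le
        (by linarith))]
  have h2 : 0 ≤ Real.tan t := Real.tan_nonneg_of_nonneg_of_le_pi_div_two ht ht'.le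
  have hm : ∀ x : ℝ, 0 ≤ x → x < Real.pi / 2 → x ∈ Ioo (-(Real.pi / 2)) (Real.pi / 2) :=
    fun x hx hx' => ⟨by linarith [Real.pi_pos], hx'⟩
  rw [sq_le_sq, abs_of_nonneg h2, h1]
  exact Real.strictMonoOn_tan.le_iff_le (hm _ (abs_nonneg _) hτ) (hm _ ht ht')

/-- Two periods of the lift of a collar to the hyperbolic plane. -/
def doubleBox (A : GL (Fin 2) ℝ) (ℓ w : ℝ) : Set ℍ :=
  (fun p => fermiAt A (toStrip p)) '' fermiBox (gd w) (2 * ℓ)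

theorem Frame.exists_zpow_mem_doubleBox (hf : Frame Γ ℓ c A h) (hΓ : IsClosedSurfaceGroup Γ) {w : ℝ}
    (hw : 0 ≤ w) {z : ℍ} (hz : defect A z ≤ Real.sinh w ^ 2) :
    ∃ n : ℤ, ((h * h) ^ n) z ∈ doubleBox A ℓ w := by
  obtain ⟨ζ, hζ, rfl⟩ := exists_fermiAt_eq A z
  rw [defect_fermiAt A hζ, ← tan_gd,
    tan_sq_le_tan_sq (gd_zero ▸ gd_strictMono.monotone hw) (gd_lt w) hζ] at hz
  have hℓ := hf.length_pos
  obtain ⟨n, hn, -⟩ := existsUnique_add_zsmul_mem_Ico (show (0 : ℝ) < 2 * ℓ by linarith) ζ.re 0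
  simp only [zsmul_eq_mul, zero_add] at hn
  refine ⟨n, (ζ.im, ζ.re + n * (2 * ℓ)), ⟨abs_le.mp hz, hn⟩, ?_⟩
  dsimp only
  rw [hf.zpow_fermiAt hΓ n hζ]
  congr 1
  apply Complex.ext <;> simp [toStrip]

theorem Frame.zpow_injective (hf : Frame Γ ℓ c A h) {m n : ℤ} (hmn : h ^ m = h ^ n) : m = n := by
  have key : ∀ n : ℤ, (h ^ n) (A • axis 0) = A • axis (n * ℓ) := by
    intro n
    induction n with
    | zero => simp
    | succ n ih =>
      rw [zpow_add_one, ← (Commute.self_zpow h n).eq, Equiv.Perm.mul_apply, ih, hf.translates]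
      congr 2
      push_cast
      ring
    | pred n ih =>
      rw [zpow_sub_one, ← ((Commute.refl h).inv_left.zpow_right _).eq, Equiv.Perm.mul_apply, ih,
        Equiv.Perm.inv_eq_iff_eq, hf.translates]
      congr 2
      push_cast
      ring
  have h1 := key m
  rw [hmn, key n] at h1
  have h2 := isometry_axis.injective (MulAction.injective A h1)
  have h3 := mul_right_cancel₀ hf.length_pos.ne' h2
  exact_mod_cast h3.symm

/-- A lift in the strip and its image under `h` can both be brought into the box by powers of `h²`.
The resulting elements of `Γ` differ by an odd power of `h`, hence are distinct. -/
theorem Frame.two_le_multiplicity (hf : Frame Γ ℓ c A h) (hΓ : IsClosedSurfaceGroup Γ) {w : ℝ}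
    (hw : 0 ≤ w) {z : ℍ} (hz : proj Γ z ∈ collar Γ w c) :
    2 ≤ multiplicity Γ (doubleBox A ℓ w) z := by
  classical
  obtain ⟨γ, hγ, hγz⟩ := hf.exists_defect_le hΓ hz
  obtain ⟨m, hm⟩ := hf.exists_zpow_mem_doubleBox hΓ hw hγz
  obtain ⟨n, hn⟩ := hf.exists_zpow_mem_doubleBox hΓ hw
    (show defect A (h (γ z)) ≤ _ by rw [hf.defect_apply hΓ]; exact hγz)
  let a : Γ := ⟨(h * h) ^ m * γ, Γ.mul_mem (hf.zpow_mem m) hγ⟩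
  let b : Γ := ⟨(h * h) ^ n * (h * γ), Γ.mul_mem (hf.zpow_mem n) (Γ.mul_mem hf.mem hγ)⟩
  have hab : a ≠ b := by
    intro hab
    have h1 : (h * h) ^ m * γ = (h * h) ^ n * (h * γ) := congrArg Subtype.val hab
    rw [← mul_assoc, mul_left_inj] at h1
    have e : ∀ k : ℤ, (h * h) ^ k = h ^ (2 * k) := fun k => by rw [zpow_mul, zpow_two]
    rw [e, e, ← zpow_add_one] at h1
    have := hf.zpow_injective h1
    omega
  have := card_le_multiplicity (doubleBox A ℓ w) z {a, b} (by
    intro γ' hγ'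
    rcases Finset.mem_insert.mp hγ' with rfl | hγ'
    · exact hm
    · rw [Finset.mem_singleton.mp hγ']; exact hn)
  rw [Finset.card_pair hab] at this
  exact_mod_cast this

theorem measurableSet_doubleBox (A : GL (Fin 2) ℝ) (ℓ w : ℝ) : MeasurableSet (doubleBox A ℓ w) :=
  measurableSet_fermiAt_image (gd_lt w)

/-- A standard collar is covered exactly twice, up to a null set, by two of its periods. -/
theorem Frame.ae_multiplicity_eq_two (hf : Frame Γ ℓ c A h) (hΓ : IsClosedSurfaceGroup Γ) {w : ℝ}
    (hw : 0 < w) (hstd : IsStandardCollar Γ w ℓ c) :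
    ∀ᵐ z : ℍ, multiplicity Γ (doubleBox A ℓ w) z =
      (proj Γ ⁻¹' collar Γ w c).indicator (fun _ => ((2 : ℕ) : ℝ≥0∞)) z := by
  have hmeas := hf.measurableSet_preimage_collar hΓ hw.le
  refine ae_multiplicity_eq hΓ (measurableSet_doubleBox A ℓ w) hmeas 2
    (fun z hz => by exact_mod_cast hf.two_le_multiplicity hΓ hw.le hz) ?_
  -- Since `tan (gd w) = sinh w`, the box has area `4 ℓ sinh w`, exactly twice that of the collar,
  -- so there is no room for further overlap.
  rw [hstd.volume_eq hΓ hw hf.length_pos hmeas, doubleBox,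
    volume_fermiAt_image (gd_pos hw).le (gd_lt w), tan_gd,
    show 2 * (2 * ℓ) * Real.sinh w = 2 * (2 * ℓ * Real.sinh w) by ring,
    ENNReal.ofReal_mul (by norm_num)]
  simp

theorem Frame.setIntegral_collar (hf : Frame Γ ℓ c A h) (hΓ : IsClosedSurfaceGroup Γ) {w : ℝ}
    (hw : 0 < w) (hstd : IsStandardCollar Γ w ℓ c) {u : Surface Γ → ℝ}
    (hu : Measurable fun z => u (proj Γ z)) :
    ∫ z in dirichletDomain Γ ∩ proj Γ ⁻¹' collar Γ w c, u (proj Γ z) =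
      (1 / 2) * ∫ p in fermiBox (gd w) (2 * ℓ),
        (1 / Real.cos p.1 ^ 2) * u (proj Γ (fermiAt A (toStrip p))) := by
  have hmeas := hf.measurableSet_preimage_collar hΓ hw.le
  have hum : Measurable u := measurable_from_quotient.mpr hu
  have hmap := map_proj_restrict hΓ (measurableSet_doubleBox A ℓ w) hmeas 2
    (hf.ae_multiplicity_eq_two hΓ hw hstd)
  have h1 := congrArg (fun μ => ∫ x, u x ∂μ) hmap
  simp only [integral_smul_measure] at h1
  rw [integral_map measurable_proj.aemeasurable hum.aestronglyMeasurable,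
    integral_map measurable_proj.aemeasurable hum.aestronglyMeasurable, doubleBox,
    setIntegral_fermiAt_image (gd_lt w) hu] at h1
  rw [h1]
  simp

/-- Distinct lifts of a standard collar have disjoint interiors. -/
theorem Frame.defect_apply_eq (hf : Frame Γ ℓ c A h) (hΓ : IsClosedSurfaceGroup Γ) {w : ℝ}
    (hw : 0 < w) (hstd : IsStandardCollar Γ w ℓ c) {γ : Equiv.Perm ℍ} (hγ : γ ∈ Γ) {z : ℍ}
    (hz : defect A z < Real.sinh w ^ 2) (hγz : defect A (γ z) < Real.sinh w ^ 2) (z' : ℍ) :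
    defect A (γ z') = defect A z' := by
  classical
  suffices hpow : ∃ n : ℤ, γ = h ^ n by
    obtain ⟨n, rfl⟩ := hpow
    exact hf.defect_zpow hΓ n z'
  by_contra! hcon
  -- If `γ` is not a power of `h`, then every point of this nonempty open set is sent into the box
  -- by three distinct elements `a`, `b`, `d`, while the multiplicity is two almost everywhere.
  set O := {z | defect A z < Real.sinh w ^ 2} ∩ {z | defect A (γ z) < Real.sinh w ^ 2}
  have hO : IsOpen O := (isOpen_lt (continuous_defect A) continuous_const).inter
    (isOpen_lt ((continuous_defect A).comp (continuous_apply hΓ hγ)) continuous_const)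
  refine volume_pos_of_isOpen hO ⟨z, hz, hγz⟩ ?_
  refine measure_mono_null ?_ (ae_iff.mp (hf.ae_multiplicity_eq_two hΓ hw hstd))
  rintro y ⟨hy1, hy2⟩ hy
  have hy1' : defect A y ≤ Real.sinh w ^ 2 := le_of_lt hy1
  have hy2' : defect A (γ y) ≤ Real.sinh w ^ 2 := le_of_lt hy2
  have hmem : y ∈ proj Γ ⁻¹' collar Γ w c := hf.mem_collar_of_defect_le hw.le hy1'
  rw [indicator_of_mem hmem] at hy
  obtain ⟨m, hm⟩ := hf.exists_zpow_mem_doubleBox hΓ hw.le hy1'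
  obtain ⟨n, hn⟩ := hf.exists_zpow_mem_doubleBox hΓ hw.le
    (show defect A (h y) ≤ _ by rw [hf.defect_apply hΓ]; exact hy1')
  obtain ⟨k, hk⟩ := hf.exists_zpow_mem_doubleBox hΓ hw.le hy2'
  let a : Γ := ⟨(h * h) ^ m, hf.zpow_mem m⟩
  let b : Γ := ⟨(h * h) ^ n * h, Γ.mul_mem (hf.zpow_mem n) hf.mem⟩
  let d : Γ := ⟨(h * h) ^ k * γ, Γ.mul_mem (hf.zpow_mem k) hγ⟩
  have e : ∀ k : ℤ, (h * h) ^ k = h ^ (2 * k) := fun k => by rw [zpow_mul, zpow_two]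
  have hab : a ≠ b := by
    intro hab
    have h1 : (h * h) ^ m = (h * h) ^ n * h := congrArg Subtype.val hab
    rw [e, e, ← zpow_add_one] at h1
    have := hf.zpow_injective h1
    omega
  have had : a ≠ d := by
    intro had
    have h1 : (h * h) ^ m = (h * h) ^ k * γ := congrArg Subtype.val had
    refine hcon (-(2 * k) + 2 * m) ?_
    rw [zpow_add, ← e m, h1, e, ← mul_assoc, ← zpow_add]
    simp
  have hbd : b ≠ d := by
    intro hbd
    have h1 : (h * h) ^ n * h = (h * h) ^ k * γ := congrArg Subtype.val hbd
    refine hcon (-(2 * k) + (2 * n + 1)) ?_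
    rw [zpow_add, zpow_add_one, ← e n, h1, e, ← mul_assoc, ← zpow_add]
    simp
  have := card_le_multiplicity (doubleBox A ℓ w) y {a, b, d} (by
    intro γ' hγ'
    rcases Finset.mem_insert.mp hγ' with rfl | hγ'
    · exact hm
    · rcases Finset.mem_insert.mp hγ' with rfl | hγ'
      · exact hn
      · rw [Finset.mem_singleton.mp hγ']; exact hk)
  rw [hy, Finset.card_eq_three.mpr ⟨a, b, d, hab, had, hbd, rfl⟩] at this
  norm_num at this

end

/-! ### Eigenfunctions on a cylinder -/

/-- The domain of Fermi coordinates. -/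
def coordDomain : Set (ℝ × ℝ) := {p | |p.1| < Real.pi / 2}

theorem fermiBox_subset_coordDomain {T P : ℝ} (hT : T < Real.pi / 2) :
    fermiBox T P ⊆ coordDomain := fun _ hp => abs_im_toStrip_lt hT hp

theorem integrableOn_fermiBox {T P : ℝ} (hT : T < Real.pi / 2) {f : ℝ × ℝ → ℝ}
    (hf : ContinuousOn f coordDomain) : IntegrableOn f (fermiBox T P) := by
  have h1 : IsCompact (Icc (-T) T ×ˢ Icc 0 P) := isCompact_Icc.prod isCompact_Icc
  have h2 : ContinuousOn f (Icc (-T) T ×ˢ Icc 0 P) :=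
    hf.mono fun p hp => lt_of_le_of_lt (abs_le.mpr hp.1) hT
  exact (h2.integrableOn_compact h1).mono_set (prod_mono subset_rfl Ico_subset_Icc_self)

theorem mk_mem_coordDomain {T x : ℝ} (hT : T < Real.pi / 2) (hx : x ∈ Icc (-T) T) (s : ℝ) :
    (x, s) ∈ coordDomain := lt_of_le_of_lt (abs_le.mpr hx) hT

/-- The divergence theorem on a cylinder. -/
theorem integral_divergence_eq_zero {T P : ℝ} (hT0 : 0 ≤ T) (hT : T < Real.pi / 2) (hP : 0 ≤ P)
    {X Y X' Y' : ℝ × ℝ → ℝ}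
    (hX : ∀ x s, (x, s) ∈ coordDomain → HasDerivAt (fun x => X (x, s)) (X' (x, s)) x)
    (hY : ∀ x s, (x, s) ∈ coordDomain → HasDerivAt (fun s => Y (x, s)) (Y' (x, s)) s)
    (hX' : ContinuousOn X' coordDomain) (hY' : ContinuousOn Y' coordDomain)
    (hXT : ∀ s, X (T, s) = X (-T, s)) (hYP : ∀ x, (x, 0) ∈ coordDomain → Y (x, P) = Y (x, 0)) :
    ∫ p in fermiBox T P, (X' p + Y' p) = 0 := by
  have iX := integrableOn_fermiBox (P := P) hT hX'
  have iY := integrableOn_fermiBox (P := P) hT hY'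
  have hmem := fun x (hx : x ∈ Icc (-T) T) s => mk_mem_coordDomain hT hx s
  rw [integral_add iX iY]
  have e : (volume : Measure (ℝ × ℝ)).restrict (fermiBox T P) =
      (volume.restrict (Icc (-T) T)).prod (volume.restrict (Ico 0 P)) := by
    rw [fermiBox, Measure.prod_restrict, Measure.volume_eq_prod]
  have h1 : ∫ p in fermiBox T P, X' p = 0 := by
    rw [IntegrableOn, e] at iX
    rw [e, integral_prod_symm _ iX]
    refine integral_eq_zero_of_ae (Eventually.of_forall fun s => ?_)
    dsimp only
    rw [integral_Icc_eq_integral_Ioc, ← intervalIntegral.integral_of_le (by linarith),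
      intervalIntegral.integral_eq_sub_of_hasDerivAt (f := fun x => X (x, s)), hXT, sub_self]
    · rfl
    · intro x hx
      rw [uIcc_of_le (by linarith)] at hx
      exact hX x s (hmem x hx s)
    · refine ContinuousOn.intervalIntegrable ?_
      rw [uIcc_of_le (by linarith)]
      exact hX'.comp (by fun_prop) fun x hx => hmem x hx s
  have h2 : ∫ p in fermiBox T P, Y' p = 0 := by
    rw [IntegrableOn, e] at iY
    rw [e, integral_prod _ iY]
    refine setIntegral_eq_zero_of_forall_eq_zero fun x hx => ?_
    rw [integral_Ico_eq_integral_Ioc, ← intervalIntegral.integral_of_le hP,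
      intervalIntegral.integral_eq_sub_of_hasDerivAt (f := fun s => Y (x, s)),
      hYP x (hmem x hx 0), sub_self]
    · intro s _
      exact hY x s (hmem x hx s)
    · refine ContinuousOn.intervalIntegrable ?_
      exact hY'.comp (by fun_prop) fun s _ => hmem x hx s
  rw [h1, h2, add_zero]

/-- A function on a cylinder that satisfies the equation `Δ v = μ v` in Fermi coordinates,
with its partial derivatives. -/
structure StripSolution (μ P : ℝ) (v vt vs vtt vst vss : ℝ × ℝ → ℝ) : Prop where
  cont : ContinuousOn v coordDomain
  cont_t : ContinuousOn vt coordDomain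
  cont_s : ContinuousOn vs coordDomain
  cont_tt : ContinuousOn vtt coordDomain
  cont_st : ContinuousOn vst coordDomain
  cont_ss : ContinuousOn vss coordDomain
  deriv_t : ∀ x s, (x, s) ∈ coordDomain → HasDerivAt (fun x => v (x, s)) (vt (x, s)) x
  deriv_s : ∀ x s, (x, s) ∈ coordDomain → HasDerivAt (fun s => v (x, s)) (vs (x, s)) s
  deriv_tt : ∀ x s, (x, s) ∈ coordDomain → HasDerivAt (fun x => vt (x, s)) (vtt (x, s)) x
  deriv_ts : ∀ x s, (x, s) ∈ coordDomain → HasDerivAt (fun s => vt (x, s)) (vst (x, s)) s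
  deriv_st : ∀ x s, (x, s) ∈ coordDomain → HasDerivAt (fun x => vs (x, s)) (vst (x, s)) x
  deriv_ss : ∀ x s, (x, s) ∈ coordDomain → HasDerivAt (fun s => vs (x, s)) (vss (x, s)) s
  equation : ∀ p ∈ coordDomain, vtt p + vss p = -(μ * v p / Real.cos p.1 ^ 2)
  periodic : ∀ x, (x, 0) ∈ coordDomain → v (x, P) = v (x, 0)
  periodic_t : ∀ x, (x, 0) ∈ coordDomain → vt (x, P) = vt (x, 0)
  periodic_s : ∀ x, (x, 0) ∈ coordDomain → vs (x, P) = vs (x, 0)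

theorem hasDerivAt_toStrip_fst {G : ℂ → ℝ} {G' : ℂ →L[ℝ] ℝ} {x s : ℝ}
    (hG : HasFDerivAt G G' (toStrip (x, s))) :
    HasDerivAt (fun x => G (toStrip (x, s))) (G' Complex.I) x := by
  have h1 : HasDerivAt (fun x => toStrip (x, s)) Complex.I x := by
    have e : (fun x : ℝ => toStrip (x, s)) = fun x : ℝ => (s : ℂ) + x * Complex.I := by
      ext x; apply Complex.ext <;> simp [toStrip]
    rw [e]
    simpa using ((Complex.ofRealCLM.hasDerivAt (x := x)).mul_const Complex.I).const_add (s : ℂ)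
  exact hG.comp_hasDerivAt x h1

theorem hasDerivAt_toStrip_snd {G : ℂ → ℝ} {G' : ℂ →L[ℝ] ℝ} {x s : ℝ}
    (hG : HasFDerivAt G G' (toStrip (x, s))) :
    HasDerivAt (fun s => G (toStrip (x, s))) (G' 1) s := by
  have h1 : HasDerivAt (fun s => toStrip (x, s)) 1 s := by
    have e : (fun s : ℝ => toStrip (x, s)) = fun s : ℝ => (s : ℂ) + x * Complex.I := by
      ext x; apply Complex.ext <;> simp [toStrip]
    rw [e]
    simpa using (Complex.ofRealCLM.hasDerivAt (x := s)).add_const ((x : ℂ) * Complex.I)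
  exact hG.comp_hasDerivAt s h1

theorem exists_stripSolution {μ P : ℝ} {v : ℂ → ℝ}
    (hv : ContDiffOn ℝ ∞ v {ζ : ℂ | |ζ.im| < Real.pi / 2})
    (hP : ∀ ζ : ℂ, |ζ.im| < Real.pi / 2 → v (ζ + P) = v ζ)
    (hΔ : ∀ ζ : ℂ, |ζ.im| < Real.pi / 2 →
      Laplacian.laplacian v ζ = -(μ * v ζ / Real.cos ζ.im ^ 2)) :
    ∃ vt vs vtt vst vss, StripSolution μ P (fun p => v (toStrip p)) vt vs vtt vst vss := by
  set S : Set ℂ := {ζ : ℂ | |ζ.im| < Real.pi / 2} with hS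
  have hSo : IsOpen S := isOpen_lt (by fun_prop) continuous_const
  have hd : ContDiffOn ℝ ∞ (fderiv ℝ v) S := hv.fderiv_of_isOpen hSo le_rfl
  have hdd : ContDiffOn ℝ ∞ (fderiv ℝ (fderiv ℝ v)) S := hd.fderiv_of_isOpen hSo le_rfl
  have hts : Continuous toStrip := by
    have : toStrip = toStripCLM := by ext1 p; rw [toStripCLM_apply]
    rw [this]; exact toStripCLM.continuous
  have hmaps : MapsTo toStrip coordDomain S := fun p hp => hp
  have c0 : ContinuousOn (fun p => v (toStrip p)) coordDomain :=
    hv.continuousOn.comp hts.continuousOn hmaps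
  have c1 : ∀ a : ℂ, ContinuousOn (fun p => fderiv ℝ v (toStrip p) a) coordDomain := fun a =>
    (hd.continuousOn.comp hts.continuousOn hmaps).clm_apply continuousOn_const
  have c2 : ∀ a b : ℂ, ContinuousOn (fun p => fderiv ℝ (fderiv ℝ v) (toStrip p) a b) coordDomain :=
    fun a b => ((hdd.continuousOn.comp hts.continuousOn hmaps).clm_apply continuousOn_const).clm_apply
      continuousOn_const
  have d1 : ∀ p ∈ coordDomain, HasFDerivAt v (fderiv ℝ v (toStrip p)) (toStrip p) := fun p hp =>
    ((hv.differentiableOn (by simp)).differentiableAt (hSo.mem_nhds (hmaps hp))).hasFDerivAt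
  have d2 : ∀ p ∈ coordDomain, ∀ a, HasFDerivAt (fun ζ => fderiv ℝ v ζ a)
      ((fderiv ℝ (fderiv ℝ v) (toStrip p)).flip a) (toStrip p) := fun p hp a => by
    have := ((hd.differentiableOn (by simp)).differentiableAt
      (hSo.mem_nhds (hmaps hp))).hasFDerivAt.clm_apply (hasFDerivAt_const a (toStrip p))
    simpa using this
  have hper : ∀ ζ ∈ S, fderiv ℝ v (ζ + P) = fderiv ℝ v ζ := by
    intro ζ hζ
    rw [← fderiv_comp_add_right]
    refine Filter.EventuallyEq.fderiv_eq ?_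
    filter_upwards [hSo.mem_nhds hζ] with η hη using hP η hη
  have hsP : ∀ x, toStrip (x, P) = toStrip (x, 0) + P := fun x => by
    apply Complex.ext <;> simp [toStrip]
  refine ⟨fun p => fderiv ℝ v (toStrip p) Complex.I, fun p => fderiv ℝ v (toStrip p) 1,
    fun p => fderiv ℝ (fderiv ℝ v) (toStrip p) Complex.I Complex.I,
    fun p => fderiv ℝ (fderiv ℝ v) (toStrip p) Complex.I 1,
    fun p => fderiv ℝ (fderiv ℝ v) (toStrip p) 1 1, ?_⟩
  exact
  { cont := c0
    cont_t := c1 _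
    cont_s := c1 _
    cont_tt := c2 _ _
    cont_st := c2 _ _
    cont_ss := c2 _ _
    deriv_t := fun x s hp => hasDerivAt_toStrip_fst (d1 _ hp)
    deriv_s := fun x s hp => hasDerivAt_toStrip_snd (d1 _ hp)
    deriv_tt := fun x s hp => hasDerivAt_toStrip_fst (d2 _ hp _)
    deriv_ts := fun x s hp => by
      have h1 := hasDerivAt_toStrip_snd (d2 _ hp Complex.I)
      have h2 : IsSymmSndFDerivAt ℝ v (toStrip (x, s)) :=
        (hv.contDiffAt (hSo.mem_nhds (hmaps hp))).isSymmSndFDerivAt (by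
          rw [minSmoothness_of_isRCLikeNormedField]
          exact WithTop.coe_le_coe.mpr (le_top : (2 : ℕ∞) ≤ ⊤))
      convert! h1 using 1
      exact h2 _ _
    deriv_st := fun x s hp => hasDerivAt_toStrip_fst (d2 _ hp _)
    deriv_ss := fun x s hp => hasDerivAt_toStrip_snd (d2 _ hp _)
    equation := fun p hp => by
      have := hΔ (toStrip p) hp
      rw [laplacian_eq_fderiv_fderiv] at this
      rw [add_comm]
      exact this
    periodic := fun x hx => by
      rw [hsP]; exact hP _ hx
    periodic_t := fun x hx => by
      rw [hsP, hper _ hx]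
    periodic_s := fun x hx => by
      rw [hsP, hper _ hx] }

/-! ### Integral identities for solutions on a cylinder -/

section Identities

variable {μ P T : ℝ} {v vt vs vtt vst vss : ℝ × ℝ → ℝ}

theorem cos_pos_of_mem_coordDomain {p : ℝ × ℝ} (hp : p ∈ coordDomain) : 0 < Real.cos p.1 :=
  Real.cos_pos_of_mem_Ioo (abs_lt.mp hp)

/-- The virial identity. -/
theorem StripSolution.virial (hv : StripSolution μ P v vt vs vtt vst vss) (hT0 : 0 ≤ T)
    (hT : T < Real.pi / 2) (hP : 0 ≤ P) {a a' a'' a''' : ℝ → ℝ} (h1 : ∀ x, HasDerivAt a (a' x) x)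
    (h2 : ∀ x, HasDerivAt a' (a'' x) x) (h3 : ∀ x, HasDerivAt a'' (a''' x) x)
    (hc : Continuous a''') (hT1 : a T = 0 ∧ a (-T) = 0) (hT2 : a' T = 0 ∧ a' (-T) = 0)
    (hT3 : a'' T = 0 ∧ a'' (-T) = 0) :
    ∫ p in fermiBox T P, (2 * a' p.1 * vt p ^ 2 +
      a p.1 * μ * (2 * Real.sin p.1 / Real.cos p.1 ^ 3) * v p ^ 2 - a''' p.1 * v p ^ 2 / 2) = 0 := by
  have ca : Continuous a := continuous_iff_continuousAt.mpr fun x => (h1 x).continuousAt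
  have ca' : Continuous a' := continuous_iff_continuousAt.mpr fun x => (h2 x).continuousAt
  have ca'' : Continuous a'' := continuous_iff_continuousAt.mpr fun x => (h3 x).continuousAt
  have c0 := hv.cont
  have c1 := hv.cont_t
  have c2 := hv.cont_s
  have c3 := hv.cont_tt
  have c4 := hv.cont_st
  have c5 := hv.cont_ss
  have hcos : ∀ p ∈ coordDomain, Real.cos p.1 ^ 2 ≠ 0 :=
    fun p hp => pow_ne_zero 2 (cos_pos_of_mem_coordDomain hp).ne'
  have hcos3 : ∀ p ∈ coordDomain, Real.cos p.1 ^ 3 ≠ 0 :=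
    fun p hp => pow_ne_zero 3 (cos_pos_of_mem_coordDomain hp).ne'
  -- The field arises from multiplying the equation by `2 a v_t + a' v`: the first summand gives the
  -- flux of the stress tensor along `a ∂_t`, the second removes `v_s²` and the undifferentiated
  -- factor `1 / cos²`.
  have key := integral_divergence_eq_zero hT0 hT hP
    (X := fun p => a p.1 * (vt p ^ 2 - vs p ^ 2 + μ * (v p ^ 2 / Real.cos p.1 ^ 2)) +
      a' p.1 * (v p * vt p) - a'' p.1 * v p ^ 2 / 2)
    (Y := fun p => 2 * a p.1 * (vs p * vt p) + a' p.1 * (v p * vs p))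
    (X' := fun p => a' p.1 * (vt p ^ 2 - vs p ^ 2 + μ * (v p ^ 2 / Real.cos p.1 ^ 2)) +
      a p.1 * (2 * vt p * vtt p - 2 * vs p * vst p +
        μ * (2 * v p * vt p / Real.cos p.1 ^ 2 + v p ^ 2 * (2 * Real.sin p.1 / Real.cos p.1 ^ 3))) +
      (a'' p.1 * (v p * vt p) + a' p.1 * (vt p * vt p + v p * vtt p)) -
      (a''' p.1 * v p ^ 2 + a'' p.1 * (2 * v p * vt p)) / 2)
    (Y' := fun p => 2 * a p.1 * (vss p * vt p + vs p * vst p) +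
      a' p.1 * (vs p * vs p + v p * vss p))
    ?_ ?_ ?_ ?_ ?_ ?_
  · rw [← key]
    refine setIntegral_congr_fun (measurableSet_fermiBox T P) fun p hp => ?_
    have hpd := fermiBox_subset_coordDomain hT hp
    have heq := hv.equation p hpd
    have hc := (cos_pos_of_mem_coordDomain hpd).ne'
    have e : vtt p = -(μ * v p / Real.cos p.1 ^ 2) - vss p := by linarith
    simp only [e]
    field_simp
    ring
  · intro x s hp
    have hcx := (cos_pos_of_mem_coordDomain hp).ne'
    have g0 := hv.deriv_t x s hp
    have gt := hv.deriv_tt x s hp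
    have gs := hv.deriv_st x s hp
    have gL := ((g0.pow 2).div ((Real.hasDerivAt_cos x).pow 2) (pow_ne_zero 2 hcx)).const_mul μ
    have := (((h1 x).mul (((gt.pow 2).sub (gs.pow 2)).add gL)).add
      ((h2 x).mul (g0.mul gt))).sub (((h3 x).mul (g0.pow 2)).div_const 2)
    convert! this using 1
    simp only [Pi.pow_apply, Pi.sub_apply, Pi.add_apply, Pi.mul_apply, Pi.div_apply]
    dsimp only at hcx
    field_simp
    ring
  · intro x s hp
    have g0 := hv.deriv_s x s hp
    have gt := hv.deriv_ts x s hp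
    have gs := hv.deriv_ss x s hp
    exact ((gs.mul gt).const_mul (2 * a x)).add ((g0.mul gs).const_mul (a' x))
  · fun_prop (disch := assumption)
  · fun_prop
  · intro s
    simp [hT1.1, hT1.2, hT2.1, hT2.2, hT3.1, hT3.2]
  · intro x hx
    simp only [hv.periodic x hx, hv.periodic_t x hx, hv.periodic_s x hx]

/-- The energy identity. -/
theorem StripSolution.energy (hv : StripSolution μ P v vt vs vtt vst vss) (hT0 : 0 ≤ T)
    (hT : T < Real.pi / 2) (hP : 0 ≤ P) {b b' b'' : ℝ → ℝ} (h1 : ∀ x, HasDerivAt b (b' x) x)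
    (h2 : ∀ x, HasDerivAt b' (b'' x) x) (hc : Continuous b'') (hT1 : b T = 0 ∧ b (-T) = 0)
    (hT2 : b' T = 0 ∧ b' (-T) = 0) :
    ∫ p in fermiBox T P, (b p.1 * (vt p ^ 2 + vs p ^ 2 - μ * (v p ^ 2 / Real.cos p.1 ^ 2)) -
      b'' p.1 * v p ^ 2 / 2) = 0 := by
  have cb : Continuous b := continuous_iff_continuousAt.mpr fun x => (h1 x).continuousAt
  have cb' : Continuous b' := continuous_iff_continuousAt.mpr fun x => (h2 x).continuousAt
  have c0 := hv.cont
  have c1 := hv.cont_t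
  have c2 := hv.cont_s
  have c3 := hv.cont_tt
  have c5 := hv.cont_ss
  -- The field is `b v ∇v`, corrected by `b' v² / 2` so that the cross term `b' v v_t` disappears.
  have key := integral_divergence_eq_zero hT0 hT hP
    (X := fun p => b p.1 * (v p * vt p) - b' p.1 * v p ^ 2 / 2)
    (Y := fun p => b p.1 * (v p * vs p))
    (X' := fun p => (b' p.1 * (v p * vt p) + b p.1 * (vt p * vt p + v p * vtt p)) -
      (b'' p.1 * v p ^ 2 + b' p.1 * (2 * v p * vt p)) / 2)
    (Y' := fun p => b p.1 * (vs p * vs p + v p * vss p))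
    ?_ ?_ ?_ ?_ ?_ ?_
  · rw [← key]
    refine setIntegral_congr_fun (measurableSet_fermiBox T P) fun p hp => ?_
    have hpd := fermiBox_subset_coordDomain hT hp
    have heq := hv.equation p hpd
    have e : vtt p = -(μ * v p / Real.cos p.1 ^ 2) - vss p := by linarith
    simp only [e]
    ring
  · intro x s hp
    have g0 := hv.deriv_t x s hp
    have gt := hv.deriv_tt x s hp
    have := ((h1 x).mul (g0.mul gt)).sub (((h2 x).mul (g0.pow 2)).div_const 2)
    convert! this using 1
    simp only [Pi.pow_apply, Pi.mul_apply]
    ring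
  · intro x s hp
    have g0 := hv.deriv_s x s hp
    have gs := hv.deriv_ss x s hp
    exact (g0.mul gs).const_mul (b x)
  · fun_prop
  · fun_prop
  · intro s
    simp [hT1.1, hT1.2, hT2.1, hT2.2]
  · intro x hx
    simp only [hv.periodic x hx, hv.periodic_s x hx]

/-- The localization identity. -/
theorem StripSolution.localization (hv : StripSolution μ P v vt vs vtt vst vss) (hT0 : 0 ≤ T)
    (hT : T < Real.pi / 2) (hP : 0 ≤ P) {φ φ' φ'' : ℝ → ℝ}
    (h1 : ∀ x, |x| < Real.pi / 2 → HasDerivAt φ (φ' x) x)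
    (h2 : ∀ x, |x| < Real.pi / 2 → HasDerivAt φ' (φ'' x) x)
    (hc : ContinuousOn φ'' {x | |x| < Real.pi / 2}) (hT1 : φ' T = 0 ∧ φ' (-T) = 0) :
    ∫ p in fermiBox T P, -(φ p.1 * φ'' p.1 * v p ^ 2 + 2 * φ p.1 * φ' p.1 * (v p * vt p)) =
      ∫ p in fermiBox T P, φ' p.1 ^ 2 * v p ^ 2 := by
  have hfst : ContinuousOn (Prod.fst : ℝ × ℝ → ℝ) coordDomain := continuous_fst.continuousOn
  have hm : MapsTo (Prod.fst : ℝ × ℝ → ℝ) coordDomain {x | |x| < Real.pi / 2} := fun p hp => hp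
  have cφ : ContinuousOn (fun p : ℝ × ℝ => φ p.1) coordDomain :=
    ContinuousOn.comp (fun x hx => (h1 x hx).continuousAt.continuousWithinAt) hfst hm
  have cφ' : ContinuousOn (fun p : ℝ × ℝ => φ' p.1) coordDomain :=
    ContinuousOn.comp (fun x hx => (h2 x hx).continuousAt.continuousWithinAt) hfst hm
  have cφ'' : ContinuousOn (fun p : ℝ × ℝ => φ'' p.1) coordDomain := hc.comp hfst hm
  have c0 := hv.cont
  have c1 := hv.cont_t
  -- The two integrands differ by the exact derivative of `φ φ' v²`. The left one is `φ v (Δ - μ) (φ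
  -- v)` in Fermi coordinates, once the area factor has cancelled the conformal factor.
  have key := integral_divergence_eq_zero hT0 hT hP
    (X := fun p => φ p.1 * φ' p.1 * v p ^ 2) (Y := fun _ => 0)
    (X' := fun p => (φ' p.1 * φ' p.1 + φ p.1 * φ'' p.1) * v p ^ 2 +
      φ p.1 * φ' p.1 * (2 * v p * vt p)) (Y' := fun _ => 0)
    ?_ ?_ ?_ ?_ ?_ ?_
  · rw [← sub_eq_zero, ← integral_sub]
    · rw [← neg_eq_zero, ← integral_neg, ← key]
      refine setIntegral_congr_fun (measurableSet_fermiBox T P) fun p hp => ?_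
      ring
    · exact integrableOn_fermiBox hT (((cφ.mul cφ'').mul (c0.pow 2)).add
        (((continuousOn_const (c := (2 : ℝ)).mul cφ).mul cφ').mul (c0.mul c1))).neg
    · exact integrableOn_fermiBox hT ((cφ'.pow 2).mul (c0.pow 2))
  · intro x s hp
    have g0 := hv.deriv_t x s hp
    have := ((h1 x hp).mul (h2 x hp)).mul (g0.pow 2)
    convert! this using 1
    simp only [Pi.pow_apply, Pi.mul_apply]
    ring
  · exact fun x s _ => hasDerivAt_const s 0
  · exact (((cφ'.mul cφ').add (cφ.mul cφ'')).mul (c0.pow 2)).add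
      ((cφ.mul cφ').mul ((continuousOn_const (c := (2 : ℝ)).mul c0).mul c1))
  · fun_prop
  · intro s
    simp [hT1.1, hT1.2]
  · exact fun _ _ => rfl

end Identities

/-! ### Weights and the mass inequality uniform in the eigenvalue -/

theorem isOpen_abs_lt (r : ℝ) : IsOpen {x : ℝ | |x| < r} := isOpen_lt (by fun_prop) continuous_const

theorem isOpen_lt_abs (r : ℝ) : IsOpen {x : ℝ | r < |x|} := isOpen_lt continuous_const (by fun_prop)

/-- A smooth even function on the line that is `1` on `[-r, r]` and `0` off `(-R, R)`. -/
theorem exists_bump {r R : ℝ} (hr : 0 < r) (hR : r < R) :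
    ∃ f : ℝ → ℝ, ContDiff ℝ ∞ f ∧ (∀ x, 0 ≤ f x) ∧ (∀ x, f x ≤ 1) ∧ (∀ x, |x| ≤ r → f x = 1) ∧
      ∀ x, R ≤ |x| → f x = 0 := by
  let B : ContDiffBump (0 : ℝ) := ⟨r, R, hr, hR⟩
  refine ⟨B, B.contDiff, fun x => B.nonneg, fun x => B.le_one, fun x hx => ?_, fun x hx => ?_⟩
  · exact B.one_of_mem_closedBall (by simpa using hx)
  · exact B.zero_of_le_dist (by simpa using hx)

theorem ContDiff.deriv_infty {f : ℝ → ℝ} (hf : ContDiff ℝ ∞ f) : ContDiff ℝ ∞ (deriv f) :=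
  (contDiff_infty_iff_deriv.mp hf).2

theorem ContDiff.hasDerivAt_deriv {f : ℝ → ℝ} (hf : ContDiff ℝ ∞ f) (x : ℝ) :
    HasDerivAt f (deriv f x) x :=
  ((contDiff_infty_iff_deriv.mp hf).1 x).hasDerivAt

/-- The radial profile `1 - χ (tan² τ)` of the cutoff function of a collar. -/
def profile (χ : ℝ → ℝ) (x : ℝ) : ℝ := 1 - χ (Real.tan x ^ 2)

theorem contDiffOn_profile {χ : ℝ → ℝ} (hχ : ContDiff ℝ ∞ χ) :
    ContDiffOn ℝ ∞ (profile χ) {x : ℝ | |x| < Real.pi / 2} := by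
  intro x hx
  have hc : Real.cos x ≠ 0 := (Real.cos_pos_of_mem_Ioo (abs_lt.mp hx)).ne'
  have h1 : ContDiffAt ℝ ∞ Real.tan x := Real.contDiffAt_tan.mpr hc
  exact (contDiffAt_const.sub (hχ.contDiffAt.comp x (h1.pow 2))).contDiffWithinAt

theorem contDiffOn_deriv_profile {χ : ℝ → ℝ} (hχ : ContDiff ℝ ∞ χ) :
    ContDiffOn ℝ ∞ (deriv (profile χ)) {x : ℝ | |x| < Real.pi / 2} :=
  (contDiffOn_profile hχ).deriv_of_isOpen (isOpen_abs_lt _) le_rfl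

theorem hasDerivAt_profile {χ : ℝ → ℝ} (hχ : ContDiff ℝ ∞ χ) (x : ℝ) (hx : |x| < Real.pi / 2) :
    HasDerivAt (profile χ) (deriv (profile χ) x) x :=
  (((contDiffOn_profile hχ).differentiableOn (by simp)).differentiableAt
    ((isOpen_abs_lt _).mem_nhds hx)).hasDerivAt

theorem hasDerivAt_deriv_profile {χ : ℝ → ℝ} (hχ : ContDiff ℝ ∞ χ) (x : ℝ)
    (hx : |x| < Real.pi / 2) :
    HasDerivAt (deriv (profile χ)) (deriv (deriv (profile χ)) x) x :=
  (((contDiffOn_deriv_profile hχ).differentiableOn (by simp)).differentiableAt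
    ((isOpen_abs_lt _).mem_nhds hx)).hasDerivAt

theorem continuousOn_deriv_deriv_profile {χ : ℝ → ℝ} (hχ : ContDiff ℝ ∞ χ) :
    ContinuousOn (deriv (deriv (profile χ))) {x : ℝ | |x| < Real.pi / 2} :=
  ((contDiffOn_deriv_profile hχ).deriv_of_isOpen (m := ∞) (isOpen_abs_lt _) le_rfl).continuousOn

/-- A weight for the virial identity: `sin` near the core and `0` near the boundary. -/
theorem exists_virial_weight {r R : ℝ} (hr : 0 < r) (hR : r < R) :
    ∃ a : ℝ → ℝ, ContDiff ℝ ∞ a ∧ (∀ x, 0 ≤ a x * Real.sin x) ∧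
      (∀ x, |x| < r → a x = Real.sin x ∧ deriv a x = Real.cos x ∧
        deriv (deriv (deriv a)) x = -Real.cos x) ∧
      (∀ x, R < |x| → a x = 0 ∧ deriv a x = 0 ∧ deriv (deriv a) x = 0) := by
  obtain ⟨f, hf, hf0, hf1, hfr, hfR⟩ := exists_bump hr hR
  refine ⟨fun x => f x * Real.sin x, hf.mul Real.contDiff_sin, fun x => ?_, fun x hx => ?_,
    fun x hx => ?_⟩
  · rw [mul_assoc]
    exact mul_nonneg (hf0 x) (mul_self_nonneg _)
  · have e : (fun x => f x * Real.sin x) =ᶠ[𝓝 x] Real.sin := by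
      filter_upwards [(isOpen_abs_lt r).mem_nhds hx] with y hy
      rw [hfr y (le_of_lt hy), one_mul]
    have e1 := e.deriv
    rw [Real.deriv_sin] at e1
    have e2 := e1.deriv
    rw [Real.deriv_cos'] at e2
    have e3 := e2.deriv
    refine ⟨e.self_of_nhds, e1.self_of_nhds, ?_⟩
    rw [e3.self_of_nhds]
    simp
  · have e : (fun x => f x * Real.sin x) =ᶠ[𝓝 x] fun _ => 0 := by
      filter_upwards [(isOpen_lt_abs R).mem_nhds hx] with y hy
      rw [hfR y (le_of_lt hy), zero_mul]
    have e1 := e.deriv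
    rw [deriv_const'] at e1
    have e2 := e1.deriv
    rw [deriv_const'] at e2
    exact ⟨e.self_of_nhds, e1.self_of_nhds, e2.self_of_nhds⟩

/-- A weight for the energy identity, supported away from the core and the boundary. -/
theorem exists_energy_weight {p q r R : ℝ} (hp : 0 < p) (hpq : p < q) (hqr : q < r) (hrR : r < R) :
    ∃ b : ℝ → ℝ, ContDiff ℝ ∞ b ∧ (∀ x, 0 ≤ b x) ∧ (∀ x, b x ≤ 1) ∧
      (∀ x, |x| < p → b x = 0 ∧ deriv (deriv b) x = 0) ∧
      (∀ x, q ≤ |x| → |x| ≤ r → b x = 1) ∧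
      (∀ x, R < |x| → b x = 0 ∧ deriv b x = 0) := by
  obtain ⟨f, hf, hf0, hf1, hfr, hfR⟩ := exists_bump hp hpq
  obtain ⟨g, hg, hg0, hg1, hgr, hgR⟩ := exists_bump (hp.trans (hpq.trans hqr)) hrR
  refine ⟨fun x => g x - f x, hg.sub hf, fun x => ?_, fun x => ?_, fun x hx => ?_,
    fun x hx hx' => ?_, fun x hx => ?_⟩
  · change 0 ≤ g x - f x
    rcases le_total |x| r with h | h
    · rw [hgr x h]; linarith [hf1 x]
    · rw [hfR x (by linarith)]; linarith [hg0 x]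
  · change g x - f x ≤ 1
    linarith [hf0 x, hg1 x]
  · have e : (fun x => g x - f x) =ᶠ[𝓝 x] fun _ => 0 := by
      filter_upwards [(isOpen_abs_lt p).mem_nhds hx] with y hy
      have hy' : |y| < p := hy
      rw [hfr y hy'.le, hgr y (by linarith), sub_self]
    have e1 := e.deriv
    rw [deriv_const'] at e1
    have e2 := e1.deriv
    rw [deriv_const'] at e2
    exact ⟨e.self_of_nhds, e2.self_of_nhds⟩
  · simp only
    rw [hgr x hx', hfR x hx, sub_zero]
  · have e : (fun x => g x - f x) =ᶠ[𝓝 x] fun _ => 0 := by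
      filter_upwards [(isOpen_lt_abs R).mem_nhds hx] with y hy
      have hy' : R < |y| := hy
      rw [hfR y (by linarith), hgR y hy'.le, sub_self]
    have e1 := e.deriv
    rw [deriv_const'] at e1
    exact ⟨e.self_of_nhds, e1.self_of_nhds⟩

theorem exists_bound {f : ℝ → ℝ} {T : ℝ} (hf : ContinuousOn f (Icc (-T) T)) :
    ∃ M, 0 < M ∧ ∀ x ∈ Icc (-T) T, |f x| ≤ M := by
  obtain ⟨M, hM⟩ := isCompact_Icc.exists_bound_of_continuousOn hf
  exact ⟨max M 1, by positivity, fun x hx => (hM x hx).trans (le_max_left _ _)⟩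

theorem cos_le_cos_of_mem_Icc {x T : ℝ} (hT : T < Real.pi / 2) (hx : x ∈ Icc (-T) T) :
    Real.cos T ≤ Real.cos x := by
  rw [← Real.cos_abs x]
  exact Real.cos_le_cos_of_nonneg_of_le_pi (abs_nonneg x) (by linarith [Real.pi_pos])
    (abs_le.mpr hx)

/-- Combination of the virial and the energy identity: the weighted mass is not positive, where
the weight is positive near the core. -/
theorem exists_mass_weight {p₁ p₃ T : ℝ} (h1 : 0 < p₁) (h13 : p₁ < p₃) (hT3 : p₃ < T)
    (hT : T < Real.pi / 2) :
    ∃ c N : ℝ, 0 < c ∧ 0 < N ∧ ∀ μ : ℝ, 0 < μ → ∃ W : ℝ → ℝ,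
      ContinuousOn W {x | |x| < Real.pi / 2} ∧
      (∀ x ∈ Icc (-T) T, -(N * (1 + μ)) ≤ W x) ∧
      (∀ x ∈ Icc (-T) T, |x| < p₃ → c ≤ W x) ∧
      (∀ x ∈ Icc (-T) T, |x| < p₃ → p₁ ≤ |x| → c * (1 + μ) ≤ W x) ∧
      ∀ P, 0 ≤ P → ∀ v vt vs vtt vst vss, StripSolution μ P v vt vs vtt vst vss →
        ∫ p in fermiBox T P, W p.1 * v p ^ 2 ≤ 0 := by
  have h3 := h1.trans h13
  -- The radii satisfy `p₁ < p₃ < p₄ < p₅ < p₆ < T`. The weight `a` is `sin` up to `p₄` and `0`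
  -- beyond `p₅`; the weight `b` is `0` up to `p₃`, `1` on `[p₄, p₅]` and `0` beyond `p₆`. Thus `b`
  -- is `1` exactly where `a'` may be negative and does not disturb the core.
  obtain ⟨p₆, h36, h6T⟩ := exists_between hT3
  obtain ⟨p₅, h35, h56⟩ := exists_between h36
  obtain ⟨p₄, h34, h45⟩ := exists_between h35
  obtain ⟨a, ha, ha0, har, haR⟩ := exists_virial_weight (h3.trans h34) h45
  obtain ⟨b, hb, hb0, hb1, hbp, hbq, hbR⟩ := exists_energy_weight h3 h34 h45 h56
  have ha1 := ContDiff.deriv_infty ha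
  have ha2 := ContDiff.deriv_infty ha1
  have ha3 := ContDiff.deriv_infty ha2
  have hb' := ContDiff.deriv_infty hb
  have hb'' := ContDiff.deriv_infty hb'
  obtain ⟨M₁, hM₁, hM₁'⟩ := exists_bound (T := T) ha1.continuous.continuousOn
  obtain ⟨M₂, hM₂, hM₂'⟩ := exists_bound (T := T) ha3.continuous.continuousOn
  obtain ⟨M₃, hM₃, hM₃'⟩ := exists_bound (T := T) hb''.continuous.continuousOn
  have hT0 : 0 < T := h3.trans hT3
  have hcT : 0 < Real.cos T := Real.cos_pos_of_mem_Ioo ⟨by linarith, hT⟩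
  have hcos : ∀ x ∈ Icc (-T) T, Real.cos T ≤ Real.cos x :=
    fun x hx => cos_le_cos_of_mem_Icc hT hx
  -- The virial term proportional to `μ` stays nonnegative also where `a` is cut off; the only
  -- negative multiple of `μ` in the weight comes from `b`.
  have hw : ∀ x ∈ Icc (-T) T, 0 ≤ a x * (2 * Real.sin x / Real.cos x ^ 3) := fun x hx => by
    have : a x * (2 * Real.sin x / Real.cos x ^ 3) = a x * Real.sin x * (2 / Real.cos x ^ 3) := by
      ring
    rw [this]
    have := hcT.trans_le (hcos x hx)
    exact mul_nonneg (ha0 x) (by positivity)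
  have hTa : |T| = T := abs_of_pos hT0
  have hs1 : 0 < Real.sin p₁ := Real.sin_pos_of_pos_of_lt_pi h1 (by linarith)
  -- Near the core both contributions are positive. The one with `μ` degenerates at `x = 0`, which
  -- is why the bound `c (1 + μ)` is claimed only for `p₁ ≤ |x|`.
  have hcore : ∀ x, |x| < p₃ → ∀ μ, a x * (2 * Real.sin x / Real.cos x ^ 3) * μ -
      deriv (deriv (deriv a)) x / 2 - 2 * M₁ * (b x * (μ / Real.cos x ^ 2)) -
      M₁ * deriv (deriv b) x = 2 * Real.sin x ^ 2 / Real.cos x ^ 3 * μ + Real.cos x / 2 := by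
    intro x hx μ
    rw [(har x (hx.trans h34)).1, (har x (hx.trans h34)).2.2, (hbp x hx).1, (hbp x hx).2]
    ring
  refine ⟨min (2 * Real.sin p₁ ^ 2) (Real.cos T / 2),
    M₂ / 2 + 2 * M₁ * (1 / Real.cos T ^ 2) + M₁ * M₃, by positivity, by positivity,
    fun μ hμ => ⟨fun x => a x * (2 * Real.sin x / Real.cos x ^ 3) * μ - deriv (deriv (deriv a)) x / 2
      - 2 * M₁ * (b x * (μ / Real.cos x ^ 2)) - M₁ * deriv (deriv b) x, ?_, ?_, ?_, ?_, ?_⟩⟩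
  · have hc : ∀ x ∈ {x : ℝ | |x| < Real.pi / 2}, Real.cos x ≠ 0 :=
      fun x hx => (Real.cos_pos_of_mem_Ioo (abs_lt.mp hx)).ne'
    have := ha.continuous
    have := hb.continuous
    have := ha3.continuous
    have := hb''.continuous
    refine ((ContinuousOn.mul (ContinuousOn.mul (by fun_prop) (ContinuousOn.div (by fun_prop)
      (by fun_prop) fun x hx => pow_ne_zero 3 (hc x hx))) (by fun_prop)).sub (by fun_prop)).sub
      (ContinuousOn.mul (by fun_prop) (ContinuousOn.mul (by fun_prop) (ContinuousOn.div
        (by fun_prop) (by fun_prop) fun x hx => pow_ne_zero 2 (hc x hx)))) |>.sub (by fun_prop)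
  · intro x hx
    dsimp only
    have e1 := mul_nonneg (hw x hx) hμ.le
    have e2 := (abs_le.mp (hM₂' x hx)).2
    have e3 := mul_le_mul_of_nonneg_left (abs_le.mp (hM₃' x hx)).2 hM₁.le
    have e4 : b x * (μ / Real.cos x ^ 2) ≤ 1 * (μ / Real.cos T ^ 2) := by
      have := hcos x hx
      gcongr
      exact hb1 x
    have e5 := mul_le_mul_of_nonneg_left e4 (by positivity : 0 ≤ 2 * M₁)
    have e6 : 0 ≤ M₂ / 2 * μ := by positivity
    have e7 : 0 ≤ M₁ * M₃ * μ := by positivity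
    have e8 : 0 ≤ 2 * M₁ * (1 / Real.cos T ^ 2) := by positivity
    have e9 : 2 * M₁ * (1 * (μ / Real.cos T ^ 2)) = 2 * M₁ * (1 / Real.cos T ^ 2) * μ := by ring
    nlinarith
  · intro x hx hx3
    refine le_of_le_of_eq ?_ (hcore x hx3 μ).symm
    have h := hcos x hx
    have := hcT.trans_le h
    have e : 0 ≤ 2 * Real.sin x ^ 2 / Real.cos x ^ 3 * μ := by positivity
    linarith [min_le_right (2 * Real.sin p₁ ^ 2) (Real.cos T / 2)]
  · intro x hx hx3 hx1
    refine le_of_le_of_eq ?_ (hcore x hx3 μ).symm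
    have h := hcos x hx
    have hc := hcT.trans_le h
    have hs : Real.sin p₁ ^ 2 ≤ Real.sin x ^ 2 := by
      have e : Real.sin x ^ 2 = Real.sin |x| ^ 2 := by
        rcases abs_choice x with e | e <;> rw [e]
        rw [Real.sin_neg, neg_sq]
      rw [e]
      gcongr
      exact Real.sin_le_sin_of_le_of_le_pi_div_two (by linarith) (by linarith) hx1
    have hc1 : Real.cos x ^ 3 ≤ 1 := pow_le_one₀ hc.le (Real.cos_le_one x)
    have e1 : 2 * Real.sin p₁ ^ 2 ≤ 2 * Real.sin x ^ 2 / Real.cos x ^ 3 := by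
      rw [le_div_iff₀ (by positivity)]
      nlinarith [sq_nonneg (Real.sin p₁)]
    have e2 := mul_le_mul_of_nonneg_right
      ((min_le_left (2 * Real.sin p₁ ^ 2) (Real.cos T / 2)).trans e1) hμ.le
    linarith [min_le_right (2 * Real.sin p₁ ^ 2) (Real.cos T / 2)]
  · intro P hP v vt vs vtt vst vss hv
    have h0 := haR T (by rw [hTa]; linarith)
    have h0' := haR (-T) (by rw [abs_neg, hTa]; linarith)
    have h1 := hbR T (by rw [hTa]; linarith)
    have h1' := hbR (-T) (by rw [abs_neg, hTa]; linarith)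
    have i1 := hv.virial hT0.le hT hP (ContDiff.hasDerivAt_deriv ha)
      (ContDiff.hasDerivAt_deriv ha1) (ContDiff.hasDerivAt_deriv ha2) ha3.continuous
      ⟨h0.1, h0'.1⟩ ⟨h0.2.1, h0'.2.1⟩ ⟨h0.2.2, h0'.2.2⟩
    have i2 := hv.energy hT0.le hT hP (ContDiff.hasDerivAt_deriv hb)
      (ContDiff.hasDerivAt_deriv hb') hb''.continuous ⟨h1.1, h1'.1⟩ ⟨h1.2, h1'.2⟩
    have hc2 : ∀ p ∈ coordDomain, Real.cos p.1 ^ 2 ≠ 0 :=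
      fun p hp => pow_ne_zero 2 (cos_pos_of_mem_coordDomain hp).ne'
    have hc3 : ∀ p ∈ coordDomain, Real.cos p.1 ^ 3 ≠ 0 :=
      fun p hp => pow_ne_zero 3 (cos_pos_of_mem_coordDomain hp).ne'
    have c1 := ha.continuous
    have c2 := ha1.continuous
    have c3 := ha3.continuous
    have c4 := hb.continuous
    have c5 := hb''.continuous
    have v0 := hv.cont
    have v1 := hv.cont_t
    have v2 := hv.cont_s
    have I1 : IntegrableOn (fun p : ℝ × ℝ => 2 * deriv a p.1 * vt p ^ 2 +
        a p.1 * μ * (2 * Real.sin p.1 / Real.cos p.1 ^ 3) * v p ^ 2 -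
        deriv (deriv (deriv a)) p.1 * v p ^ 2 / 2) (fermiBox T P) := by
      refine integrableOn_fermiBox hT ?_
      refine ((by fun_prop : ContinuousOn _ _).add (ContinuousOn.mul (ContinuousOn.mul
        (by fun_prop) (ContinuousOn.div (by fun_prop) (by fun_prop) hc3)) (by fun_prop))).sub
        (by fun_prop)
    have I2 : IntegrableOn (fun p : ℝ × ℝ => b p.1 * (vt p ^ 2 + vs p ^ 2 -
        μ * (v p ^ 2 / Real.cos p.1 ^ 2)) - deriv (deriv b) p.1 * v p ^ 2 / 2) (fermiBox T P) := by
      refine integrableOn_fermiBox hT ?_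
      refine (ContinuousOn.mul (by fun_prop) ((by fun_prop : ContinuousOn _ _).sub
        (ContinuousOn.mul (by fun_prop) (ContinuousOn.div (by fun_prop) (by fun_prop) hc2)))).sub
        (by fun_prop)
    have I3 : IntegrableOn (fun p : ℝ × ℝ => (a p.1 * (2 * Real.sin p.1 / Real.cos p.1 ^ 3) * μ -
        deriv (deriv (deriv a)) p.1 / 2 - 2 * M₁ * (b p.1 * (μ / Real.cos p.1 ^ 2)) -
        M₁ * deriv (deriv b) p.1) * v p ^ 2) (fermiBox T P) := by
      refine integrableOn_fermiBox hT (ContinuousOn.mul ?_ (by fun_prop))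
      refine ((ContinuousOn.mul (ContinuousOn.mul (by fun_prop) (ContinuousOn.div (by fun_prop)
        (by fun_prop) hc3)) (by fun_prop)).sub (by fun_prop)).sub
        (ContinuousOn.mul (by fun_prop) (ContinuousOn.mul (by fun_prop) (ContinuousOn.div
          (by fun_prop) (by fun_prop) hc2))) |>.sub (by fun_prop)
    -- The virial identity plus `2 M₁` times the energy identity, where `M₁` bounds `|a'|`. All
    -- gradient terms of the sum are then nonnegative, and dropping them leaves the weighted mass.
    have i3 : ∫ p in fermiBox T P, ((2 * deriv a p.1 * vt p ^ 2 +
        a p.1 * μ * (2 * Real.sin p.1 / Real.cos p.1 ^ 3) * v p ^ 2 -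
        deriv (deriv (deriv a)) p.1 * v p ^ 2 / 2) + 2 * M₁ * (b p.1 * (vt p ^ 2 + vs p ^ 2 -
        μ * (v p ^ 2 / Real.cos p.1 ^ 2)) - deriv (deriv b) p.1 * v p ^ 2 / 2)) = 0 := by
      rw [integral_add I1 (I2.const_mul _), integral_const_mul, i1, i2]
      ring
    rw [← i3]
    refine setIntegral_mono_on I3 (I1.add (I2.const_mul _)) (measurableSet_fermiBox T P)
      fun p hp => ?_
    have hpx : p.1 ∈ Icc (-T) T := hp.1
    have k1 : 0 ≤ 2 * deriv a p.1 + 2 * M₁ * b p.1 := by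
      rcases lt_or_ge |p.1| p₄ with h | h
      · rw [(har p.1 h).2.1]
        have := hcT.trans_le (hcos p.1 hpx)
        have := hb0 p.1
        positivity
      rcases le_or_gt |p.1| p₅ with h' | h'
      · rw [hbq p.1 h h']
        linarith [(abs_le.mp (hM₁' p.1 hpx)).1]
      · rw [(haR p.1 h').2.1]
        have := hb0 p.1
        positivity
    have k2 := mul_nonneg k1 (sq_nonneg (vt p))
    have k3 : 0 ≤ 2 * M₁ * b p.1 * vs p ^ 2 := by
      have := hb0 p.1
      positivity
    rw [← sub_nonneg]
    refine (add_nonneg k2 k3).trans_eq ?_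
    ring

theorem continuousOn_fst_of_continuousOn {f : ℝ → ℝ}
    (hf : ContinuousOn f {x | |x| < Real.pi / 2}) :
    ContinuousOn (fun p : ℝ × ℝ => f p.1) coordDomain :=
  hf.comp continuous_fst.continuousOn fun _ hp => hp

/-- If a combination of weights dominates pointwise, then it dominates in the mean. -/
theorem setIntegral_weight_mono {T P : ℝ} (hT : T < Real.pi / 2) {f g W : ℝ → ℝ} {v : ℝ × ℝ → ℝ}
    {A B : ℝ} (hB : 0 ≤ B) (hv : ContinuousOn v coordDomain)
    (hf : ContinuousOn f {x | |x| < Real.pi / 2}) (hg : ContinuousOn g {x | |x| < Real.pi / 2})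
    (hW : ContinuousOn W {x | |x| < Real.pi / 2})
    (h : ∀ x ∈ Icc (-T) T, f x ≤ A * g x + B * W x)
    (h0 : ∫ p in fermiBox T P, W p.1 * v p ^ 2 ≤ 0) :
    ∫ p in fermiBox T P, f p.1 * v p ^ 2 ≤ A * ∫ p in fermiBox T P, g p.1 * v p ^ 2 := by
  have i1 : IntegrableOn (fun p : ℝ × ℝ => f p.1 * v p ^ 2) (fermiBox T P) :=
    integrableOn_fermiBox hT ((continuousOn_fst_of_continuousOn hf).mul (hv.pow 2))
  have i2 : IntegrableOn (fun p : ℝ × ℝ => g p.1 * v p ^ 2) (fermiBox T P) :=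
    integrableOn_fermiBox hT ((continuousOn_fst_of_continuousOn hg).mul (hv.pow 2))
  have i3 : IntegrableOn (fun p : ℝ × ℝ => W p.1 * v p ^ 2) (fermiBox T P) :=
    integrableOn_fermiBox hT ((continuousOn_fst_of_continuousOn hW).mul (hv.pow 2))
  calc ∫ p in fermiBox T P, f p.1 * v p ^ 2
      ≤ ∫ p in fermiBox T P, (A * (g p.1 * v p ^ 2) + B * (W p.1 * v p ^ 2)) := by
        refine setIntegral_mono_on i1 ((i2.const_mul _).add (i3.const_mul _))
          (measurableSet_fermiBox T P) fun p hp => ?_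
        exact (mul_le_mul_of_nonneg_right (h p.1 hp.1) (sq_nonneg (v p))).trans_eq (by ring)
    _ = A * (∫ p in fermiBox T P, g p.1 * v p ^ 2) + B * ∫ p in fermiBox T P, W p.1 * v p ^ 2 := by
        rw [integral_add (i2.const_mul _) (i3.const_mul _), integral_const_mul, integral_const_mul]
    _ ≤ _ := by linarith [mul_nonpos_of_nonneg_of_nonpos hB h0]

/-! ### The cutoff profile and its estimates -/

theorem profile_nonneg {χ : ℝ → ℝ} (h : ∀ x, χ x ≤ 1) (x : ℝ) : 0 ≤ profile χ x :=
  sub_nonneg.mpr (h _)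

theorem profile_le_one {χ : ℝ → ℝ} (h : ∀ x, 0 ≤ χ x) (x : ℝ) : profile χ x ≤ 1 :=
  sub_le_self _ (h _)

theorem tan_gd_sq_lt {r x : ℝ} (hr : 0 ≤ r) (hx : |x| < Real.pi / 2) :
    gd r < |x| ↔ Real.sinh r ^ 2 < Real.tan x ^ 2 := by
  rw [← tan_gd r, ← not_le, ← not_le,
    tan_sq_le_tan_sq (by rcases hr.eq_or_lt with h | h; · rw [← h, gd_zero]
                         exact (gd_pos h).le) (gd_lt r) hx]

theorem sq_sinh_lt {r s : ℝ} (hr : 0 ≤ r) (h : r < s) : Real.sinh r ^ 2 < Real.sinh s ^ 2 :=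
  pow_lt_pow_left₀ (Real.sinh_lt_sinh.mpr h) (Real.sinh_nonneg_iff.mpr hr) two_ne_zero

/-- A cutoff function for collars of width `w`, in terms of the squared hyperbolic sine of the
distance to the core, together with the estimates that it satisfies for eigenfunctions. -/
theorem exists_cutoff {w : ℝ} (hw : 0 < w) :
    ∃ (χ : ℝ → ℝ) (r₁ r₂ K : ℝ), w / 2 < r₁ ∧ r₁ < r₂ ∧ r₂ < w ∧ 0 < K ∧ ContDiff ℝ ∞ χ ∧
      (∀ q, 0 ≤ χ q) ∧ (∀ q, χ q ≤ 1) ∧ (∀ q, 0 ≤ q → q ≤ Real.sinh r₁ ^ 2 → χ q = 1) ∧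
      (∀ q, Real.sinh r₂ ^ 2 ≤ q → χ q = 0) ∧
      (∀ x ∈ Icc (-gd w) (gd w), deriv (profile χ) x ^ 2 ≤ K) ∧
      ∀ μ, 0 < μ → ∀ P, 0 ≤ P → ∀ v vt vs vtt vst vss, StripSolution μ P v vt vs vtt vst vss →
        (∫ p in fermiBox (gd w) P, -(profile χ p.1 * deriv (deriv (profile χ)) p.1 * v p ^ 2 +
          2 * profile χ p.1 * deriv (profile χ) p.1 * (v p * vt p)) =
          ∫ p in fermiBox (gd w) P, deriv (profile χ) p.1 ^ 2 * v p ^ 2) ∧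
        (∫ p in fermiBox (gd w) P, deriv (profile χ) p.1 ^ 2 * v p ^ 2 ≤
          K * ∫ p in fermiBox (gd w) P, profile χ p.1 ^ 2 * v p ^ 2) ∧
        ∫ p in fermiBox (gd w) P, v p ^ 2 ≤
          K * (1 + μ) * ∫ p in fermiBox (gd w) P, profile χ p.1 ^ 2 * v p ^ 2 := by
  obtain ⟨r₂, h2, h2w⟩ := exists_between (half_lt_self hw)
  obtain ⟨r₁, h1, h12⟩ := exists_between h2
  obtain ⟨r₃, h23, h3w⟩ := exists_between h2w
  have hr0 : 0 < r₁ := by linarith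
  have hT : gd w < Real.pi / 2 := gd_lt w
  have hT0 : 0 < gd w := gd_pos hw
  obtain ⟨β, hβ, hβ0, hβ1, hβr, hβR⟩ := exists_bump (pow_pos (Real.sinh_pos_iff.mpr hr0) 2)
    (sq_sinh_lt hr0.le h12)
  -- This makes the profile `φ` a square, so that `φ'² ≤ 4 M² φ`: the derivative is bounded and
  -- vanishes wherever `φ` does.
  set χ : ℝ → ℝ := fun q => 1 - (1 - β q) ^ 2 with hχd
  have hχ : ContDiff ℝ ∞ χ := contDiff_const.sub ((contDiff_const.sub hβ).pow 2)
  have hχ0 : ∀ q, 0 ≤ χ q := fun q => by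
    have e0 := hβ0 q
    have e1 := hβ1 q
    simp only [hχd]
    nlinarith
  have hχ1 : ∀ q, χ q ≤ 1 := fun q => by
    simp only [hχd]
    linarith [sq_nonneg (1 - β q)]
  have hχr : ∀ q, 0 ≤ q → q ≤ Real.sinh r₁ ^ 2 → χ q = 1 := fun q hq0 hq => by
    simp only [hχd]
    rw [hβr q (by rwa [abs_of_nonneg hq0])]
    norm_num
  have hχR : ∀ q, Real.sinh r₂ ^ 2 ≤ q → χ q = 0 := fun q hq => by
    simp only [hχd]
    rw [hβR q (hq.trans (le_abs_self q))]
    norm_num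
  have hmem : ∀ x ∈ Icc (-gd w) (gd w), |x| < Real.pi / 2 :=
    fun x hx => (abs_le.mpr hx).trans_lt hT
  have hsq : ∀ x, |x| < Real.pi / 2 →
      deriv (profile χ) x = 2 * profile β x * deriv (profile β) x := fun x hx => by
    have e : profile χ = profile β ^ 2 := by
      funext x
      simp only [profile, hχd, Pi.pow_apply]
      ring
    rw [e]
    have := ((hasDerivAt_profile hβ x hx).pow 2).deriv
    simpa using this
  have hφβ : ∀ x, profile χ x = profile β x ^ 2 := fun x => by
    simp only [profile, hχd]
    ring
  obtain ⟨M, hM, hM'⟩ := exists_bound (T := gd w)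
    ((contDiffOn_deriv_profile hβ).continuousOn.mono hmem)
  have hφ0 := profile_nonneg hχ1
  have hφ1 := profile_le_one hχ0
  have hd : ∀ x ∈ Icc (-gd w) (gd w), deriv (profile χ) x ^ 2 ≤ 4 * M ^ 2 * profile χ x :=
    fun x hx => by
      rw [hsq x (hmem x hx), hφβ]
      have e := pow_le_pow_left₀ (abs_nonneg _) (hM' x hx) 2
      rw [sq_abs] at e
      nlinarith [mul_le_mul_of_nonneg_left e (sq_nonneg (profile β x))]
  have hin : ∀ x ∈ Icc (-gd w) (gd w), |x| < gd r₁ → profile χ x = 0 := fun x hx hx1 => by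
    have : Real.tan x ^ 2 ≤ Real.sinh r₁ ^ 2 :=
      not_lt.mp fun h => absurd ((tan_gd_sq_lt hr0.le (hmem x hx)).mpr h) (not_lt.mpr hx1.le)
    simp only [profile]
    rw [hχr _ (sq_nonneg _) this, sub_self]
  have hout : ∀ x, |x| < Real.pi / 2 → gd r₂ < |x| → profile χ x = 1 := fun x hx hx2 => by
    simp only [profile]
    rw [hχR _ ((tan_gd_sq_lt (by linarith) hx).mp hx2).le, sub_zero]
  have hout' : ∀ x, |x| < Real.pi / 2 → gd r₂ < |x| → deriv (profile χ) x = 0 :=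
    fun x hx hx2 => by
      have e : profile χ =ᶠ[𝓝 x] fun _ => 1 := by
        filter_upwards [(isOpen_abs_lt _).mem_nhds hx, (isOpen_lt_abs _).mem_nhds hx2] with y hy hy'
        exact hout y hy hy'
      rw [e.deriv_eq, deriv_const]
  have g1 : 0 < gd r₁ := gd_pos hr0
  have g12 : gd r₁ < gd r₂ := gd_strictMono h12
  have g23 : gd r₂ < gd r₃ := gd_strictMono h23
  have g3 : gd r₃ < gd w := gd_strictMono h3w
  obtain ⟨c, N, hc, hN, hmass⟩ := exists_mass_weight g1 (g12.trans g23) g3 hT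
  -- The three summands of `K` are the constants of the three estimates, so that one number serves
  -- for all of them.
  refine ⟨χ, r₁, r₂, 4 * M ^ 2 + 4 * M ^ 2 * N / c + (1 + N / c), h1, h12, h2w, by positivity, hχ,
    hχ0, hχ1, hχr, hχR, fun x hx => ?_, fun μ hμ P hP v vt vs vtt vst vss hv => ?_⟩
  · have e1 := hd x hx
    have e2 := mul_le_mul_of_nonneg_left (hφ1 x) (by positivity : 0 ≤ 4 * M ^ 2)
    have e3 : 0 ≤ 4 * M ^ 2 * N / c := by positivity
    have e4 : 0 ≤ N / c := by positivity
    linarith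
  obtain ⟨W, hW, hWN, hW3, hW1, hWv⟩ := hmass μ hμ
  have cφ := (contDiffOn_profile hχ).continuousOn
  have cφ' := (contDiffOn_deriv_profile hχ).continuousOn
  have hI : 0 ≤ ∫ p in fermiBox (gd w) P, profile χ p.1 ^ 2 * v p ^ 2 :=
    integral_nonneg fun p => by positivity
  have hTa : |gd w| = gd w := abs_of_pos hT0
  refine ⟨?_, ?_, ?_⟩
  · exact hv.localization hT0.le hT hP (hasDerivAt_profile hχ) (hasDerivAt_deriv_profile hχ)
      (continuousOn_deriv_deriv_profile hχ)
      ⟨hout' _ (by rwa [hTa]) (by rw [hTa]; linarith),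
        hout' _ (by rwa [abs_neg, hTa]) (by rw [abs_neg, hTa]; linarith)⟩
  -- It suffices that `(1 + μ) φ'² ≤ A φ² + B W` pointwise. Inside `gd r₁` both `φ` and `φ'` vanish
  -- and `W ≥ 0`. Up to `gd r₂` the bound `W ≥ c (1 + μ)` pays for `φ'²`. Beyond that `φ = 1` and
  -- `φ' = 0`, and `A` offsets the negative part of `W`. The factor `1 + μ` on the left cancels the
  -- one in `A`.
  · have key := setIntegral_weight_mono (P := P) (f := fun x => (1 + μ) * deriv (profile χ) x ^ 2)
      (g := fun x => profile χ x ^ 2) (A := 4 * M ^ 2 * N / c * (1 + μ)) (B := 4 * M ^ 2 / c)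
      hT (by positivity) hv.cont (continuousOn_const.mul (cφ'.pow 2)) (cφ.pow 2) hW ?_
      (hWv P hP v vt vs vtt vst vss hv)
    · have e : ∫ p in fermiBox (gd w) P, (1 + μ) * deriv (profile χ) p.1 ^ 2 * v p ^ 2 =
          (1 + μ) * ∫ p in fermiBox (gd w) P, deriv (profile χ) p.1 ^ 2 * v p ^ 2 := by
        rw [← integral_const_mul]
        exact integral_congr_ae (Eventually.of_forall fun p => by ring)
      rw [e] at key
      have e2 : ∫ p in fermiBox (gd w) P, deriv (profile χ) p.1 ^ 2 * v p ^ 2 ≤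
          4 * M ^ 2 * N / c * ∫ p in fermiBox (gd w) P, profile χ p.1 ^ 2 * v p ^ 2 := by
        refine le_of_mul_le_mul_left (key.trans_eq ?_) (by positivity : 0 < 1 + μ)
        ring
      have e3 : 0 ≤ (4 * M ^ 2 + (1 + N / c)) *
          ∫ p in fermiBox (gd w) P, profile χ p.1 ^ 2 * v p ^ 2 := by positivity
      linarith
    · intro x hx
      rcases lt_or_ge |x| (gd r₁) with h | h
      · have e := hd x hx
        rw [hin x hx h, mul_zero] at e
        have e' : deriv (profile χ) x ^ 2 = 0 := le_antisymm e (sq_nonneg _)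
        have e2 := hc.le.trans (hW3 x hx (h.trans (g12.trans g23)))
        simp only [e', hin x hx h]
        have : 0 ≤ 4 * M ^ 2 / c * W x := by positivity
        linarith
      rcases le_or_gt |x| (gd r₂) with h' | h'
      · have e := mul_le_mul_of_nonneg_left (hW1 x hx (h'.trans_lt g23) h)
          (by positivity : 0 ≤ 4 * M ^ 2 / c)
        have e1 : 4 * M ^ 2 / c * (c * (1 + μ)) = 4 * M ^ 2 * (1 + μ) := by field_simp
        have e2 : deriv (profile χ) x ^ 2 ≤ 4 * M ^ 2 :=
          (hd x hx).trans (mul_le_of_le_one_right (by positivity) (hφ1 x))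
        have e3 := mul_le_mul_of_nonneg_left e2 (by positivity : 0 ≤ 1 + μ)
        have e4 : 0 ≤ 4 * M ^ 2 * N / c * (1 + μ) * profile χ x ^ 2 := by positivity
        linarith
      · simp only [hout' x (hmem x hx) h', hout x (hmem x hx) h']
        have e := mul_le_mul_of_nonneg_left (hWN x hx) (by positivity : 0 ≤ 4 * M ^ 2 / c)
        have e1 : 4 * M ^ 2 / c * -(N * (1 + μ)) = -(4 * M ^ 2 * N / c * (1 + μ)) := by ring
        linarith
  -- Here the whole core counts, where only `W ≥ c` is known, so the factor `1 + μ` in `A` remains.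
  -- The intermediate radius `r₃ > r₂` ensures `φ = 1` wherever `W` may be negative.
  · have key := setIntegral_weight_mono (P := P) (f := fun _ => 1)
      (g := fun x => profile χ x ^ 2) (A := (1 + N / c) * (1 + μ)) (B := 1 / c)
      hT (by positivity) hv.cont continuousOn_const (cφ.pow 2) hW ?_
      (hWv P hP v vt vs vtt vst vss hv)
    · simp only [one_mul] at key
      have e3 : 0 ≤ (4 * M ^ 2 + 4 * M ^ 2 * N / c) * (1 + μ) *
          ∫ p in fermiBox (gd w) P, profile χ p.1 ^ 2 * v p ^ 2 := by positivity
      linarith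
    · intro x hx
      rcases lt_or_ge |x| (gd r₃) with h | h
      · have e := mul_le_mul_of_nonneg_left (hW3 x hx h) (by positivity : 0 ≤ 1 / c)
        have e1 : 1 / c * c = 1 := by field_simp
        have e2 : 0 ≤ (1 + N / c) * (1 + μ) * profile χ x ^ 2 := by positivity
        linarith
      · rw [hout x (hmem x hx) (g23.trans_le h)]
        have e := mul_le_mul_of_nonneg_left (hWN x hx) (by positivity : 0 ≤ 1 / c)
        have e1 : 1 / c * -(N * (1 + μ)) = -(N / c * (1 + μ)) := by ring
        linarith

/-! ### The cutoff function on the surface -/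

section

/-- The Laplacian in terms of iterated partial derivatives. -/
theorem laplacian_eq_of_partials {G : ℂ → ℝ} {O : Set (ℝ × ℝ)} (hO : IsOpen O) {x s : ℝ}
    (hp : (x, s) ∈ O) (hG : ∀ p ∈ O, ContDiffAt ℝ ∞ G (toStrip p)) {gt gs : ℝ × ℝ → ℝ} {gtt gss : ℝ}
    (ht : ∀ x s, (x, s) ∈ O → HasDerivAt (fun x => G (toStrip (x, s))) (gt (x, s)) x)
    (hs : ∀ x s, (x, s) ∈ O → HasDerivAt (fun s => G (toStrip (x, s))) (gs (x, s)) s)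
    (htt : HasDerivAt (fun x => gt (x, s)) gtt x) (hss : HasDerivAt (fun s => gs (x, s)) gss s) :
    Laplacian.laplacian G (toStrip (x, s)) = gtt + gss := by
  have d1 : ∀ p ∈ O, HasFDerivAt G (fderiv ℝ G (toStrip p)) (toStrip p) := fun p hp =>
    ((hG p hp).differentiableAt (by simp)).hasFDerivAt
  have d2 : ∀ a, HasFDerivAt (fun ζ => fderiv ℝ G ζ a)
      ((fderiv ℝ (fderiv ℝ G) (toStrip (x, s))).flip a) (toStrip (x, s)) := fun a => by
    have := (((hG _ hp).fderiv_right (m := ∞) le_rfl).differentiableAt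
      (by simp)).hasFDerivAt.clm_apply (hasFDerivAt_const a (toStrip (x, s)))
    simpa using this
  have h1 := hasDerivAt_toStrip_fst (d2 Complex.I)
  have h2 := hasDerivAt_toStrip_snd (d2 1)
  have e1 : (fun x => fderiv ℝ G (toStrip (x, s)) Complex.I) =ᶠ[𝓝 x] fun x => gt (x, s) := by
    filter_upwards [(hO.preimage (by fun_prop : Continuous fun x : ℝ => (x, s))).mem_nhds hp]
      with y hy
    exact (hasDerivAt_toStrip_fst (d1 _ hy)).unique (ht y s hy)
  have e2 : (fun s => fderiv ℝ G (toStrip (x, s)) 1) =ᶠ[𝓝 s] fun s => gs (x, s) := by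
    filter_upwards [(hO.preimage (by fun_prop : Continuous fun s : ℝ => (x, s))).mem_nhds hp]
      with y hy
    exact (hasDerivAt_toStrip_snd (d1 _ hy)).unique (hs x y hy)
  have k1 := (htt.congr_of_eventuallyEq e1).unique h1
  have k2 := (hss.congr_of_eventuallyEq e2).unique h2
  rw [laplacian_eq_fderiv_fderiv, k1, k2, add_comm]
  rfl

theorem IsSmoothLift.of_eventuallyEq {u : ℍ → ℝ}
    (h : ∀ z, ∃ u', IsSmoothLift u' ∧ u =ᶠ[𝓝 z] u') : IsSmoothLift u := by
  intro w hw
  obtain ⟨u', hu', e⟩ := h (ofComplex w)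
  refine ((hu'.contDiffAt hw).congr_of_eventuallyEq ?_).contDiffWithinAt
  have hc : ContinuousAt (fun w : ℂ => (ofComplex w : ℍ)) w :=
    (contMDiffAt_ofComplex (n := 0) hw).continuousAt
  exact hc.eventually e

theorem IsSmoothLift.comp {u : ℍ → ℝ} (hu : IsSmoothLift u) {f : ℝ → ℝ} (hf : ContDiff ℝ ∞ f) :
    IsSmoothLift fun z => f (u z) :=
  hf.comp_contDiffOn hu

theorem planeLaplacian_congr {u u' : ℍ → ℝ} {z : ℍ} (h : u =ᶠ[𝓝 z] u') :
    planeLaplacian u z = planeLaplacian u' z := by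
  unfold planeLaplacian
  have hc : ContinuousAt (fun w : ℂ => (ofComplex w : ℍ)) (z : ℂ) :=
    (contMDiffAt_ofComplex (n := 0) z.im_pos).continuousAt
  have e : (fun w : ℂ => u (ofComplex w)) =ᶠ[𝓝 (z : ℂ)] fun w => u' (ofComplex w) :=
    hc.eventually (show u =ᶠ[𝓝 (ofComplex (z : ℂ))] u' by rwa [ofComplex_apply])
  rw [(InnerProductSpace.laplacian_congr_nhds e).self_of_nhds]

theorem IsSmoothLift.continuous_planeLaplacian {u : ℍ → ℝ} (hu : IsSmoothLift u) :
    Continuous (planeLaplacian u) := by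
  have h1 := (ContDiffOn.fderiv_of_isOpen (m := ∞) hu isOpen_im_pos le_rfl).fderiv_of_isOpen
    (m := ∞) isOpen_im_pos le_rfl
  have h2 := h1.continuousOn.comp_continuous UpperHalfPlane.continuous_coe fun z => z.im_pos
  have h3 : ∀ a : ℂ, Continuous fun z : ℍ =>
      fderiv ℝ (fderiv ℝ fun w : ℂ => u (ofComplex w)) (z : ℂ) a a := fun a =>
    (h2.clm_apply continuous_const).clm_apply continuous_const
  unfold planeLaplacian
  simp only [laplacian_eq_fderiv_fderiv]
  exact ((continuous_im.pow 2).mul ((h3 1).add (h3 Complex.I))).neg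

variable {Γ : Subgroup (Equiv.Perm ℍ)} {ℓ : ℝ} {c : ℝ → Surface Γ} {A : GL (Fin 2) ℝ}
  {h : Equiv.Perm ℍ}

theorem laplacian_proj (hΓ : IsClosedSurfaceGroup Γ) {u : Surface Γ → ℝ} (hu : IsSmooth Γ u)
    (z : ℍ) : laplacian Γ u (proj Γ z) = planeLaplacian (fun z => u (proj Γ z)) z := by
  obtain ⟨γ, hγ, e⟩ := proj_eq_iff.mp (Quotient.out_eq (proj Γ z) : proj Γ _ = proj Γ z)
  obtain ⟨g, hg⟩ := exists_gl hΓ hγ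
  unfold laplacian
  rw [← e, hg, ← planeLaplacian_comp_smul (u := fun z => u (proj Γ z)) hu g z]
  congr 1
  funext z
  rw [← hg, proj_apply hγ]

open Classical in
/-- The function that is `χ (sinh² d)` at the points at distance `d < w` from the geodesic under the
image of the imaginary axis by `A`, and `0` elsewhere. -/
def cutoff (Γ : Subgroup (Equiv.Perm ℍ)) (A : GL (Fin 2) ℝ) (w : ℝ) (χ : ℝ → ℝ) (x : Surface Γ) :
    ℝ :=
  if hx : ∃ z, proj Γ z = x ∧ defect A z < Real.sinh w ^ 2 then χ (defect A hx.choose) else 0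

/-- The chosen lift does not matter: two lifts inside the open strip differ by an element of `Γ`
that preserves the defect, by `Frame.defect_apply_eq`. -/
theorem Frame.cutoff_proj (hf : Frame Γ ℓ c A h) (hΓ : IsClosedSurfaceGroup Γ) {w : ℝ}
    (hw : 0 < w) (hstd : IsStandardCollar Γ w ℓ c) (χ : ℝ → ℝ) {z : ℍ}
    (hz : defect A z < Real.sinh w ^ 2) : cutoff Γ A w χ (proj Γ z) = χ (defect A z) := by
  have hx : ∃ z', proj Γ z' = proj Γ z ∧ defect A z' < Real.sinh w ^ 2 := ⟨z, rfl, hz⟩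
  rw [cutoff, dif_pos hx]
  obtain ⟨h1, h2⟩ := hx.choose_spec
  obtain ⟨γ, hγ, e⟩ := proj_eq_iff.mp h1
  rw [← e] at h2 ⊢
  rw [hf.defect_apply_eq hΓ hw hstd hγ hz h2]

theorem Frame.cutoff_eq_zero (hf : Frame Γ ℓ c A h) {w : ℝ} (hw : 0 < w) (χ : ℝ → ℝ)
    {x : Surface Γ} (hx : x ∉ collar Γ w c) : cutoff Γ A w χ x = 0 := by
  refine dif_neg ?_
  rintro ⟨z, rfl, hz⟩
  exact hx (hf.mem_collar_of_defect_le hw.le hz.le)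

theorem Frame.cutoff_eq_one (hf : Frame Γ ℓ c A h) (hΓ : IsClosedSurfaceGroup Γ) {w : ℝ}
    (hw : 0 < w) (hstd : IsStandardCollar Γ w ℓ c) {χ : ℝ → ℝ} {r r₁ : ℝ} (hr0 : 0 ≤ r)
    (hr : r < r₁) (hrw : r₁ < w) (hχ : ∀ q, 0 ≤ q → q ≤ Real.sinh r₁ ^ 2 → χ q = 1)
    {x : Surface Γ} (hx : x ∈ collar Γ r c) : cutoff Γ A w χ x = 1 := by
  obtain ⟨z, rfl⟩ := proj_surjective x
  obtain ⟨γ, hγ, hz⟩ := hf.exists_defect_le hΓ hx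
  have h1 := hz.trans_lt (sq_sinh_lt hr0 hr)
  rw [← proj_apply hγ, hf.cutoff_proj hΓ hw hstd χ (h1.trans (sq_sinh_lt (hr0.trans hr.le) hrw))]
  exact hχ _ (sq_nonneg _) h1.le

/-- The gap between `r₂` and `w` gives smoothness across the boundary of the collar. Within distance
`w - r₂` of a point outside all open strips, no point has a lift at distance less than `r₂` from the
axis, and from `r₂` on `χ` vanishes. -/
theorem Frame.cutoff_eventually_eq_zero (hf : Frame Γ ℓ c A h) (hΓ : IsClosedSurfaceGroup Γ)
    {w : ℝ} (hw : 0 < w) (hstd : IsStandardCollar Γ w ℓ c) {χ : ℝ → ℝ} {r₂ : ℝ} (hr0 : 0 ≤ r₂)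
    (hrw : r₂ < w) (hχ : ∀ q, Real.sinh r₂ ^ 2 ≤ q → χ q = 0) {z₀ : ℍ}
    (hz₀ : ¬ ∃ γ ∈ Γ, defect A (γ z₀) < Real.sinh w ^ 2) :
    (fun z => cutoff Γ A w χ (proj Γ z)) =ᶠ[𝓝 z₀] fun _ => 0 := by
  filter_upwards [Metric.ball_mem_nhds z₀ (sub_pos.mpr hrw)] with z hz
  by_cases hx : ∃ γ ∈ Γ, defect A (γ z) < Real.sinh w ^ 2
  · obtain ⟨γ, hγ, hγz⟩ := hx
    rw [← proj_apply hγ, hf.cutoff_proj hΓ hw hstd χ hγz]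
    refine hχ _ (not_lt.mp fun hlt => hz₀ ⟨γ, hγ, ?_⟩)
    obtain ⟨s, hs⟩ := exists_dist_le_of_defect_le hr0 hlt.le
    have hd : dist (γ z₀) (A • axis s) ≤ dist z z₀ + r₂ := by
      have := dist_triangle (γ z₀) (γ z) (A • axis s)
      rw [dist_apply hΓ hγ, dist_comm z₀] at this
      linarith
    refine (defect_le_of_dist_le hd).trans_lt (sq_sinh_lt (by positivity) ?_)
    linarith [Metric.mem_ball.mp hz]
  · refine dif_neg ?_
    rintro ⟨z', e, hz'⟩
    obtain ⟨γ, hγ, rfl⟩ := proj_eq_iff.mp e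
    exact hx ⟨γ, hγ, hz'⟩

theorem Frame.isSmooth_cutoff (hf : Frame Γ ℓ c A h) (hΓ : IsClosedSurfaceGroup Γ)
    {w : ℝ} (hw : 0 < w) (hstd : IsStandardCollar Γ w ℓ c) {χ : ℝ → ℝ} {r₂ : ℝ} (hr0 : 0 ≤ r₂)
    (hrw : r₂ < w) (hχs : ContDiff ℝ ∞ χ) (hχ : ∀ q, Real.sinh r₂ ^ 2 ≤ q → χ q = 0) :
    IsSmoothLift fun z => cutoff Γ A w χ (proj Γ z) := by
  refine IsSmoothLift.of_eventuallyEq fun z₀ => ?_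
  by_cases hz₀ : ∃ γ ∈ Γ, defect A (γ z₀) < Real.sinh w ^ 2
  · obtain ⟨γ, hγ, hz⟩ := hz₀
    obtain ⟨g, hg⟩ := exists_gl hΓ hγ
    refine ⟨fun z => χ (defect A (g • z)), ((isSmoothLift_defect A).comp_smul g).comp hχs, ?_⟩
    filter_upwards [(isOpen_lt ((continuous_defect A).comp (continuous_apply hΓ hγ))
      continuous_const).mem_nhds hz] with z hz'
    rw [← proj_apply hγ, hf.cutoff_proj hΓ hw hstd χ hz', hg]
  · exact ⟨fun _ => 0, contDiffOn_const, hf.cutoff_eventually_eq_zero hΓ hw hstd hr0 hrw hχ hz₀⟩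

end

/-! ### The cut-off eigenfunction in Fermi coordinates -/

section

/-- The formulas for the cutoff hold only in the open strip, and its boundary lines are null. -/
theorem ae_abs_fst_lt (T P : ℝ) : ∀ᵐ p : ℝ × ℝ, p ∈ fermiBox T P → |p.1| < T := by
  have h1 : ∀ᵐ x : ℝ, x ≠ T ∧ x ≠ -T :=
    (Measure.ae_ne volume T).and (Measure.ae_ne volume (-T))
  have h2 : ∀ᵐ p : ℝ × ℝ, p.1 ≠ T ∧ p.1 ≠ -T :=
    (Measure.quasiMeasurePreserving_fst (μ := (volume : Measure ℝ))
      (ν := (volume : Measure ℝ))).ae h1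
  filter_upwards [h2] with p hp hmem
  rw [abs_lt]
  exact ⟨lt_of_le_of_ne hmem.1.1 (Ne.symm hp.2), lt_of_le_of_ne hmem.1.2 hp.1⟩

variable {Γ : Subgroup (Equiv.Perm ℍ)} {ℓ w μ : ℝ} {c : ℝ → Surface Γ} {A : GL (Fin 2) ℝ}
  {h : Equiv.Perm ℍ} {f f' : Surface Γ → ℝ}

/-- A function on the surface in Fermi coordinates. -/
def inFermi (A : GL (Fin 2) ℝ) (f : Surface Γ → ℝ) (ζ : ℂ) : ℝ := f (proj Γ (fermiAt A ζ))

theorem contDiffOn_inFermi (hf : IsSmooth Γ f) :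
    ContDiffOn ℝ ∞ (inFermi A f) {ζ : ℂ | |ζ.im| < Real.pi / 2} :=
  contDiffOn_comp_fermi (IsSmoothLift.comp_smul (u := fun z => f (proj Γ z)) hf A)

theorem laplacian_inFermi (hΓ : IsClosedSurfaceGroup Γ) (hf : IsSmooth Γ f) {ζ : ℂ}
    (hζ : |ζ.im| < Real.pi / 2) : Laplacian.laplacian (inFermi A f) ζ =
      -(laplacian Γ f (proj Γ (fermiAt A ζ)) / Real.cos ζ.im ^ 2) := by
  rw [laplacian_proj hΓ hf, fermiAt,
    ← planeLaplacian_comp_smul (u := fun z => f (proj Γ z)) hf A]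
  exact laplacian_comp_fermi (IsSmoothLift.comp_smul (u := fun z => f (proj Γ z)) hf A) hζ

theorem Frame.exists_stripSolution (hF : Frame Γ ℓ c A h) (hΓ : IsClosedSurfaceGroup Γ)
    (hf : IsSmooth Γ f) (heig : ∀ x, laplacian Γ f x = μ * f x) :
    ∃ vt vs vtt vst vss,
      StripSolution μ (2 * ℓ) (fun p => inFermi A f (toStrip p)) vt vs vtt vst vss := by
  refine HypSurface.exists_stripSolution (contDiffOn_inFermi hf) (fun ζ hζ => ?_) fun ζ hζ => ?_
  · rw [inFermi, ← hF.sq_fermiAt hΓ hζ, proj_apply (Γ.mul_mem hF.mem hF.mem)]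
    rfl
  · rw [laplacian_inFermi hΓ hf hζ, heig]
    rfl

theorem inFermi_cut {χ : ℝ → ℝ} (hw : 0 < w)
    (hf' : ∀ z, defect A z < Real.sinh w ^ 2 →
      f' (proj Γ z) = f (proj Γ z) * (1 - χ (defect A z))) {ζ : ℂ} (hζ : |ζ.im| < gd w) :
    inFermi A f' ζ = profile χ ζ.im * inFermi A f ζ := by
  have h1 : |ζ.im| < Real.pi / 2 := hζ.trans (gd_lt w)
  have h2 : defect A (fermiAt A ζ) < Real.sinh w ^ 2 := by
    rw [defect_fermiAt A h1]
    refine lt_of_le_of_ne (not_lt.mp fun h => ?_) fun h => ?_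
    · exact absurd ((tan_gd_sq_lt hw.le h1).mpr h) (not_lt.mpr hζ.le)
    · rw [← tan_gd w] at h
      exact absurd ((tan_sq_le_tan_sq (abs_nonneg _) h1
        (by rw [abs_of_pos (gd_pos hw)]; exact gd_lt w)).mp (by
          rw [← h]
          rcases abs_choice ζ.im with e | e <;> rw [e]
          rw [Real.tan_neg, neg_sq])) (by rw [abs_of_pos (gd_pos hw)]; exact not_le.mpr hζ)
  rw [inFermi, hf' _ h2, defect_fermiAt A h1, mul_comm]
  rfl

/-- Leibniz rule for the product of the profile and the eigenfunction in conformal coordinates; the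
term in which the profile is not differentiated is replaced by means of the equation. -/
theorem laplacian_cut {χ : ℝ → ℝ} (hΓ : IsClosedSurfaceGroup Γ) (hw : 0 < w)
    (hχ : ContDiff ℝ ∞ χ) (hs' : IsSmooth Γ f')
    (hf' : ∀ z, defect A z < Real.sinh w ^ 2 →
      f' (proj Γ z) = f (proj Γ z) * (1 - χ (defect A z)))
    {P : ℝ} {vt vs vtt vst vss : ℝ × ℝ → ℝ}
    (hv : StripSolution μ P (fun p => inFermi A f (toStrip p)) vt vs vtt vst vss) {p : ℝ × ℝ}
    (hp : |p.1| < gd w) :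
    laplacian Γ f' (proj Γ (fermiAt A (toStrip p))) =
      μ * (profile χ p.1 * inFermi A f (toStrip p)) - Real.cos p.1 ^ 2 *
        (deriv (deriv (profile χ)) p.1 * inFermi A f (toStrip p) +
          2 * deriv (profile χ) p.1 * vt p) := by
  obtain ⟨x, s⟩ := p
  have hO : IsOpen {p : ℝ × ℝ | |p.1| < gd w} := isOpen_lt (by fun_prop) continuous_const
  have hd : ∀ p : ℝ × ℝ, |p.1| < gd w → p ∈ coordDomain := fun p hp => hp.trans (gd_lt w)
  have hx : |x| < Real.pi / 2 := hd (x, s) hp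
  have hcos' : Real.cos x ≠ 0 := (cos_pos_of_mem_coordDomain (hd _ hp)).ne'
  have hcos : Real.cos x ^ 2 ≠ 0 := pow_ne_zero 2 hcos'
  have hS : IsOpen {ζ : ℂ | |ζ.im| < Real.pi / 2} := isOpen_lt (by fun_prop) continuous_const
  have hcut : ∀ x s, |x| < gd w → inFermi A f' (toStrip (x, s)) =
      profile χ x * inFermi A f (toStrip (x, s)) := fun x s hx =>
    inFermi_cut (ζ := toStrip (x, s)) hw hf' hx
  have key := laplacian_eq_of_partials (G := inFermi A f') hO (x := x) (s := s) hp
    (fun p hp => (contDiffOn_inFermi hs').contDiffAt (hS.mem_nhds (hd p hp)))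
    (gt := fun p => deriv (profile χ) p.1 * inFermi A f (toStrip p) + profile χ p.1 * vt p)
    (gs := fun p => profile χ p.1 * vs p)
    (gtt := (deriv (deriv (profile χ)) x * inFermi A f (toStrip (x, s)) +
      deriv (profile χ) x * vt (x, s)) + (deriv (profile χ) x * vt (x, s) +
        profile χ x * vtt (x, s)))
    (gss := profile χ x * vss (x, s)) ?_ ?_ ?_ ?_
  · have k := laplacian_inFermi (A := A) hΓ hs' (ζ := toStrip (x, s)) hx
    rw [key] at k
    have k2 := hv.equation (x, s) (hd _ hp)
    have k3 : vss (x, s) =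
        -(μ * inFermi A f (toStrip (x, s)) / Real.cos x ^ 2) - vtt (x, s) := by
      linarith
    have k4 : ∀ L R C : ℝ, C ≠ 0 → R = -(L / C) → L = -(C * R) := by
      rintro L R C hC rfl
      field_simp
    rw [k4 _ _ _ hcos k, k3]
    field_simp
    ring
  · intro x s hxs
    refine HasDerivAt.congr_of_eventuallyEq
      ((hasDerivAt_profile hχ x (hd _ hxs)).mul (hv.deriv_t x s (hd _ hxs))) ?_
    filter_upwards [(isOpen_abs_lt (gd w)).mem_nhds hxs] with y hy
    exact hcut y s hy
  · intro x s hxs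
    refine HasDerivAt.congr_of_eventuallyEq ((hv.deriv_s x s (hd _ hxs)).const_mul (profile χ x)) ?_
    exact Eventually.of_forall fun y => hcut x y hxs
  · exact ((hasDerivAt_deriv_profile hχ x hx).mul (hv.deriv_t x s hx)).add
      ((hasDerivAt_profile hχ x hx).mul (hv.deriv_tt x s hx))
  · exact (hv.deriv_ss x s hx).const_mul (profile χ x)

end

/-! ### Energy and mass in one collar -/

section

variable {Γ : Subgroup (Equiv.Perm ℍ)} {ℓ w μ : ℝ} {c : ℝ → Surface Γ} {A : GL (Fin 2) ℝ}
  {h : Equiv.Perm ℍ} {f f' : Surface Γ → ℝ}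

theorem IsSmooth.continuous_comp_proj (hf : IsSmooth Γ f) : Continuous fun z => f (proj Γ z) :=
  IsSmoothLift.continuous (u := fun z => f (proj Γ z)) hf

theorem IsSmooth.continuous_laplacian (hΓ : IsClosedSurfaceGroup Γ) (hf : IsSmooth Γ f) :
    Continuous fun z => laplacian Γ f (proj Γ z) := by
  simp only [laplacian_proj hΓ hf]
  exact IsSmoothLift.continuous_planeLaplacian (u := fun z => f (proj Γ z)) hf

theorem integrableOn_dirichletDomain (hΓ : IsClosedSurfaceGroup Γ) {u : ℍ → ℝ}
    (hu : Continuous u) : IntegrableOn u (dirichletDomain Γ) :=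
  hu.continuousOn.integrableOn_compact (isCompact_dirichletDomain hΓ)

theorem volume_real_fermiBox {T P : ℝ} (hT : 0 ≤ T) (hP : 0 ≤ P) :
    volume.real (fermiBox T P) = 2 * T * P := by
  rw [Measure.real, fermiBox, Measure.volume_eq_prod, Measure.prod_prod, Real.volume_Icc,
    Real.volume_Ico, ENNReal.toReal_mul, ENNReal.toReal_ofReal (by linarith),
    ENNReal.toReal_ofReal (by linarith)]
  ring

/-- The properties of the radial profile `1 - χ (tan² τ)` that the estimates use. -/
structure ProfileBounds (w μ K : ℝ) (χ : ℝ → ℝ) : Prop where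
  pos : 0 < K
  smooth : ContDiff ℝ ∞ χ
  deriv_sq_le : ∀ x ∈ Icc (-gd w) (gd w), deriv (profile χ) x ^ 2 ≤ K
  energy_eq : ∀ P, 0 ≤ P → ∀ v vt vs vtt vst vss, StripSolution μ P v vt vs vtt vst vss →
    ∫ p in fermiBox (gd w) P, -(profile χ p.1 * deriv (deriv (profile χ)) p.1 * v p ^ 2 +
      2 * profile χ p.1 * deriv (profile χ) p.1 * (v p * vt p)) =
      ∫ p in fermiBox (gd w) P, deriv (profile χ) p.1 ^ 2 * v p ^ 2
  energy_le : ∀ P, 0 ≤ P → ∀ v vt vs vtt vst vss, StripSolution μ P v vt vs vtt vst vss →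
    ∫ p in fermiBox (gd w) P, deriv (profile χ) p.1 ^ 2 * v p ^ 2 ≤
      K * ∫ p in fermiBox (gd w) P, profile χ p.1 ^ 2 * v p ^ 2
  mass_le : ∀ P, 0 ≤ P → ∀ v vt vs vtt vst vss, StripSolution μ P v vt vs vtt vst vss →
    ∫ p in fermiBox (gd w) P, v p ^ 2 ≤
      K * (1 + μ) * ∫ p in fermiBox (gd w) P, profile χ p.1 ^ 2 * v p ^ 2

/-- The energy and the mass that the cutoff affects in one collar. -/
theorem Frame.collar_estimates (hF : Frame Γ ℓ c A h) (hΓ : IsClosedSurfaceGroup Γ) (hw : 0 < w)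
    (hstd : IsStandardCollar Γ w ℓ c) {K S : ℝ} {χ : ℝ → ℝ}
    (hχ : ProfileBounds w μ K χ) (hf : IsSmooth Γ f) (heig : ∀ x, laplacian Γ f x = μ * f x)
    (hS : ∀ x, |f x| ≤ S) (hs' : IsSmooth Γ f')
    (hf' : ∀ z, defect A z < Real.sinh w ^ 2 →
      f' (proj Γ z) = f (proj Γ z) * (1 - χ (defect A z))) :
    ∃ m, 0 ≤ m ∧
      (∫ z in dirichletDomain Γ ∩ proj Γ ⁻¹' collar Γ w c, (laplacian Γ f' (proj Γ z) *
        f' (proj Γ z) - μ * (f' (proj Γ z) * f' (proj Γ z))) ≤ K * m) ∧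
      (∫ z in dirichletDomain Γ ∩ proj Γ ⁻¹' collar Γ w c, (laplacian Γ f' (proj Γ z) *
        f' (proj Γ z) - μ * (f' (proj Γ z) * f' (proj Γ z))) ≤ 2 * K * gd w * ℓ * S ^ 2) ∧
      (m ≤ ∫ z in dirichletDomain Γ ∩ proj Γ ⁻¹' collar Γ w c, f' (proj Γ z) * f' (proj Γ z)) ∧
      (∫ z in dirichletDomain Γ ∩ proj Γ ⁻¹' collar Γ w c, f (proj Γ z) * f (proj Γ z) ≤
        K * (1 + μ) / Real.cos (gd w) ^ 2 * m) ∧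
      (∫ z in dirichletDomain Γ ∩ proj Γ ⁻¹' collar Γ w c, f (proj Γ z) * f (proj Γ z) ≤
        2 * ℓ * Real.sinh w * S ^ 2) := by
  have hℓ := hF.length_pos
  have hK := hχ.pos
  have hT := gd_lt w
  have hT0 := gd_pos hw
  have hcf := hf.continuous_comp_proj
  have hcf' := hs'.continuous_comp_proj
  have hcl := hs'.continuous_laplacian hΓ
  obtain ⟨vt, vs, vtt, vst, vss, hv⟩ := hF.exists_stripSolution hΓ hf heig
  have hP : 0 ≤ 2 * ℓ := by linarith
  have E0 := hχ.energy_eq _ hP _ _ _ _ _ _ hv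
  have E1 := hχ.energy_le _ hP _ _ _ _ _ _ hv
  have E2 := hχ.mass_le _ hP _ _ _ _ _ _ hv
  set v : ℝ × ℝ → ℝ := fun p => inFermi A f (toStrip p) with hvd
  have cv : ContinuousOn v coordDomain := hv.cont
  have cφ := continuousOn_fst_of_continuousOn (contDiffOn_profile hχ.smooth).continuousOn
  have cφ' := continuousOn_fst_of_continuousOn (contDiffOn_deriv_profile hχ.smooth).continuousOn
  have ccos : ContinuousOn (fun p : ℝ × ℝ => 1 / Real.cos p.1 ^ 2) coordDomain :=
    ContinuousOn.div (by fun_prop) (by fun_prop)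
      fun p hp => pow_ne_zero 2 (cos_pos_of_mem_coordDomain hp).ne'
  have hmeas := hF.measurableSet_preimage_collar hΓ hw.le
  have hbox := measurableSet_fermiBox (gd w) (2 * ℓ)
  have hdom : ∀ p ∈ fermiBox (gd w) (2 * ℓ), p ∈ coordDomain :=
    fun p hp => fermiBox_subset_coordDomain hT hp
  have hvS : ∀ p, v p ^ 2 ≤ S ^ 2 := fun p => sq_le_sq' (abs_le.mp (hS _)).1 (abs_le.mp (hS _)).2
  have ht := Frame.setIntegral_collar hF hΓ hw hstd
    (u := fun x => laplacian Γ f' x * f' x - μ * (f' x * f' x))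
    ((hcl.mul hcf').sub ((hcf'.mul hcf').const_mul μ)).measurable
  -- The area density `1 / cos²` cancels the factor `cos²` of the Laplacian, which leaves the flat
  -- integrals of the localization identity. The factor `1/2` accounts for the double covering.
  have hen : ∫ z in dirichletDomain Γ ∩ proj Γ ⁻¹' collar Γ w c, (laplacian Γ f' (proj Γ z) *
      f' (proj Γ z) - μ * (f' (proj Γ z) * f' (proj Γ z))) =
      (1 / 2) * ∫ p in fermiBox (gd w) (2 * ℓ), deriv (profile χ) p.1 ^ 2 * v p ^ 2 := by
    rw [ht, ← E0]
    congr 1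
    refine setIntegral_congr_ae hbox ?_
    filter_upwards [ae_abs_fst_lt (gd w) (2 * ℓ)] with p hp hpm
    have h1 := laplacian_cut hΓ hw hχ.smooth hs' hf' hv (hp hpm)
    have h2 := inFermi_cut (f := f) hw hf' (ζ := toStrip p) (hp hpm)
    rw [inFermi] at h2
    rw [h1, h2]
    have hc : Real.cos p.1 ≠ 0 := (cos_pos_of_mem_coordDomain (hdom p hpm)).ne'
    simp only [toStrip]
    field_simp
    ring
  -- The witness is the mass of `f'` for the flat area. The hyperbolic density lies between `1` and
  -- `1 / cos² (gd w)`, so flat and hyperbolic masses are comparable.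
  refine ⟨(1 / 2) * ∫ p in fermiBox (gd w) (2 * ℓ), profile χ p.1 ^ 2 * v p ^ 2, ?_, ?_, ?_, ?_, ?_,
    ?_⟩
  · exact mul_nonneg (by norm_num) (integral_nonneg fun p => by positivity)
  · rw [hen]
    linarith
  · rw [hen]
    have h1 : ∫ p in fermiBox (gd w) (2 * ℓ), deriv (profile χ) p.1 ^ 2 * v p ^ 2 ≤
        ∫ p in fermiBox (gd w) (2 * ℓ), K * S ^ 2 := by
      refine setIntegral_mono_on (integrableOn_fermiBox hT ((cφ'.pow 2).mul (cv.pow 2)))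
        (integrableOn_fermiBox hT continuousOn_const) hbox fun p hp => ?_
      exact mul_le_mul (hχ.deriv_sq_le p.1 hp.1) (hvS p) (sq_nonneg _) hK.le
    rw [setIntegral_const, volume_real_fermiBox hT0.le hP, smul_eq_mul] at h1
    linarith
  · rw [Frame.setIntegral_collar hF hΓ hw hstd (u := fun x => f' x * f' x)
      (hcf'.mul hcf').measurable]
    refine mul_le_mul_of_nonneg_left ?_ (by norm_num)
    have h1 : ∫ p in fermiBox (gd w) (2 * ℓ), 1 / Real.cos p.1 ^ 2 *
        (f' (proj Γ (fermiAt A (toStrip p))) * f' (proj Γ (fermiAt A (toStrip p)))) =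
        ∫ p in fermiBox (gd w) (2 * ℓ), 1 / Real.cos p.1 ^ 2 * (profile χ p.1 ^ 2 * v p ^ 2) := by
      refine setIntegral_congr_ae hbox ?_
      filter_upwards [ae_abs_fst_lt (gd w) (2 * ℓ)] with p hp hpm
      have h2 := inFermi_cut (f := f) hw hf' (ζ := toStrip p) (hp hpm)
      rw [inFermi] at h2
      rw [h2]
      simp only [hvd, toStrip]
      ring
    rw [h1]
    refine setIntegral_mono_on (integrableOn_fermiBox hT ((cφ.pow 2).mul (cv.pow 2)))
      (integrableOn_fermiBox hT (ccos.mul ((cφ.pow 2).mul (cv.pow 2)))) hbox fun p hp => ?_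
    refine le_mul_of_one_le_left (by positivity) ?_
    rw [one_le_div (pow_pos (cos_pos_of_mem_coordDomain (hdom p hp)) 2)]
    exact Real.cos_sq_le_one _
  · rw [Frame.setIntegral_collar hF hΓ hw hstd (u := fun x => f x * f x)
      (hcf.mul hcf).measurable]
    have hcT : 0 < Real.cos (gd w) := Real.cos_pos_of_mem_Ioo ⟨by linarith, hT⟩
    have h1 : ∫ p in fermiBox (gd w) (2 * ℓ), 1 / Real.cos p.1 ^ 2 *
        (f (proj Γ (fermiAt A (toStrip p))) * f (proj Γ (fermiAt A (toStrip p)))) ≤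
        ∫ p in fermiBox (gd w) (2 * ℓ), 1 / Real.cos (gd w) ^ 2 * v p ^ 2 := by
      refine (setIntegral_congr_fun hbox fun p hp => ?_).trans_le (setIntegral_mono_on
        (integrableOn_fermiBox hT (ccos.mul (cv.pow 2)))
        (integrableOn_fermiBox hT (continuousOn_const.mul (cv.pow 2))) hbox fun p hp => ?_)
      · change _ = 1 / Real.cos p.1 ^ 2 * v p ^ 2
        rw [sq (v p)]
        rfl
      · have := cos_le_cos_of_mem_Icc hT hp.1
        exact mul_le_mul_of_nonneg_right (one_div_le_one_div_of_le (by positivity)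
          (pow_le_pow_left₀ hcT.le this 2)) (sq_nonneg _)
    rw [integral_const_mul] at h1
    have h2 := mul_le_mul_of_nonneg_left E2 (by positivity : 0 ≤ 1 / Real.cos (gd w) ^ 2)
    have h3 := mul_le_mul_of_nonneg_left (h1.trans h2) (by norm_num : (0 : ℝ) ≤ 1 / 2)
    refine h3.trans_eq ?_
    ring
  · have hvol := hstd.volume_eq hΓ hw hℓ hmeas
    have hsub : dirichletDomain Γ ∩ proj Γ ⁻¹' collar Γ w c ⊆ dirichletDomain Γ :=
      inter_subset_left
    have hm := (isClosed_dirichletDomain (Γ := Γ)).measurableSet.inter hmeas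
    have h1 : ∫ z in dirichletDomain Γ ∩ proj Γ ⁻¹' collar Γ w c, f (proj Γ z) * f (proj Γ z) ≤
        ∫ z in dirichletDomain Γ ∩ proj Γ ⁻¹' collar Γ w c, S ^ 2 := by
      refine setIntegral_mono_on ((integrableOn_dirichletDomain hΓ (hcf.mul hcf)).mono_set hsub)
        ((integrableOn_dirichletDomain hΓ continuous_const).mono_set hsub) hm fun z _ => ?_
      rw [← sq]
      exact sq_le_sq' (abs_le.mp (hS _)).1 (abs_le.mp (hS _)).2
    have hsh := Real.sinh_pos_iff.mpr hw
    rw [setIntegral_const, Measure.real, hvol, ENNReal.toReal_ofReal (by positivity),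
      smul_eq_mul] at h1
    exact h1

end

/-! ### Summation over the collars -/

section

variable {Γ : Subgroup (Equiv.Perm ℍ)} {ℓ w μ : ℝ} {f f' : Surface Γ → ℝ}

theorem abs_le_supNorm (hΓ : IsClosedSurfaceGroup Γ) (hf : IsSmooth Γ f) (x : Surface Γ) :
    |f x| ≤ supNorm Γ f := by
  refine le_ciSup (f := fun x => |f x|) ?_ x
  obtain ⟨K, hK, hKs⟩ := hΓ.cocompact
  obtain ⟨M, hM⟩ := hK.exists_bound_of_continuousOn hf.continuous_comp_proj.continuousOn
  refine ⟨M, ?_⟩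
  rintro _ ⟨y, rfl⟩
  obtain ⟨z, hz, rfl⟩ : y ∈ proj Γ '' K := by rw [hKs]; trivial
  exact hM z hz

theorem integral_eq_add_sum (hΓ : IsClosedSurfaceGroup Γ) {k : ℕ} {U : Fin k → Set ℍ}
    (hU : ∀ i, MeasurableSet (U i)) (hd : ∀ i j, i ≠ j → Disjoint (U i) (U j)) {u : ℍ → ℝ}
    (hu : Continuous u) : ∫ z in dirichletDomain Γ, u z =
      (∫ z in dirichletDomain Γ \ ⋃ i, U i, u z) + ∑ i, ∫ z in dirichletDomain Γ ∩ U i, u z := by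
  have hi := integrableOn_dirichletDomain hΓ hu
  rw [← integral_inter_add_sdiff (MeasurableSet.iUnion hU) hi, add_comm, inter_iUnion,
    integral_iUnion_fintype (fun i => isClosed_dirichletDomain.measurableSet.inter (hU i))
      (fun i j hij => (hd i j hij).mono inter_subset_right inter_subset_right)
      fun i => hi.mono_set inter_subset_left]

/-- Here `R` is the mass off the collars, and `n i`, `M' i`, `e i` are the mass of `f`, the mass of
`f'` and the excess energy in collar `i`. Each energy has two bounds, one by the sup norm and one by
the mass that survives the cutoff; which one is used depends on whether `M ≥ 1/2`. -/
theorem quotient_le {k : ℕ} {R M E K L c₁ c₂ c₃ : ℝ} {m n e M' : Fin k → ℝ} (hK : 0 ≤ K)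
    (hc₁ : 0 ≤ c₁) (hc₂ : 0 ≤ c₂) (hc₃ : 0 ≤ c₃) (hL : 0 ≤ L) (hR : 0 ≤ R) (hm : ∀ i, 0 ≤ m i)
    (h1 : ∀ i, e i ≤ K * m i) (h2 : ∀ i, e i ≤ c₁ * L) (h3 : ∀ i, m i ≤ M' i)
    (h4 : ∀ i, n i ≤ c₂ * m i) (h5 : ∀ i, n i ≤ c₃ * L) (hM : M = R + ∑ i, M' i)
    (hone : 1 = R + ∑ i, n i) (hE : E = ∑ i, e i) :
    0 < M ∧ E / M ≤ (2 * c₁ + 2 * K * c₃) * (L * k) := by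
  have s1 : ∑ i, e i ≤ K * ∑ i, m i := by
    rw [Finset.mul_sum]; exact Finset.sum_le_sum fun i _ => h1 i
  have s2 : ∑ i, e i ≤ c₁ * (L * k) := by
    refine (Finset.sum_le_sum fun i _ => h2 i).trans_eq ?_
    simp; ring
  have s3 : ∑ i, m i ≤ ∑ i, M' i := Finset.sum_le_sum fun i _ => h3 i
  have s4 : ∑ i, n i ≤ c₂ * ∑ i, m i := by
    rw [Finset.mul_sum]; exact Finset.sum_le_sum fun i _ => h4 i
  have s5 : ∑ i, n i ≤ c₃ * (L * k) := by
    refine (Finset.sum_le_sum fun i _ => h5 i).trans_eq ?_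
    simp; ring
  have s0 : 0 ≤ ∑ i, m i := Finset.sum_nonneg fun i _ => hm i
  have hmM : ∑ i, m i ≤ M := by linarith
  have hRM : R ≤ M := by linarith
  -- If no mass survived, then `R` and all `m i` would vanish, hence also all `n i`, against total
  -- mass `1`. The constant `c₂` enters only here, so it may depend on `μ`.
  have hpos : 0 < M := by
    by_contra hcon
    have e1 : R ≤ 0 := by linarith
    have e2 := mul_le_mul_of_nonneg_left (hmM.trans (not_lt.mp hcon)) hc₂
    linarith
  have hX : 0 ≤ c₁ * (L * k) := by positivity
  have hEK : E ≤ K * M := by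
    rw [hE]; exact s1.trans (mul_le_mul_of_nonneg_left hmM hK)
  refine ⟨hpos, ?_⟩
  rw [div_le_iff₀ hpos]
  have hY : 0 ≤ c₃ * (L * k) := by positivity
  rcases le_or_gt (1 / 2) M with hM2 | hM2
  · have e1 := mul_le_mul_of_nonneg_left hM2 (by positivity : 0 ≤ 2 * (c₁ * (L * k)))
    have e2 := mul_nonneg (mul_nonneg hK hY) hpos.le
    linarith
  -- More than half of the mass of `f` lies in the collars, so `L k` is bounded below and the
  -- constant bound `E / M ≤ K` is good enough.
  · have e1 : 1 / 2 ≤ c₃ * (L * k) := by linarith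
    have e2 := mul_le_mul_of_nonneg_left e1 (by positivity : 0 ≤ 2 * K * M)
    have e3 := mul_nonneg hX hpos.le
    linarith

/-- The function `f` cut off along a family of geodesics. -/
def cutOff {k : ℕ} (A : Fin k → GL (Fin 2) ℝ) (w : ℝ) (χ : ℝ → ℝ) (f : Surface Γ → ℝ)
    (x : Surface Γ) : ℝ :=
  f x * (1 - ∑ i, cutoff Γ (A i) w χ x)

variable {k : ℕ} {c : Fin k → ℝ → Surface Γ} {A : Fin k → GL (Fin 2) ℝ} {h : Fin k → Equiv.Perm ℍ}

theorem isSmooth_cutOff (hΓ : IsClosedSurfaceGroup Γ) (hF : ∀ i, Frame Γ ℓ (c i) (A i) (h i))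
    (hw : 0 < w) (hstd : ∀ i, IsStandardCollar Γ w ℓ (c i)) {χ : ℝ → ℝ} {r₂ : ℝ} (hr0 : 0 ≤ r₂)
    (hrw : r₂ < w) (hχs : ContDiff ℝ ∞ χ) (hχ : ∀ q, Real.sinh r₂ ^ 2 ≤ q → χ q = 0)
    (hf : IsSmooth Γ f) : IsSmooth Γ (cutOff A w χ f) :=
  ContDiffOn.mul hf (contDiffOn_const.sub
    (ContDiffOn.sum fun i _ => (hF i).isSmooth_cutoff hΓ hw (hstd i) hr0 hrw hχs hχ))

theorem cutOff_of_mem (hF : ∀ i, Frame Γ ℓ (c i) (A i) (h i)) (hw : 0 < w)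
    (hdisj : ∀ i j, i ≠ j → Disjoint (collar Γ w (c i)) (collar Γ w (c j))) (χ : ℝ → ℝ) {i : Fin k}
    {x : Surface Γ} (hx : x ∈ collar Γ w (c i)) :
    cutOff A w χ f x = f x * (1 - cutoff Γ (A i) w χ x) := by
  rw [cutOff, Finset.sum_eq_single i]
  · intro j _ hji
    exact (hF j).cutoff_eq_zero hw χ fun hx' => disjoint_left.mp (hdisj j i hji) hx' hx
  · simp

theorem cutOff_of_notMem (hF : ∀ i, Frame Γ ℓ (c i) (A i) (h i)) (hw : 0 < w) (χ : ℝ → ℝ)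
    {x : Surface Γ} (hx : ∀ i, x ∉ collar Γ w (c i)) : cutOff A w χ f x = f x := by
  rw [cutOff, Finset.sum_eq_zero fun i _ => (hF i).cutoff_eq_zero hw χ (hx i), sub_zero, mul_one]

/-- Equality with `f` off the collars would not suffice, since the Laplacian needs a neighbourhood;
the cutoffs do vanish near every such point. -/
theorem laplacian_cutOff_of_notMem (hΓ : IsClosedSurfaceGroup Γ)
    (hF : ∀ i, Frame Γ ℓ (c i) (A i) (h i)) (hw : 0 < w)
    (hstd : ∀ i, IsStandardCollar Γ w ℓ (c i)) {χ : ℝ → ℝ} {r₂ : ℝ} (hr0 : 0 ≤ r₂)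
    (hrw : r₂ < w) (hχs : ContDiff ℝ ∞ χ) (hχ : ∀ q, Real.sinh r₂ ^ 2 ≤ q → χ q = 0)
    (hf : IsSmooth Γ f) {z : ℍ} (hz : ∀ i, proj Γ z ∉ collar Γ w (c i)) :
    laplacian Γ (cutOff A w χ f) (proj Γ z) = laplacian Γ f (proj Γ z) := by
  rw [laplacian_proj hΓ (isSmooth_cutOff hΓ hF hw hstd hr0 hrw hχs hχ hf), laplacian_proj hΓ hf]
  refine planeLaplacian_congr ?_
  have h1 : ∀ᶠ z' in 𝓝 z, ∀ i, cutoff Γ (A i) w χ (proj Γ z') = 0 := by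
    rw [eventually_all]
    intro i
    refine (hF i).cutoff_eventually_eq_zero hΓ hw (hstd i) hr0 hrw hχ ?_
    rintro ⟨γ, hγ, hγz⟩
    exact hz i (proj_apply hγ z ▸ (hF i).mem_collar_of_defect_le hw.le hγz.le)
  filter_upwards [h1] with z' hz'
  rw [cutOff, Finset.sum_eq_zero fun i _ => hz' i, sub_zero, mul_one]

end

end HypSurface

end

/-! ### Assembly of the estimates -/

open HypSurface MeasureTheory Set in
theorem mainTheorem6 (w : ℝ) (hw : 0 < w) :
    ∃ ε : ℝ, 0 < ε ∧ ∃ B : ℝ, 0 < B ∧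
      ∀ Γ : Subgroup (Equiv.Perm UpperHalfPlane), HypSurface.IsClosedSurfaceGroup Γ →
      ∀ (ℓ : ℝ) (k : ℕ) (γ : Fin k → ℝ → HypSurface.Surface Γ),
        (∀ i, HypSurface.IsClosedGeodesic Γ ℓ (γ i)) →
        (∀ i, HypSurface.IsStandardCollar Γ w ℓ (γ i)) →
        (∀ i j, i ≠ j →
          Disjoint (HypSurface.collar Γ w (γ i)) (HypSurface.collar Γ w (γ j))) →
      ∀ (μ : ℝ) (f : HypSurface.Surface Γ → ℝ), 0 < μ →
        HypSurface.IsNormalizedEigenfunction Γ μ f →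
        HypSurface.supNorm Γ f ^ 2 * ℓ < ε →
        ∃ f' : HypSurface.Surface Γ → ℝ,
          HypSurface.IsSmooth Γ f' ∧
          (∀ i, ∀ x ∈ HypSurface.collar Γ (w / 2) (γ i), f' x = 0) ∧
          (∀ x, (∀ i, x ∉ HypSurface.collar Γ w (γ i)) → f' x = f x) ∧
          0 < HypSurface.inner Γ f' f' ∧
          HypSurface.rayleigh Γ f' - μ ≤ B * HypSurface.supNorm Γ f ^ 2 * ℓ * k := by
  obtain ⟨χ, r₁, r₂, K, h1, h12, h2w, hK, hχ, -, -, hχ1, hχ2, hKd, hest⟩ := exists_cutoff hw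
  have hT0 := gd_pos hw
  have hsh := Real.sinh_pos_iff.mpr hw
  -- `B` is the constant `2 c₁ + 2 K c₃` of `quotient_le`, with `c₁` and `c₃` from the sup norm
  -- bounds of `Frame.collar_estimates`.
  refine ⟨1, one_pos, 2 * (2 * K * gd w) + 2 * K * (2 * Real.sinh w), by positivity, ?_⟩
  intro Γ hΓ ℓ k γ hγ hstd hdisj μ f hμ hf _
  choose A h hF using fun i => exists_frame hΓ (hγ i)
  have hbd : ProfileBounds w μ K χ :=
    ⟨hK, hχ, hKd, fun P hP v vt vs vtt vst vss hv => (hest μ hμ P hP v vt vs vtt vst vss hv).1,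
      fun P hP v vt vs vtt vst vss hv => (hest μ hμ P hP v vt vs vtt vst vss hv).2.1,
      fun P hP v vt vs vtt vst vss hv => (hest μ hμ P hP v vt vs vtt vst vss hv).2.2⟩
  have hr0 : 0 ≤ r₂ := by linarith
  have hs' := isSmooth_cutOff hΓ hF hw hstd hr0 h2w hχ hχ2 hf.smooth
  have hcf := hf.smooth.continuous_comp_proj
  have hcf' := hs'.continuous_comp_proj
  have hcl := hs'.continuous_laplacian hΓ
  set f' := cutOff A w χ f with hf'
  have hin : ∀ i z, defect (A i) z < Real.sinh w ^ 2 →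
      f' (proj Γ z) = f (proj Γ z) * (1 - χ (defect (A i) z)) := fun i z hz => by
    rw [hf', cutOff_of_mem hF hw hdisj χ ((hF i).mem_collar_of_defect_le hw.le hz.le),
      (hF i).cutoff_proj hΓ hw (hstd i) χ hz]
  have hout : ∀ x, (∀ i, x ∉ collar Γ w (γ i)) → f' x = f x :=
    fun x hx => cutOff_of_notMem hF hw χ hx
  have hzero : ∀ i, ∀ x ∈ collar Γ (w / 2) (γ i), f' x = 0 := fun i x hx => by
    have hx' : x ∈ collar Γ w (γ i) := le_trans hx (half_le_self hw.le)
    rw [hf', cutOff_of_mem hF hw hdisj χ hx',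
      (hF i).cutoff_eq_one hΓ hw (hstd i) (half_pos hw).le h1 (h12.trans h2w) hχ1 hx, sub_self,
      mul_zero]
  choose m hm e1 e2 e3 e4 e5 using fun i => (hF i).collar_estimates hΓ hw (hstd i) hbd hf.smooth
    hf.eigen (abs_le_supNorm hΓ hf.smooth) hs' (hin i)
  have hmeas : ∀ i, MeasurableSet (proj Γ ⁻¹' collar Γ w (γ i)) :=
    fun i => (hF i).measurableSet_preimage_collar hΓ hw.le
  have hd : ∀ i j, i ≠ j → Disjoint (proj Γ ⁻¹' collar Γ w (γ i)) (proj Γ ⁻¹' collar Γ w (γ j)) :=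
    fun i j hij => (hdisj i j hij).preimage _
  have hmd : MeasurableSet (dirichletDomain Γ \ ⋃ i, proj Γ ⁻¹' collar Γ w (γ i)) :=
    isClosed_dirichletDomain.measurableSet.diff (MeasurableSet.iUnion hmeas)
  have hoff : ∀ z ∈ dirichletDomain Γ \ ⋃ i, proj Γ ⁻¹' collar Γ w (γ i),
      ∀ i, proj Γ z ∉ collar Γ w (γ i) := fun z hz i hi => hz.2 (mem_iUnion.mpr ⟨i, hi⟩)
  have hM := integral_eq_add_sum hΓ hmeas hd (u := fun z => f' (proj Γ z) * f' (proj Γ z))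
    (hcf'.mul hcf')
  have hone := integral_eq_add_sum hΓ hmeas hd (u := fun z => f (proj Γ z) * f (proj Γ z))
    (hcf.mul hcf)
  have hE := integral_eq_add_sum hΓ hmeas hd (u := fun z => laplacian Γ f' (proj Γ z) *
    f' (proj Γ z) - μ * (f' (proj Γ z) * f' (proj Γ z))) ((hcl.mul hcf').sub ((hcf'.mul hcf').const_mul μ))
  have hR : ∫ z in dirichletDomain Γ \ ⋃ i, proj Γ ⁻¹' collar Γ w (γ i),
      f' (proj Γ z) * f' (proj Γ z) = ∫ z in dirichletDomain Γ \ ⋃ i, proj Γ ⁻¹' collar Γ w (γ i),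
      f (proj Γ z) * f (proj Γ z) :=
    setIntegral_congr_fun hmd fun z hz => by rw [hout _ (hoff z hz)]
  have hR0 : ∫ z in dirichletDomain Γ \ ⋃ i, proj Γ ⁻¹' collar Γ w (γ i),
      (laplacian Γ f' (proj Γ z) * f' (proj Γ z) - μ * (f' (proj Γ z) * f' (proj Γ z))) = 0 :=
    setIntegral_eq_zero_of_forall_eq_zero fun z hz => by
      rw [laplacian_cutOff_of_notMem hΓ hF hw hstd hr0 h2w hχ hχ2 hf.smooth (hoff z hz), hf.eigen,
        hout _ (hoff z hz)]
      ring
  rw [hR0, zero_add] at hE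
  have hn : ∫ z in dirichletDomain Γ, f (proj Γ z) * f (proj Γ z) = 1 := hf.normalized
  rw [hn, ← hR] at hone
  have hnn : 0 ≤ ∫ z in dirichletDomain Γ \ ⋃ i, proj Γ ⁻¹' collar Γ w (γ i),
      f' (proj Γ z) * f' (proj Γ z) := integral_nonneg fun z => mul_self_nonneg _
  -- For `k = 0` nothing fixes the sign of `ℓ`, while `quotient_le` needs `L ≥ 0`. Hence `|ℓ|` is
  -- used there; the factor `k` makes the difference irrelevant in the end.
  have habs : ∀ i : Fin k, |ℓ| = ℓ := fun i => abs_of_pos (hγ i).length_pos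
  obtain ⟨hpos, hq⟩ := quotient_le (L := supNorm Γ f ^ 2 * |ℓ|) (c₁ := 2 * K * gd w)
    (c₂ := K * (1 + μ) / Real.cos (gd w) ^ 2) (c₃ := 2 * Real.sinh w) hK.le (by positivity)
    (by positivity) (by positivity) (by positivity) hnn hm e1
    (fun i => (e2 i).trans_eq (by rw [habs i]; ring)) e3 e4
    (fun i => (e5 i).trans_eq (by rw [habs i]; ring)) hM hone hE
  refine ⟨f', hs', hzero, hout, hpos, ?_⟩
  have hi1 := integrableOn_dirichletDomain hΓ
    (u := fun z => laplacian Γ f' (proj Γ z) * f' (proj Γ z)) (hcl.mul hcf')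
  have hi2 := integrableOn_dirichletDomain hΓ
    (u := fun z => μ * (f' (proj Γ z) * f' (proj Γ z))) ((hcf'.mul hcf').const_mul μ)
  rw [integral_sub hi1 hi2, integral_const_mul, sub_div, mul_div_assoc, div_self hpos.ne',
    mul_one] at hq
  have hk : |ℓ| * k = ℓ * k := by
    rcases Nat.eq_zero_or_pos k with rfl | hk
    · simp
    · rw [habs ⟨0, hk⟩]
  refine hq.trans_eq ?_
  rw [mul_assoc (supNorm Γ f ^ 2), hk]
  ring
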